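/- **Theorem (consistency of the variance estimator).** *Regressors.* Let $(\varepsilon_i)_{i\in\mathbb Z}$ be iid, $\mathcal F_t=\sigma(\dots,\varepsilon_{t-1},\varepsilon_t)$, and let $X_i=h(\varepsilon_i,\varepsilon_{i-1},\dots)$, $i\in\mathbb Z$, be real-valued, with $h$ measurable. Let $X_i$ have density $g$ and, for $k\ge 1$, let $g_k(\cdot\mid\mathcal F_0)$ be (a version, chosen as a jointly measurable function of the argument and of the past $(\varepsilon_0,\varepsilon_{-1},\dots)$, of) the conditional density of $X_k$ given $\mathcal F_0$. Let $\varepsilon_0'$ be a copy of $\varepsilon_0$ independent of $(\varepsilon_i)$, let $g_k(\cdot\mid\mathcal F_0^*)$ be $g_k(\cdot\mid\mathcal F_0)$ with $\varepsilon_0$ replaced by $\varepsilon_0'$, and put $\theta_t=\sup_{y\in\mathbb R}\|g_t(y\mid\mathcal F_0)-g_t(y\mid\mathcal F_0^*)\|_{L^2}$. Assume $\Theta_\infty=\sum_{t\ge1}\theta_t<\infty$. *Data and model.* Fix $\tau\in(0,1)$ and put $\rho_\tau(u)=u(\tau-\mathbf 1\{u<0\})$. For each sample size $n$ and $1\le t\le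 n$ there are observations $Y_{tj}$, $j\in\Gamma_t$, with $\Gamma_t$ finite; $\Gamma_t$, $Y_{tj}$ and hence the quantities below may depend on $n$, and for each $t$, $|\Gamma_t|\to\infty$ as $n\to\infty$. Let $Q_t$ be a sample $\tau$-quantile, that is, a minimiser of $m\mapsto\sum_{j\in\Gamma_t}\rho_\tau(Y_{tj}-m)$, and assume that almost surely $$Q_t=\mu(X_t)+\sigma(X_t)e_t,\qquad t=1,\dots,n,$$ with $\mu,\sigma$ measurable, $\sigma>0$, and $e_1,\dots,e_n$ iid with a law not depending on $n$, $\mathbb E e_t=0$, $\mathbb E e_t^2=1$, such that $e_t$ is independent of the $\sigma$-field generated by $\mathcal F_t$ and $e_1,\dots,e_{t-1}$. *Kernel and bandwidth.* Let $K:\mathbb R\to\mathbb R$ be bounded, symmetric and Lipschitz (with bounded derivative where it exists), with $\int K=1$, $\int K^2<\infty$ and $u\mapsto u^2K(u)$ integrable. Assume moreover that either (i) $K$ has compact support, or (ii) $K$ is nonincreasing on $[0,\infty)$ and $\mathbb E[\mu(X_0)^2]<\infty$, $\mathbb E[\sigma(X_0)^2]<\infty$. Let $b_n\to0$, $nb_n\to\infty$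 and $\log n/(nb_n^3)\to0$. *Estimators.* Put $$\hat g(y;b)=\frac1{nb}\sum_{t=1}^nK\Big(\frac{y-X_t}b\Big),\qquad \hat\mu(y;b)=\frac1{nb\,\hat g(y;b)}\sum_{t=1}^nK\Big(\frac{y-X_t}b\Big)Q_t,$$ $$\hat\mu^*(y;b)=2\hat\mu(y;b)-\hat\mu(y;\sqrt2\,b),\qquad K_2(u)=2K(u)-2^{-1/2}K(u/\sqrt2),$$ $$\hat\sigma^2(y;b)=\frac1{nb\,\hat g(y;b)}\sum_{t=1}^nK_2\Big(\frac{y-X_t}b\Big)\big(Q_t-\hat\mu^*(X_t;b)\big)^2$$ (a quotient with zero denominator is read as $0$). *Favourable point.* Let $x\in\mathbb R$ be such that for some ball $B=B(x,\epsilon)$, $\epsilon>0$: $\mu,\sigma,g$ are four times differentiable on $B$ with bounded fourth derivatives, $\inf_B\sigma>0$, $\inf_Bg>0$, and $\sup_{y\in B}g_1(y\mid\mathcal F_0)\le M$ almost surely for some constant $M$. *Conclusion.* Then $\hat\sigma^2(x;b_n)\to\sigma^2(x)$ in probability as $n\to\infty$. -/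

import Mathlib

open MeasureTheory ProbabilityTheory Filter
open scoped Topology ENNReal

noncomputable section

/-! ### Replicated data and sample quantiles -/

/-- The check function `ρ_τ(u) = u (τ - 1{u < 0})`. -/
def checkLoss (τ u : ℝ) : ℝ := u * (τ - if u < 0 then 1 else 0)

/-- `q` is a sample `τ`-quantile of the finite family `(y j)_{j ∈ Γ}`: a minimiser of
`m ↦ ∑_{j ∈ Γ} ρ_τ(y j - m)` over the whole line. -/
def IsSampleQuantile {ι : Type*} (τ : ℝ) (Γ : Finset ι) (y : ι → ℝ) (q : ℝ) : Prop :=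
  ∀ m : ℝ, ∑ j ∈ Γ, checkLoss τ (y j - q) ≤ ∑ j ∈ Γ, checkLoss τ (y j - m)

/-! ### The regressor process and its dependence measure -/

section Regressors

variable {Ω E : Type*} [MeasurableSpace Ω] [MeasurableSpace E]

/-- The past `ξ_t = (ε_t, ε_{t-1}, ε_{t-2}, …)` of the innovations. -/
def past {Ω' : Type*} (ε : ℤ → Ω' → E) (t : ℤ) (ω : Ω') : ℕ → E := fun s => ε (t - (s : ℤ)) ω

/-- `ℱ_t`, the σ-field generated by `(…, ε_{t-1}, ε_t)`. -/
abbrev innovationField (ε : ℤ → Ω → E) (t : ℤ) : MeasurableSpace Ω :=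
  MeasurableSpace.comap (past ε t) inferInstance

/-- The innovations `(ε_i)_{i ∈ ℤ}` are independent and identically distributed. -/
structure IsIIDInnovation (P : Measure Ω) (ε : ℤ → Ω → E) : Prop where
  measurable : ∀ i, Measurable (ε i)
  indep : iIndepFun ε P
  identDistrib : ∀ i, IdentDistrib (ε i) (ε 0) P P

/-- The regressors `X_i = h(ε_i, ε_{i-1}, ε_{i-2}, …)`. -/
def regressor (h : (ℕ → E) → ℝ) (ε : ℤ → Ω → E) (i : ℤ) (ω : Ω) : ℝ := h (past ε i ω)

/-- `g` is a probability density of the real random variable `Z`. -/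
structure IsDensityOf (P : Measure Ω) (Z : Ω → ℝ) (g : ℝ → ℝ) : Prop where
  measurable : Measurable g
  nonneg : ∀ y, 0 ≤ g y
  map_eq : P.map Z = volume.withDensity fun y => ENNReal.ofReal (g y)

/-- `y ↦ γ k y ξ_0` is, for every `k ≥ 1`, a version of the conditional density `g_k(y ∣ ℱ_0)` of
`X_k` given `ℱ_0`, written as a measurable function of `y` and of the past
`ξ_0 = (ε_0, ε_{-1}, …)`. -/
structure IsCondDensity (P : Measure Ω) (ε : ℤ → Ω → E) (X : ℤ → Ω → ℝ)
    (γ : ℕ → ℝ → (ℕ → E) → ℝ) : Prop where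
  measurable : ∀ k, 1 ≤ k → Measurable fun p : ℝ × (ℕ → E) => γ k p.1 p.2
  nonneg : ∀ k, 1 ≤ k → ∀ y ξ, 0 ≤ γ k y ξ
  condProb : ∀ k : ℕ, 1 ≤ k → ∀ A : Set ℝ, MeasurableSet A →
    P⟦X (k : ℤ) ⁻¹' A | innovationField ε 0⟧ =ᵐ[P] fun ω => ∫ y in A, γ k y (past ε 0 ω)

/-- The coupled innovations `ε*_i = ε_i` for `i ≠ 0` and `ε*_0 = ε'_0`, realised on `Ω × Ω` (with
the product measure): the first coordinate carries `ε`, the second its independent copy `ε'`. -/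
def coupled (ε : ℤ → Ω → E) (i : ℤ) (p : Ω × Ω) : E := if i = 0 then ε i p.2 else ε i p.1

/-- `θ_t = sup_y ‖ g_t(y ∣ ℱ_0) - g_t(y ∣ ℱ_0^*) ‖`, the norm being that of `L²`. -/
def dependenceMeasure (P : Measure Ω) (ε : ℤ → Ω → E) (γ : ℕ → ℝ → (ℕ → E) → ℝ) (t : ℕ) : ℝ≥0∞ :=
  ⨆ y : ℝ, eLpNorm
    (fun p : Ω × Ω => γ t y (past ε 0 p.1) - γ t y (past (coupled ε) 0 p)) 2 (P.prod P)

/-- `Θ_∞ = ∑_{t ≥ 1} θ_t`. -/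
def totalDependence (P : Measure Ω) (ε : ℤ → Ω → E) (γ : ℕ → ℝ → (ℕ → E) → ℝ) : ℝ≥0∞ :=
  ∑' t : ℕ, dependenceMeasure P ε γ (t + 1)

/-- The errors `e_{n,t}`, `1 ≤ t ≤ n`: in every row `n` they are iid, with one common law for all
rows, mean zero and variance one, and `e_{n,t}` is independent of the σ-field generated by
`(…, ε_{t-1}, ε_t)` and the earlier errors `e_{n,1}, …, e_{n,t-1}`. -/
structure IsErrorArray (P : Measure Ω) (ε : ℤ → Ω → E) (e : ℕ → ℕ → Ω → ℝ) : Prop where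
  measurable : ∀ n, ∀ t ∈ Finset.Icc 1 n, Measurable (e n t)
  memLp : ∀ n, ∀ t ∈ Finset.Icc 1 n, MemLp (e n t) 2 P
  indep : ∀ n, iIndepFun (fun t : Finset.Icc 1 n => e n t) P
  identDistrib : ∀ n, ∀ t ∈ Finset.Icc 1 n, IdentDistrib (e n t) (e 1 1) P P
  mean_zero : ∀ n, ∀ t ∈ Finset.Icc 1 n, ∫ ω, e n t ω ∂P = 0
  variance_one : ∀ n, ∀ t ∈ Finset.Icc 1 n, ∫ ω, (e n t ω) ^ 2 ∂P = 1
  indep_past : ∀ n, ∀ t ∈ Finset.Icc 1 n,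
    Indep (MeasurableSpace.comap (e n t) inferInstance)
      (innovationField ε (t : ℤ) ⊔
        ⨆ s ∈ Finset.Ico 1 t, MeasurableSpace.comap (e n s) inferInstance) P

end Regressors

/-! ### Regularity conditions -/

/-- `f` is four times differentiable on the (open) set `s`, with bounded fourth derivative there. -/
def HasBoundedFourthDeriv (f : ℝ → ℝ) (s : Set ℝ) : Prop :=
  (∀ k < 4, ∀ y ∈ s, DifferentiableAt ℝ (iteratedDeriv k f) y) ∧
    ∃ C : ℝ, ∀ y ∈ s, |iteratedDeriv 4 f y| ≤ C

/-- The point `x` is favourable. -/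
def IsFavourable {Ω E : Type*} [MeasurableSpace Ω] (P : Measure Ω) (ε : ℤ → Ω → E)
    (γ : ℕ → ℝ → (ℕ → E) → ℝ) (μ σ g : ℝ → ℝ) (x : ℝ) : Prop :=
  ∃ r : ℝ, 0 < r ∧
    HasBoundedFourthDeriv μ (Metric.ball x r) ∧
    HasBoundedFourthDeriv σ (Metric.ball x r) ∧
    HasBoundedFourthDeriv g (Metric.ball x r) ∧
    (∃ c : ℝ, 0 < c ∧ ∀ y ∈ Metric.ball x r, c ≤ σ y) ∧
    (∃ c : ℝ, 0 < c ∧ ∀ y ∈ Metric.ball x r, c ≤ g y) ∧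
    ∃ M : ℝ, ∀ᵐ ω ∂P, ∀ y ∈ Metric.ball x r, γ 1 y (past ε 0 ω) ≤ M

/-- Admissible kernels. The derivative is asked to be bounded where it exists; a Lipschitz function
is differentiable almost everywhere. -/
structure IsSmoothingKernel (K : ℝ → ℝ) : Prop where
  bounded : ∃ C : ℝ, ∀ u, |K u| ≤ C
  symmetric : ∀ u, K (-u) = K u
  lipschitz : ∃ L, LipschitzWith L K
  deriv_bounded : ∃ C : ℝ, ∀ u, DifferentiableAt ℝ K u → |deriv K u| ≤ C
  integrable : Integrable K
  integral_eq_one : ∫ u, K u = 1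
  integrable_sq : Integrable fun u => K u ^ 2
  integrable_sq_mul : Integrable fun u => u ^ 2 * K u

/-! ### The estimators, as functions of the data `X_1, …, X_n` and `Q_1, …, Q_n` -/

/-- `ĝ(x; b) = (n b)⁻¹ ∑_{t=1}^n K((x - X_t) / b)`. -/
def kernelDensity (K : ℝ → ℝ) (n : ℕ) (X : ℕ → ℝ) (b x : ℝ) : ℝ :=
  1 / (n * b) * ∑ t ∈ Finset.Icc 1 n, K ((x - X t) / b)

/-- `μ̂(x; b) = (n b ĝ(x; b))⁻¹ ∑_{t=1}^n K((x - X_t) / b) Q_t`. -/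
def meanEstimator (K : ℝ → ℝ) (n : ℕ) (X Q : ℕ → ℝ) (b x : ℝ) : ℝ :=
  1 / (n * b * kernelDensity K n X b x) * ∑ t ∈ Finset.Icc 1 n, K ((x - X t) / b) * Q t

/-- The jackknife estimator `μ̂*_l(x; b) = (l μ̂(x; b) - μ̂(x; √l b)) / (l - 1)`. -/
def jackknifeEstimator (l : ℝ) (K : ℝ → ℝ) (n : ℕ) (X Q : ℕ → ℝ) (b x : ℝ) : ℝ :=
  (l * meanEstimator K n X Q b x - meanEstimator K n X Q (√l * b) x) / (l - 1)

/-- `K_l(u) = (l K(u) - l^{-1/2} K(u / √l)) / (l - 1)`. -/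
def jackknifeKernel (l : ℝ) (K : ℝ → ℝ) (u : ℝ) : ℝ :=
  (l * K u - (√l)⁻¹ * K (u / √l)) / (l - 1)

/-- `σ̂²(x; b) = (n b ĝ(x; b))⁻¹ ∑_{t=1}^n K_2((x - X_t) / b) (Q_t - μ̂*_2(X_t; b))²`. -/
def varianceEstimator (K : ℝ → ℝ) (n : ℕ) (X Q : ℕ → ℝ) (b x : ℝ) : ℝ :=
  1 / (n * b * kernelDensity K n X b x) *
    ∑ t ∈ Finset.Icc 1 n, jackknifeKernel 2 K ((x - X t) / b) *
      (Q t - jackknifeEstimator 2 K n X Q b (X t)) ^ 2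

end

/-! Up to the factor $\hat g(x)\to g(x)>0$, the estimator is a kernel average of the squared
residuals $(Q_t-\hat\mu^*(X_t))^2$. Design points near $x$ carry the bulk of the kernel weight.
There $\hat\mu^*$ is uniformly close to $\mu$, so the residual is $\sigma(X_t)e_t+o(1)$; the squares
can be replaced by $\sigma^2(X_t)e_t^2$, and a weak law of large numbers finishes the proof because
$K_2$ has integral one. Four ingredients make this rigorous.

Dependence. With $\xi_t$ the past at time $t$, $\varphi(X_t)-\mathbb
E\varphi(X_0)=\sum_{k\ge0}D_k(\xi_{t-k})$, where $D_k$ is the change in the forecast of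
$\varphi(X_t)$ when the innovation at time $t-k$ is revealed. For a fixed lag these are orthogonal
in $t$, so Minkowski over lags bounds the $L^2$ norm of the centred sum by $\sqrt n\sum_k\|D_k\|$
(`IsForecast.eLpNorm_sum_sub_le`). Coupling gives $\|D_k\|\le\theta_k\int|\varphi|$ for $k\ge1$, and
$\|D_0\|\le\|\varphi(X_0)\|$. For a kernel localised at scale $b$ the variance of the normalised sum
is then $O(1/(nb))$, as under independence.

Uniformity. A grid, Chebyshev's inequality at each grid point and a Lipschitz bound between grid
points turn the $O(1/(nb))$ second moments into uniform smallness on an interval; the cost is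
$nb^3\to\infty$ (`eventually_forall_abs_le_of_lipschitz`). This yields uniform consistency of $\hat
g$ and, with martingale differences for the noise, of $\hat\mu$
(`IsLocalDesign.eventually_meanEstimator`).

Squared errors. Only $\mathbb Ee_t^2<\infty$ is available, so $e_t^2-1$ is truncated: the bounded
part is treated in $L^2$, the tail in $L^1$ (`IsLocalDesign.tendsto_localAverage_sq_sub_one`).

Distant points. Away from $x$ nothing is known about $\mu,\sigma,g$ or the accuracy of $\hat\mu^*$.
A compactly supported kernel eventually ignores these points. A monotone one decays cubically,
giving them total weight $O(b^2)$ after normalisation, and it suffices that the squared residuals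
sum to $O_P(n)$. This follows from the deterministic stability bound $\sum_t\hat\mu(X_t)^2\le
D\sum_tQ_t^2$ (`exists_sum_meanEstimator_sq_le`), a cell-counting argument.

Convergence in probability is phrased along `probFilter`, so that events holding with probability
tending to one, including those uniform in $y$, are intersected by `filter_upwards`. -/

noncomputable section

set_option linter.unusedSectionVars false

/-! ### Convergence in probability as convergence along a filter -/

section ProbFilter

variable {Ω : Type*} [MeasurableSpace Ω] {P : Measure Ω}

/-- The filter on `ℕ × Ω` of the sets whose sections have probability tending to one. Convergence
in probability is convergence along this filter. -/
def probFilter (P : Measure Ω) : Filter (ℕ × Ω) where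
  sets := {s | Tendsto (fun n => P {ω | (n, ω) ∉ s}) atTop (𝓝 0)}
  univ_sets := by simp
  sets_of_superset := by
    intro s t hs hst
    refine tendsto_of_tendsto_of_tendsto_of_le_of_le tendsto_const_nhds hs (fun _ => zero_le)
      fun n => measure_mono ?_
    exact fun ω hω h => hω (hst h)
  inter_sets := by
    intro s t hs ht
    have hadd := Tendsto.add hs ht
    rw [add_zero] at hadd
    refine tendsto_of_tendsto_of_tendsto_of_le_of_le tendsto_const_nhds hadd (fun _ => zero_le)
      fun n => ?_
    refine le_trans (measure_mono ?_) (measure_union_le _ _)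
    intro ω hω
    by_cases h : (n, ω) ∈ s
    · exact Or.inr fun h' => hω ⟨h, h'⟩
    · exact Or.inl h

theorem eventually_probFilter {p : ℕ × Ω → Prop} :
    (∀ᶠ z in probFilter P, p z) ↔ Tendsto (fun n => P {ω | ¬ p (n, ω)}) atTop (𝓝 0) :=
  Iff.rfl

theorem tendsto_fst_probFilter : Tendsto Prod.fst (probFilter P) atTop := by
  intro s hs
  refine tendsto_const_nhds.congr' ?_
  filter_upwards [hs] with n hn
  simp [hn]

theorem eventually_probFilter_of_ae {p : ℕ × Ω → Prop} (h : ∀ n, ∀ᵐ ω ∂P, p (n, ω)) :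
    ∀ᶠ z in probFilter P, p z :=
  eventually_probFilter.2 (tendsto_const_nhds.congr fun n => (ae_iff.1 (h n)).symm)

theorem tendstoInMeasure_of_tendsto_probFilter {f : ℕ → Ω → ℝ} {c : ℝ}
    (h : Tendsto (fun z : ℕ × Ω => f z.1 z.2) (probFilter P) (𝓝 c)) :
    TendstoInMeasure P f atTop fun _ => c := by
  intro ε hε
  have := eventually_probFilter.1 (h.eventually (Metric.eball_mem_nhds c hε))
  refine this.congr fun n => ?_
  congr 1
  ext ω
  simp

/-- Markov's inequality for sequences. -/
theorem tendsto_probFilter_of_integral_le [IsFiniteMeasure P] {f : ℕ → Ω → ℝ} {c : ℕ → ℝ}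
    (hint : ∀ᶠ n in atTop, Integrable (f n) P) (hle : ∀ᶠ n in atTop, ∫ ω, |f n ω| ∂P ≤ c n)
    (hc : Tendsto c atTop (𝓝 0)) :
    Tendsto (fun z : ℕ × Ω => f z.1 z.2) (probFilter P) (𝓝 0) := by
  rw [Metric.tendsto_nhds]
  intro ε hε
  rw [eventually_probFilter]
  have hreal : Tendsto (fun n => P.real {ω | ε ≤ |f n ω|}) atTop (𝓝 0) := by
    have hc' : Tendsto (fun n => c n / ε) atTop (𝓝 0) := by simpa using hc.div_const ε
    refine squeeze_zero' (Eventually.of_forall fun n => measureReal_nonneg) ?_ hc'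
    filter_upwards [hint, hle] with n hi hn
    rw [le_div_iff₀' hε]
    exact (mul_meas_ge_le_integral_of_nonneg (Eventually.of_forall fun _ => abs_nonneg _)
      hi.abs ε).trans hn
  have := ENNReal.tendsto_ofReal hreal
  rw [ENNReal.ofReal_zero] at this
  refine this.congr fun n => ?_
  simp [ofReal_measureReal]

/-- A process with small second moments and a moderate random Lipschitz constant is uniformly
small on a compact interval. -/
theorem eventually_forall_abs_le_of_lipschitz [IsFiniteMeasure P] {F : ℕ → ℝ → Ω → ℝ}
    {Λ : ℕ → Ω → ℝ} {b : ℕ → ℝ} {x ρ C C' : ℝ} (hρ : 0 < ρ) (hb : Tendsto b atTop (𝓝 0))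
    (hbpos : ∀ᶠ n in atTop, 0 < b n)
    (hnb3 : Tendsto (fun n : ℕ => n * b n ^ 3) atTop atTop)
    (hint : ∀ᶠ n in atTop, ∀ y, Integrable (fun ω => F n y ω ^ 2) P)
    (hle : ∀ᶠ n in atTop, ∀ y ∈ Metric.closedBall x ρ, ∫ ω, F n y ω ^ 2 ∂P ≤ C / (n * b n))
    (hΛint : ∀ᶠ n in atTop, Integrable (Λ n) P)
    (hΛle : ∀ᶠ n in atTop, ∫ ω, |Λ n ω| ∂P ≤ C')
    (hlip : ∀ᶠ n in atTop, ∀ ω, ∀ y ∈ Metric.closedBall x ρ, ∀ z ∈ Metric.closedBall x ρ,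
      |F n y ω - F n z ω| ≤ Λ n ω * (|y - z| / b n ^ 2))
    {ε : ℝ} (hε : 0 < ε) :
    ∀ᶠ p in probFilter P, ∀ y ∈ Metric.closedBall x ρ, |F p.1 y p.2| ≤ ε := by
  -- The grid size balances two errors: the sum of $N$ second moments of order $1/(nb)$, and the
  -- Lipschitz gap of order $1/(Nb^2)$. With $N\approx\sqrt{nb^3}/b^2$ the leading order of both is
  -- $(nb^3)^{-1/2}$.
  set N : ℕ → ℕ := fun n => ⌈√(n * b n ^ 3) / b n ^ 2⌉₊ with hN
  set pt : ℕ → ℕ → ℝ := fun n i => x - ρ + i * (2 * ρ / N n) with hpt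
  have hsqrt : Tendsto (fun n : ℕ => √(n * b n ^ 3)) atTop atTop :=
    Real.tendsto_sqrt_atTop.comp hnb3
  have hNpos : ∀ᶠ n in atTop, 0 < N n := by
    filter_upwards [hbpos, hnb3.eventually_gt_atTop 0] with n h1 h2
    exact Nat.ceil_pos.2 (by positivity)
  have hptmem : ∀ n, 0 < N n → ∀ i ∈ Finset.range (N n + 1),
      pt n i ∈ Metric.closedBall x ρ := by
    intro n hn i hi
    have hi' : (i : ℝ) ≤ N n := by exact_mod_cast Nat.lt_succ_iff.1 (Finset.mem_range.1 hi)
    have hn' : (0 : ℝ) < N n := by exact_mod_cast hn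
    have : (i : ℝ) * (2 * ρ / N n) ≤ 2 * ρ := by
      rw [mul_div_assoc', div_le_iff₀ hn']
      nlinarith
    have : 0 ≤ (i : ℝ) * (2 * ρ / N n) := by positivity
    rw [Metric.mem_closedBall, Real.dist_eq, abs_le]
    constructor <;> simp only [hpt] <;> linarith
  -- the maximum over the grid
  have hgrid : Tendsto (fun p : ℕ × Ω => ∑ i ∈ Finset.range (N p.1 + 1), F p.1 (pt p.1 i) p.2 ^ 2)
      (probFilter P) (𝓝 0) := by
    refine tendsto_probFilter_of_integral_le
      (f := fun n ω => ∑ i ∈ Finset.range (N n + 1), F n (pt n i) ω ^ 2)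
      (c := fun n => |C| * (1 / √(n * b n ^ 3) + 2 * (b n ^ 2 * (1 / (n * b n ^ 3))))) ?_ ?_ ?_
    · filter_upwards [hint] with n hn
      exact integrable_finsetSum _ fun i _ => hn _
    · filter_upwards [hint, hle, hNpos, hbpos, hnb3.eventually_gt_atTop 0] with n h1 h2 h3 h4 h5
      have hn0 : (0 : ℝ) < n := by
        by_contra h0
        nlinarith [pow_pos h4 3]
      have habs : ∀ ω, |∑ i ∈ Finset.range (N n + 1), F n (pt n i) ω ^ 2|
          = ∑ i ∈ Finset.range (N n + 1), F n (pt n i) ω ^ 2 :=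
        fun ω => abs_of_nonneg (Finset.sum_nonneg fun i _ => sq_nonneg _)
      simp_rw [habs]
      rw [integral_finsetSum _ fun i _ => h1 _]
      have hb1 : ∑ i ∈ Finset.range (N n + 1), ∫ ω, F n (pt n i) ω ^ 2 ∂P
          ≤ (N n + 1) * (|C| / (n * b n)) := by
        refine (Finset.sum_le_sum (g := fun _ => |C| / (n * b n)) fun i hi =>
          (h2 _ (hptmem n h3 i hi)).trans ?_).trans (by simp)
        gcongr
        exact le_abs_self C
      refine hb1.trans ?_
      have hNle : (N n : ℝ) + 1 ≤ √(n * b n ^ 3) / b n ^ 2 + 2 := by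
        have := (Nat.ceil_lt_add_one (a := √(n * b n ^ 3) / b n ^ 2) (by positivity)).le
        linarith
      have hs : √(n * b n ^ 3) * √(n * b n ^ 3) = n * b n ^ 3 := Real.mul_self_sqrt h5.le
      have hs0 : 0 < √(n * b n ^ 3) := Real.sqrt_pos.2 h5
      calc ((N n : ℝ) + 1) * (|C| / (n * b n))
          ≤ (√(n * b n ^ 3) / b n ^ 2 + 2) * (|C| / (n * b n)) := by gcongr
        _ = |C| * (√(n * b n ^ 3) / (n * b n ^ 3) + 2 * (b n ^ 2 * (1 / (n * b n ^ 3)))) := by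
          field_simp
        _ = _ := by
          congr 2
          rw [div_eq_div_iff h5.ne' hs0.ne', hs, one_mul]
    · have h1 : Tendsto (fun n : ℕ => 1 / √(n * b n ^ 3)) atTop (𝓝 0) := by
        exact hsqrt.inv_tendsto_atTop.congr fun n => (one_div _).symm
      have h2 : Tendsto (fun n : ℕ => 1 / (n * b n ^ 3)) atTop (𝓝 0) := by
        exact hnb3.inv_tendsto_atTop.congr fun n => (one_div _).symm
      have := (h1.add (((hb.pow 2).mul h2).const_mul 2)).const_mul |C|
      simpa using this
  have hstep : Tendsto (fun p : ℕ × Ω => Λ p.1 p.2 * (2 * ρ / √(p.1 * b p.1 ^ 3)))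
      (probFilter P) (𝓝 0) := by
    refine tendsto_probFilter_of_integral_le
      (f := fun n ω => Λ n ω * (2 * ρ / √(n * b n ^ 3)))
      (c := fun n => C' * (2 * ρ * (1 / √(n * b n ^ 3)))) ?_ ?_ ?_
    · filter_upwards [hΛint] with n hn
      exact hn.mul_const _
    · filter_upwards [hΛle] with n hn
      have h0 : 0 ≤ 2 * ρ / √(n * b n ^ 3) := by positivity
      simp_rw [abs_mul, abs_of_nonneg h0]
      rw [integral_mul_const, ← mul_one_div (2 * ρ)]
      exact mul_le_mul_of_nonneg_right hn (by positivity)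
    · have h1 : Tendsto (fun n : ℕ => 1 / √(n * b n ^ 3)) atTop (𝓝 0) := by
        exact hsqrt.inv_tendsto_atTop.congr fun n => (one_div _).symm
      simpa using (h1.const_mul (2 * ρ)).const_mul C'
  have e1 := hgrid.eventually (gt_mem_nhds (show (0 : ℝ) < (ε / 2) ^ 2 by positivity))
  have e2 := hstep.eventually (gt_mem_nhds (show (0 : ℝ) < ε / 2 by positivity))
  filter_upwards [e1, e2, tendsto_fst_probFilter.eventually hNpos,
    tendsto_fst_probFilter.eventually hlip, tendsto_fst_probFilter.eventually hbpos,
    tendsto_fst_probFilter.eventually (hnb3.eventually_gt_atTop 0)]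
    with ⟨n, ω⟩ h1 h2 h3 h4 h5 h6 y hy
  have hN0 : (0 : ℝ) < N n := by exact_mod_cast h3
  -- Nonnegativity of the Lipschitz constant is forced by the Lipschitz bound itself, read at two
  -- distinct points of the ball.
  have hΛ0 : 0 ≤ Λ n ω := by
    have h7 : 0 ≤ Λ n ω * (|(x + ρ) - x| / b n ^ 2) :=
      (abs_nonneg _).trans (h4 ω (x + ρ) (by simp [abs_of_pos hρ]) x (by simp [hρ.le]))
    have h8 : 0 < |(x + ρ) - x| / b n ^ 2 := by
      have : |x + ρ - x| = ρ := by rw [add_sub_cancel_left, abs_of_pos hρ]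
      rw [this]
      exact div_pos hρ (pow_pos h5 2)
    exact nonneg_of_mul_nonneg_left h7 h8
  rw [Metric.mem_closedBall, Real.dist_eq, abs_le] at hy
  set s : ℝ := (y - (x - ρ)) / (2 * ρ / N n) with hs
  have hd0 : 0 < 2 * ρ / N n := by positivity
  have hs0 : 0 ≤ s := div_nonneg (by linarith [hy.1]) hd0.le
  have hsN : s ≤ N n := by
    rw [hs, div_le_iff₀ hd0, mul_div_cancel₀ _ hN0.ne']
    linarith [hy.2]
  have hiN : ⌊s⌋₊ ∈ Finset.range (N n + 1) := by
    rw [Finset.mem_range, Nat.lt_succ_iff]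
    exact_mod_cast (Nat.floor_le hs0).trans hsN
  have hclose : |y - pt n ⌊s⌋₊| ≤ 2 * ρ / N n := by
    have hy' : y = x - ρ + s * (2 * ρ / N n) := by
      rw [hs, div_mul_cancel₀ _ hd0.ne']
      ring
    have : y - pt n ⌊s⌋₊ = (s - ⌊s⌋₊) * (2 * ρ / N n) := by
      simp only [hpt]
      rw [hy']
      ring
    rw [this, abs_of_nonneg (mul_nonneg (by linarith [Nat.floor_le hs0]) hd0.le)]
    have := Nat.lt_floor_add_one s
    nlinarith
  have hl := h4 ω y (by rw [Metric.mem_closedBall, Real.dist_eq, abs_le]; exact hy) _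
    (hptmem n h3 _ hiN)
  have hNge : √(n * b n ^ 3) / b n ^ 2 ≤ N n := Nat.le_ceil _
  have hs6 : 0 < √(n * b n ^ 3) := Real.sqrt_pos.2 h6
  have hstep' : |y - pt n ⌊s⌋₊| / b n ^ 2 ≤ 2 * ρ / √(n * b n ^ 3) := by
    rw [div_le_div_iff₀ (pow_pos h5 2) hs6]
    rw [div_le_iff₀ (pow_pos h5 2)] at hNge
    calc |y - pt n ⌊s⌋₊| * √(n * b n ^ 3) ≤ 2 * ρ / N n * (N n * b n ^ 2) := by gcongr
      _ = 2 * ρ * b n ^ 2 := by field_simp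
  have hA : |F n y ω - F n (pt n ⌊s⌋₊) ω| < ε / 2 :=
    (hl.trans (mul_le_mul_of_nonneg_left hstep' hΛ0)).trans_lt h2
  have hB : |F n (pt n ⌊s⌋₊) ω| < ε / 2 := by
    have : F n (pt n ⌊s⌋₊) ω ^ 2 < (ε / 2) ^ 2 :=
      (Finset.single_le_sum (f := fun i => F n (pt n i) ω ^ 2) (fun i _ => sq_nonneg _)
        hiN).trans_lt h1
    exact abs_lt_of_sq_lt_sq this (by positivity)
  have := abs_sub_abs_le_abs_sub (F n y ω) (F n (pt n ⌊s⌋₊) ω)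
  show |F n y ω| ≤ ε
  linarith

end ProbFilter

/-! ### Stationarity of the past -/

section Past

variable {Ω E : Type*} [MeasurableSpace Ω] [MeasurableSpace E] {P : Measure Ω} {ε : ℤ → Ω → E}

theorem integrable_of_abs_le [IsFiniteMeasure P] {f : Ω → ℝ} (hf : Measurable f) {C : ℝ}
    (hC : ∀ ω, |f ω| ≤ C) : Integrable f P :=
  Integrable.of_bound hf.aestronglyMeasurable C (Eventually.of_forall hC)

theorem past_sub {Ω' E' : Type*} (ε : ℤ → Ω' → E') (t : ℤ) (k : ℕ) (ω : Ω') :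
    past ε (t - k) ω = fun s => past ε t ω (s + k) := by
  ext s
  simp only [past]
  refine congrArg (fun i => ε i ω) ?_
  push_cast
  ring

theorem measurable_past (hε : ∀ i, Measurable (ε i)) (t : ℤ) : Measurable (past ε t) :=
  measurable_pi_lambda _ fun _ => hε _

theorem innovationField_le (hε : ∀ i, Measurable (ε i)) (t : ℤ) :
    innovationField ε t ≤ (inferInstance : MeasurableSpace Ω) :=
  (measurable_past hε t).comap_le

theorem measurable_past_innovationField (ε : ℤ → Ω → E) {s t : ℤ} (h : s ≤ t) :
    Measurable[innovationField ε t] (past ε s) := by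
  obtain ⟨k, rfl⟩ : ∃ k : ℕ, s = t - k := ⟨(t - s).toNat, by omega⟩
  have : past ε (t - k) = (fun (ξ : ℕ → E) s => ξ (s + k)) ∘ past ε t := by
    ext1 ω
    exact past_sub ε t k ω
  rw [this]
  exact Measurable.comp (measurable_pi_lambda _ fun _ => measurable_pi_apply _)
    (comap_measurable _)

variable [IsProbabilityMeasure P]

/-- By independence the law of the past at any time is the infinite product of the common law of the
innovations, which does not involve $t$. -/
theorem IsIIDInnovation.identDistrib_past (hε : IsIIDInnovation P ε) (t : ℤ) :
    IdentDistrib (past ε t) (past ε 0) P P := by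
  have key : ∀ t : ℤ, P.map (past ε t) = Measure.infinitePi fun _ : ℕ => P.map (ε 0) := by
    intro t
    have hinj : Function.Injective fun s : ℕ => t - (s : ℤ) := fun a b hab => by
      simp only at hab; omega
    have h1 := hε.indep.precomp hinj
    have h2 := h1.map_fun_eq_infinitePi_map fun i => hε.measurable _
    have h3 : (fun s : ℕ => P.map (ε (t - s))) = fun _ => P.map (ε 0) := by
      ext1 s
      exact (hε.identDistrib _).map_eq
    change P.map (past ε t) = Measure.infinitePi fun s : ℕ => P.map (ε (t - s)) at h2
    simp_rw [h2, h3]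
  exact ⟨(measurable_past hε.measurable t).aemeasurable,
    (measurable_past hε.measurable 0).aemeasurable, by rw [key, key]⟩

theorem IsIIDInnovation.identDistrib_regressor (hε : IsIIDInnovation P ε) {h : (ℕ → E) → ℝ}
    (hh : Measurable h) (t : ℤ) : IdentDistrib (regressor h ε t) (regressor h ε 0) P P :=
  (hε.identDistrib_past t).comp hh

theorem IsIIDInnovation.integral_past (hε : IsIIDInnovation P ε) {F : (ℕ → E) → ℝ}
    (hF : Measurable F) (t : ℤ) : ∫ ω, F (past ε t ω) ∂P = ∫ ω, F (past ε 0 ω) ∂P :=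
  ((hε.identDistrib_past t).comp hF).integral_eq

theorem measurable_regressor (hε : ∀ i, Measurable (ε i)) {h : (ℕ → E) → ℝ} (hh : Measurable h)
    (t : ℤ) : Measurable (regressor h ε t) :=
  hh.comp (measurable_past hε t)

theorem IsIIDInnovation.indep_iSup (hε : IsIIDInnovation P ε) {S T : Set ℤ} (hST : Disjoint S T) :
    Indep (⨆ i ∈ S, MeasurableSpace.comap (ε i) inferInstance)
      (⨆ i ∈ T, MeasurableSpace.comap (ε i) inferInstance) P :=
  indep_iSup_of_disjoint (fun i => (hε.measurable i).comap_le) hε.indep hST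

theorem innovationField_le_iSup (ε : ℤ → Ω → E) (t : ℤ) :
    innovationField ε t ≤ ⨆ i ∈ Set.Iic t, MeasurableSpace.comap (ε i) inferInstance := by
  refine measurable_iff_comap_le.1 (@measurable_pi_lambda _ _ _ (_) _ _ fun s => ?_)
  refine measurable_iff_comap_le.2 ?_
  exact le_iSup₂_of_le (t - s) (by simp) le_rfl

/-- Prepending an entry to a sequence. -/
def consSeq {E : Type*} (p : E × (ℕ → E)) : ℕ → E := fun s => Nat.casesOn s p.1 p.2

theorem measurable_consSeq : Measurable (consSeq : E × (ℕ → E) → ℕ → E) := by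
  refine measurable_pi_lambda _ fun s => ?_
  cases s with
  | zero => exact measurable_fst
  | succ s => exact (measurable_pi_apply s).comp measurable_snd

theorem consSeq_past {Ω' E' : Type*} (ε : ℤ → Ω' → E') (ω : Ω') :
    consSeq (ε 0 ω, past ε (-1) ω) = past ε 0 ω := by
  ext s
  cases s with
  | zero => simp [consSeq, past]
  | succ s =>
    simp only [consSeq, past]
    refine congrArg (fun i => ε i ω) ?_
    push_cast
    ring

theorem past_coupled {Ω' E' : Type*} [MeasurableSpace Ω'] (ε : ℤ → Ω' → E') (p : Ω' × Ω') :
    past (coupled ε) 0 p = consSeq (ε 0 p.2, past ε (-1) p.1) := by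
  ext s
  cases s with
  | zero => simp [consSeq, past, coupled]
  | succ s =>
    simp only [consSeq, past, coupled]
    rw [if_neg (by omega)]
    refine congrArg (fun i => ε i p.1) ?_
    push_cast
    ring

/-- The present innovation is independent of the earlier ones, so replacing it by an independent
copy does not change the law. Almost sure properties of the past thereby transfer to the coupled
past. -/
theorem IsIIDInnovation.map_past_coupled (hε : IsIIDInnovation P ε) :
    (P.prod P).map (past (coupled ε) 0) = P.map (past ε 0) := by
  have hm := measurable_past hε.measurable (-1)
  have hind : (ε 0) ⟂ᵢ[P] (past ε (-1)) := by
    have := hε.indep_iSup (S := {0}) (T := Set.Iic (-1)) (by simp)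
    rw [IndepFun_iff_Indep]
    refine indep_of_indep_of_le_left (indep_of_indep_of_le_right this ?_) ?_
    · exact innovationField_le_iSup ε (-1)
    · simp
  have h1 := (indepFun_iff_map_prod_eq_prod_map_map (hε.measurable 0).aemeasurable
    hm.aemeasurable).1 hind
  have h2 : P.map (past ε 0) = ((P.map (ε 0)).prod (P.map (past ε (-1)))).map consSeq := by
    rw [← h1, Measure.map_map measurable_consSeq ((hε.measurable 0).prodMk hm)]
    congr 1
    ext1 ω
    exact (consSeq_past ε ω).symm
  have h3 : past (coupled ε) 0
      = (consSeq ∘ Prod.map (ε 0) (past ε (-1))) ∘ (Prod.swap : Ω × Ω → Ω × Ω) := by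
    ext1 p
    exact past_coupled ε p
  rw [h2, Measure.map_prod_map _ _ (hε.measurable 0) hm, h3,
    Measure.map_map measurable_consSeq ((hε.measurable 0).prodMap hm),
    ← Measure.map_map (measurable_consSeq.comp ((hε.measurable 0).prodMap hm)) measurable_swap,
    Measure.prod_swap]

end Past

/-! ### Forecasts of a bounded function of the past -/

section Forecast

variable {Ω E : Type*} [MeasurableSpace Ω] [MeasurableSpace E] {P : Measure Ω}
  [IsProbabilityMeasure P] {ε : ℤ → Ω → E}

/-- `f k`, evaluated at the past at time `t - k`, is the best forecast of `f 0` at time `t`; all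
these functions are bounded by `C`. -/
structure IsForecast (P : Measure Ω) (ε : ℤ → Ω → E) (f : ℕ → (ℕ → E) → ℝ) (C : ℝ) : Prop where
  measurable : ∀ k, Measurable (f k)
  bound : ∀ k ξ, |f k ξ| ≤ C
  forecast : ∀ (k : ℕ) (G : (ℕ → E) → ℝ) (c : ℝ), Measurable G → (∀ ξ, |G ξ| ≤ c) →
    ∫ ω, f 0 (past ε k ω) * G (past ε 0 ω) ∂P = ∫ ω, f k (past ε 0 ω) * G (past ε 0 ω) ∂P

/-- The innovation of the forecasts between two consecutive times. -/
def forecastDiff (f : ℕ → (ℕ → E) → ℝ) (k : ℕ) (ξ : ℕ → E) : ℝ :=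
  f k ξ - f (k + 1) fun s => ξ (s + 1)

variable {f : ℕ → (ℕ → E) → ℝ} {C : ℝ}

theorem measurable_shift (k : ℕ) : Measurable fun (ξ : ℕ → E) s => ξ (s + k) :=
  measurable_pi_lambda _ fun _ => measurable_pi_apply _

theorem IsForecast.measurable_diff (hf : IsForecast P ε f C) (k : ℕ) :
    Measurable (forecastDiff f k) :=
  (hf.measurable k).sub ((hf.measurable (k + 1)).comp (measurable_shift 1))

theorem IsForecast.abs_diff_le (hf : IsForecast P ε f C) (k : ℕ) (ξ : ℕ → E) :
    |forecastDiff f k ξ| ≤ 2 * C := by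
  have h1 := hf.bound k ξ
  have h2 := hf.bound (k + 1) fun s => ξ (s + 1)
  have := abs_sub (f k ξ) (f (k + 1) fun s => ξ (s + 1))
  unfold forecastDiff
  linarith

/-- Stationarity moves the forecast identity from time $0$ to time $t$: both integrands are fixed
functions of a single past. -/
theorem IsForecast.integral_past_mul (hf : IsForecast P ε f C) (hε : IsIIDInnovation P ε) (k : ℕ)
    (t : ℤ) {G : (ℕ → E) → ℝ} {c : ℝ} (hG : Measurable G) (hc : ∀ ξ, |G ξ| ≤ c) :
    ∫ ω, f 0 (past ε (t + k) ω) * G (past ε t ω) ∂P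
      = ∫ ω, f k (past ε t ω) * G (past ε t ω) ∂P := by
  have h0 : Measurable fun ξ : ℕ → E => f 0 ξ * G fun s => ξ (s + k) :=
    (hf.measurable 0).mul (hG.comp (measurable_shift k))
  have h1 : Measurable fun ξ : ℕ → E => f k ξ * G ξ := (hf.measurable k).mul hG
  have e1 : ∀ t : ℤ, ∀ ω, f 0 (past ε (t + k) ω) * G (past ε t ω)
      = (fun ξ : ℕ → E => f 0 ξ * G fun s => ξ (s + k)) (past ε (t + k) ω) := by
    intro t ω
    have := past_sub ε (t + k) k ω
    rw [add_sub_cancel_right] at this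
    simp only [this]
  simp_rw [e1]
  rw [hε.integral_past h0, ← hε.integral_past h0 (0 + k), hε.integral_past h1 t]
  simp_rw [← e1, zero_add]
  exact hf.forecast k G c hG hc

/-- The martingale difference property, by the tower rule: against a function of the past at $t-1$,
the forecasts made at $t$ and at $t-1$ both integrate like the target at $t+k$. -/
theorem IsForecast.integral_diff_mul_eq_zero (hf : IsForecast P ε f C) (hε : IsIIDInnovation P ε)
    (k : ℕ) (t : ℤ) {G : (ℕ → E) → ℝ} {c : ℝ} (hG : Measurable G) (hc : ∀ ξ, |G ξ| ≤ c) :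
    ∫ ω, forecastDiff f k (past ε t ω) * G (past ε (t - 1) ω) ∂P = 0 := by
  have hp := fun t => measurable_past hε.measurable t
  have hint : ∀ j s, Integrable (fun ω => f j (past ε s ω) * G (past ε (t - 1) ω)) P := fun j s =>
    integrable_of_abs_le (((hf.measurable j).comp (hp s)).mul (hG.comp (hp _))) (C := C * c)
      fun ω => by
        rw [abs_mul]
        exact mul_le_mul (hf.bound j _) (hc _) (abs_nonneg _)
          ((abs_nonneg _).trans (hf.bound j (past ε s ω)))
  have h1 : ∀ ω, past ε (t - 1) ω = fun s => past ε t ω (s + 1) := fun ω => by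
    have := past_sub ε t 1 ω
    rwa [Nat.cast_one] at this
  have e : ∀ ω, forecastDiff f k (past ε t ω) * G (past ε (t - 1) ω)
      = f k (past ε t ω) * G (past ε (t - 1) ω)
        - f (k + 1) (past ε (t - 1) ω) * G (past ε (t - 1) ω) := fun ω => by
    rw [h1 ω, forecastDiff, sub_mul]
  simp_rw [e]
  rw [integral_sub (hint _ _) (hint _ _), sub_eq_zero]
  have a1 := hf.integral_past_mul hε k t (hG.comp (measurable_shift 1)) (c := c) fun ξ => hc _
  have a2 := hf.integral_past_mul hε (k + 1) (t - 1) hG hc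
  simp only [Function.comp_apply, ← h1] at a1
  rw [← a1, ← a2]
  have : t - 1 + ((k + 1 : ℕ) : ℤ) = t + k := by push_cast; ring
  rw [this]

theorem IsForecast.integral_diff_mul_diff (hf : IsForecast P ε f C) (hε : IsIIDInnovation P ε)
    (k : ℕ) {s t : ℤ} (hst : s < t) :
    ∫ ω, forecastDiff f k (past ε t ω) * forecastDiff f k (past ε s ω) ∂P = 0 := by
  obtain ⟨j, rfl⟩ : ∃ j : ℕ, s = t - 1 - j := ⟨(t - 1 - s).toNat, by omega⟩
  have := hf.integral_diff_mul_eq_zero hε k t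
    ((hf.measurable_diff k).comp (measurable_shift j)) (c := 2 * C) fun ξ => hf.abs_diff_le k _
  simpa only [Function.comp_apply, ← past_sub] using this

theorem eLpNorm_two_eq_ofReal_sqrt {α : Type*} [MeasurableSpace α] {m : Measure α} {u : α → ℝ}
    (hu : AEStronglyMeasurable u m) (hint : Integrable (fun ω => u ω ^ 2) m) :
    eLpNorm u 2 m = ENNReal.ofReal √(∫ ω, u ω ^ 2 ∂m) := by
  have hmem : MemLp u 2 m := (memLp_two_iff_integrable_sq hu).2 hint
  rw [hmem.eLpNorm_eq_integral_rpow_norm (by simp) (by simp), Real.sqrt_eq_rpow]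
  simp

/-- Sums of orthogonal variables with a common second moment. -/
theorem integral_sum_sq_of_orthogonal {ι : Type*} (s : Finset ι) {u : ι → Ω → ℝ}
    (hu : ∀ i ∈ s, ∀ j ∈ s, Integrable (fun ω => u i ω * u j ω) P)
    (horth : ∀ i ∈ s, ∀ j ∈ s, i ≠ j → ∫ ω, u i ω * u j ω ∂P = 0) :
    ∫ ω, (∑ i ∈ s, u i ω) ^ 2 ∂P = ∑ i ∈ s, ∫ ω, u i ω ^ 2 ∂P := by
  simp_rw [sq, Finset.sum_mul_sum]
  rw [integral_finsetSum _ fun i hi => integrable_finsetSum _ fun j hj => hu i hi j hj]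
  refine Finset.sum_congr rfl fun i hi => ?_
  rw [integral_finsetSum _ fun j hj => hu i hi j hj]
  exact Finset.sum_eq_single_of_mem i hi fun j hj hji => horth i hi j hj hji.symm

/-- For a fixed lag the terms are orthogonal with a common second moment, so Pythagoras gives
exactly the factor $\sqrt n$. -/
theorem IsForecast.eLpNorm_sum_diff (hf : IsForecast P ε f C) (hε : IsIIDInnovation P ε)
    (k n : ℕ) :
    eLpNorm (fun ω => ∑ t ∈ Finset.Icc 1 n, forecastDiff f k (past ε ((t : ℤ) - k) ω)) 2 P
      = ENNReal.ofReal √n * eLpNorm (fun ω => forecastDiff f k (past ε 0 ω)) 2 P := by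
  have hp := fun t => measurable_past hε.measurable t
  have hm : ∀ t, Measurable fun ω => forecastDiff f k (past ε t ω) := fun t =>
    (hf.measurable_diff k).comp (hp t)
  have hC : 0 ≤ 2 * C := by
    obtain ⟨ω⟩ := nonempty_of_isProbabilityMeasure P
    exact (abs_nonneg _).trans (hf.abs_diff_le k (past ε 0 ω))
  have hmul : ∀ s t, Integrable
      (fun ω => forecastDiff f k (past ε s ω) * forecastDiff f k (past ε t ω)) P := fun s t =>
    integrable_of_abs_le ((hm s).mul (hm t)) (C := 2 * C * (2 * C)) fun ω => by
      rw [abs_mul]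
      exact mul_le_mul (hf.abs_diff_le k _) (hf.abs_diff_le k _) (abs_nonneg _) hC
  have hsq : ∀ t, ∫ ω, forecastDiff f k (past ε t ω) ^ 2 ∂P
      = ∫ ω, forecastDiff f k (past ε 0 ω) ^ 2 ∂P := fun t =>
    hε.integral_past ((hf.measurable_diff k).pow_const 2) t
  have key := integral_sum_sq_of_orthogonal (P := P) (Finset.Icc 1 n)
    (u := fun t ω => forecastDiff f k (past ε ((t : ℤ) - k) ω))
    (fun i _ j _ => hmul _ _) (fun i _ j _ hij => by
      rcases lt_or_gt_of_ne hij with h | h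
      · simp_rw [mul_comm (forecastDiff f k (past ε ((i : ℤ) - k) _))]
        exact hf.integral_diff_mul_diff hε k (by omega)
      · exact hf.integral_diff_mul_diff hε k (by omega))
  simp_rw [hsq, Finset.sum_const, Nat.card_Icc, add_tsub_cancel_right, nsmul_eq_mul] at key
  rw [eLpNorm_two_eq_ofReal_sqrt, eLpNorm_two_eq_ofReal_sqrt, key,
    Real.sqrt_mul (Nat.cast_nonneg n), ENNReal.ofReal_mul (Real.sqrt_nonneg _)]
  · exact (hm 0).aestronglyMeasurable
  · simpa only [sq] using hmul 0 0
  · exact (Finset.measurable_fun_sum _ fun t _ => hm _).aestronglyMeasurable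
  · simp_rw [sq, Finset.sum_mul_sum]
    exact integrable_finsetSum _ fun i hi => integrable_finsetSum _ fun j hj => hmul _ _

theorem IsForecast.integral_eq (hf : IsForecast P ε f C) (hε : IsIIDInnovation P ε) (k : ℕ)
    (t : ℤ) : ∫ ω, f k (past ε t ω) ∂P = ∫ ω, f 0 (past ε 0 ω) ∂P := by
  have := hf.integral_past_mul hε k t (G := fun _ => 1) (c := 1) measurable_const (by simp)
  simp only [mul_one] at this
  rw [← this, hε.integral_past (hf.measurable 0)]

/-- Telescoping: the $k$-th term is the forecast of the same target made at time $t-k$ minus the one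
made at time $t-k-1$. -/
theorem sum_forecastDiff (f : ℕ → (ℕ → E) → ℝ) (ε : ℤ → Ω → E) (m : ℕ) (t : ℤ) (ω : Ω) :
    ∑ k ∈ Finset.range m, forecastDiff f k (past ε (t - k) ω)
      = f 0 (past ε t ω) - f m (past ε (t - m) ω) := by
  induction m with
  | zero => simp
  | succ m ih =>
    rw [Finset.sum_range_succ, ih, forecastDiff]
    have : past ε (t - (m + 1 : ℕ)) ω = fun s => past ε (t - m) ω (s + 1) := by
      rw [← past_sub ε (t - m) 1 ω]
      congr 1
      push_cast
      ring
    rw [this]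
    ring

theorem iSup_piLE_nat : ⨆ n, Filtration.piLE (ι := ℕ) (X := fun _ => E) n = MeasurableSpace.pi := by
  refine le_antisymm (iSup_le fun n => Filtration.le _ n) ?_
  refine iSup_le fun s => le_iSup_of_le s ?_
  have h : Measurable[Filtration.piLE (ι := ℕ) (X := fun _ => E) s] fun ξ : ℕ → E => ξ s :=
    (measurable_pi_apply (⟨s, Set.mem_Iic.2 le_rfl⟩ : Set.Iic s)).comp
      (comap_measurable (Preorder.restrictLe (π := fun _ : ℕ => E) s))
  exact h.comap_le

/-- Coordinates $0,\dots,j$ of the past at time $m$ are the innovations at times $m-j,\dots,m$, all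
strictly positive when $j<m$. -/
theorem IsIIDInnovation.indep_piLE (hε : IsIIDInnovation P ε) {j m : ℕ} (hjm : j < m) :
    Indep (MeasurableSpace.comap (past ε m) (Filtration.piLE (ι := ℕ) (X := fun _ => E) j))
      (innovationField ε 0) P := by
  refine indep_of_indep_of_le_left (indep_of_indep_of_le_right
    (hε.indep_iSup (S := Set.Ioi 0) (T := Set.Iic 0) ?_) (innovationField_le_iSup ε 0)) ?_
  · exact Set.disjoint_left.2 fun i hi hi' => absurd (Set.mem_Ioi.1 hi) (not_lt.2 hi')
  · change MeasurableSpace.comap (past ε m) (MeasurableSpace.comap _ _) ≤ _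
    rw [MeasurableSpace.comap_comp]
    refine measurable_iff_comap_le.1 (@measurable_pi_lambda _ _ _ (_) _ _ fun s => ?_)
    refine measurable_iff_comap_le.2 ?_
    have hs : (s : ℕ) ≤ j := s.2
    exact le_iSup₂_of_le ((m : ℤ) - (s : ℕ)) (by rw [Set.mem_Ioi]; omega) le_rfl

/-- Forecasts over a long horizon are asymptotically constant. -/
theorem IsForecast.tendsto_eLpNorm (hf : IsForecast P ε f C) (hε : IsIIDInnovation P ε) :
    Tendsto (fun m => eLpNorm (fun ω => f m (past ε 0 ω) - ∫ ω', f 0 (past ε 0 ω') ∂P) 2 P)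
      atTop (𝓝 0) := by
  have hp := fun t => measurable_past hε.measurable t
  set c := ∫ ω', f 0 (past ε 0 ω') ∂P with hc
  set law := P.map (past ε 0) with hlaw
  have : IsProbabilityMeasure law := Measure.isProbabilityMeasure_map (hp 0).aemeasurable
  set ℱ := Filtration.piLE (ι := ℕ) (X := fun _ => E) with hℱ
  -- The projection of the target onto the $j+1$ most recent innovations; by Lévy's upward theorem
  -- it converges to the target in $L^1$.
  set g : ℕ → (ℕ → E) → ℝ := fun j => law[f 0 | ℱ j] with hg
  have hf0 : Integrable (f 0) law := integrable_of_abs_le (hf.measurable 0) (hf.bound 0)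
  have hgint : ∀ j, Integrable (g j) law := fun j => integrable_condExp
  have hgm : ∀ j, Measurable (g j) := fun j =>
    (stronglyMeasurable_condExp.mono (ℱ.le j)).measurable
  have hlevy : Tendsto (fun j => ∫ ξ, |f 0 ξ - g j ξ| ∂law) atTop (𝓝 0) := by
    have h1 := hf0.tendsto_eLpNorm_condExp (ℱ := ℱ) (by
      rw [hℱ, iSup_piLE_nat]; exact (hf.measurable 0).stronglyMeasurable)
    have h2 := (ENNReal.tendsto_toReal ENNReal.zero_ne_top).comp h1
    refine h2.congr fun j => ?_
    have h3 := (hgint j).sub hf0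
    rw [Function.comp_apply, eLpNorm_one_eq_lintegral_enorm,
      ← integral_norm_eq_lintegral_enorm h3.aestronglyMeasurable]
    refine integral_congr_ae (Eventually.of_forall fun ξ => ?_)
    simp only [Pi.sub_apply, Real.norm_eq_abs]
    exact abs_sub_comm _ _
  have hC : 0 ≤ C := by
    obtain ⟨ω⟩ := nonempty_of_isProbabilityMeasure P
    exact (abs_nonneg _).trans (hf.bound 0 (past ε 0 ω))
  have hcC : |c| ≤ C := by
    have := norm_integral_le_of_norm_le_const (μ := P) (f := fun ω => f 0 (past ε 0 ω)) (C := C)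
      (Eventually.of_forall fun ω => hf.bound 0 _)
    simpa using this
  have hGm : ∀ m, Measurable fun ξ => f m ξ - c := fun m => (hf.measurable m).sub_const c
  have hGb : ∀ m ξ, |f m ξ - c| ≤ 2 * C := fun m ξ => by
    have := abs_sub (f m ξ) c
    have := hf.bound m ξ
    linarith
  have hid : ∀ m : ℤ, IdentDistrib (past ε m) (past ε 0) P P := hε.identDistrib_past
  have hgint' : ∀ j, ∀ m : ℤ, Integrable (fun ω => g j (past ε m ω)) P := fun j m =>
    ((hid m).comp (hgm j)).integrable_iff.2
      ((integrable_map_measure (hgm j).aestronglyMeasurable (hp 0).aemeasurable).1 (hgint j))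
  -- With $G=f_m-c$ centred, $\mathbb E G(\xi_0)^2=\mathbb E f_m(\xi_0)G(\xi_0)=\mathbb E
  -- f_0(\xi_m)G(\xi_0)$. For $m>j$ the variable $g_j(\xi_m)$ is independent of $\xi_0$, so
  -- subtracting it from $f_0(\xi_m)$ changes nothing, and only the approximation error of $g_j$
  -- remains.
  have hbound : ∀ j m : ℕ, j < m → ∫ ω, (f m (past ε 0 ω) - c) ^ 2 ∂P
      ≤ 2 * C * ∫ ξ, |f 0 ξ - g j ξ| ∂law := by
    intro j m hjm
    set G : (ℕ → E) → ℝ := fun ξ => f m ξ - c with hG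
    have hGint : Integrable (fun ω => G (past ε 0 ω)) P :=
      integrable_of_abs_le ((hGm m).comp (hp 0)) fun ω => hGb m _
    have hEG : ∫ ω, G (past ε 0 ω) ∂P = 0 := by
      have hfm : Integrable (fun ω => f m (past ε 0 ω)) P :=
        integrable_of_abs_le ((hf.measurable m).comp (hp 0)) fun ω => hf.bound m _
      simp only [hG]
      rw [integral_sub hfm (integrable_const _), hf.integral_eq hε]
      simp [hc]
    have hfG : ∀ k s, Integrable (fun ω => f k (past ε s ω) * G (past ε 0 ω)) P := fun k s =>
      integrable_of_abs_le (((hf.measurable k).comp (hp s)).mul ((hGm m).comp (hp 0)))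
        (C := C * (2 * C)) fun ω => by
          rw [abs_mul]
          exact mul_le_mul (hf.bound k _) (hGb m _) (abs_nonneg _) hC
    have hgG : Integrable (fun ω => g j (past ε m ω) * G (past ε 0 ω)) P :=
      (hgint' j m).mul_bdd (c := 2 * C) ((hGm m).comp (hp 0)).aestronglyMeasurable
        (Eventually.of_forall fun ω => hGb m _)
    have hzero : ∫ ω, g j (past ε m ω) * G (past ε 0 ω) ∂P = 0 := by
      have hind : (fun ω => g j (past ε m ω)) ⟂ᵢ[P] fun ω => G (past ε 0 ω) := by
        rw [IndepFun_iff_Indep]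
        refine indep_of_indep_of_le_left (indep_of_indep_of_le_right (hε.indep_piLE hjm) ?_) ?_
        · exact measurable_iff_comap_le.1 ((hGm m).comp (comap_measurable _))
        · refine measurable_iff_comap_le.1 ?_
          exact (stronglyMeasurable_condExp (m := ℱ j) (μ := law) (f := f 0)).measurable.comp
            (@comap_measurable _ _ (ℱ j) (past ε m))
      rw [hind.integral_fun_mul_eq_mul_integral (hgint' j m).aestronglyMeasurable
        hGint.aestronglyMeasurable, hEG, mul_zero]
    have e1 : ∫ ω, (f m (past ε 0 ω) - c) ^ 2 ∂P
        = ∫ ω, f m (past ε 0 ω) * G (past ε 0 ω) ∂P := by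
      have : ∀ ω, (f m (past ε 0 ω) - c) ^ 2
          = f m (past ε 0 ω) * G (past ε 0 ω) - c * G (past ε 0 ω) := fun ω => by
        simp only [hG]; ring
      simp_rw [this]
      rw [integral_sub (hfG _ _) (hGint.const_mul c), integral_const_mul, hEG, mul_zero, sub_zero]
    have e2 := hf.forecast m G (2 * C) (hGm m) (hGb m)
    have e3 : ∫ ω, f 0 (past ε m ω) * G (past ε 0 ω) ∂P
        = ∫ ω, (f 0 (past ε m ω) - g j (past ε m ω)) * G (past ε 0 ω) ∂P := by
      simp_rw [sub_mul]
      rw [integral_sub (hfG _ _) hgG, hzero, sub_zero]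
    have hdm : Measurable fun ξ => |f 0 ξ - g j ξ| := ((hf.measurable 0).sub (hgm j)).abs
    have hdint : Integrable (fun ω => |f 0 (past ε m ω) - g j (past ε m ω)|) P :=
      ((integrable_of_abs_le ((hf.measurable 0).comp (hp m)) fun ω => hf.bound 0 _).sub
        (hgint' j m)).abs
    rw [e1, ← e2, e3, hlaw, integral_map (hp 0).aemeasurable hdm.aestronglyMeasurable,
      ← hε.integral_past hdm m, ← integral_const_mul]
    refine (le_abs_self _).trans ?_
    rw [← Real.norm_eq_abs]
    refine norm_integral_le_of_norm_le (hdint.const_mul _) ?_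
    refine Eventually.of_forall fun ω => ?_
    rw [norm_mul, mul_comm]
    exact mul_le_mul_of_nonneg_right (hGb m _) (abs_nonneg _)
  have hsq : Tendsto (fun m => ∫ ω, (f m (past ε 0 ω) - c) ^ 2 ∂P) atTop (𝓝 0) := by
    have h1 : Tendsto (fun j => 2 * C * ∫ ξ, |f 0 ξ - g j ξ| ∂law) atTop (𝓝 0) := by
      simpa using hlevy.const_mul (2 * C)
    rw [Metric.tendsto_atTop]
    intro η hη
    obtain ⟨j, hj⟩ := (h1.eventually (gt_mem_nhds hη)).exists
    refine ⟨j + 1, fun m hm => ?_⟩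
    rw [Real.dist_eq, sub_zero, abs_of_nonneg (integral_nonneg fun _ => sq_nonneg _)]
    exact (hbound j m hm).trans_lt hj
  have h2 : Tendsto (fun m => ENNReal.ofReal √(∫ ω, (f m (past ε 0 ω) - c) ^ 2 ∂P)) atTop
      (𝓝 0) := by
    have := ENNReal.tendsto_ofReal ((Real.continuous_sqrt.tendsto 0).comp hsq)
    simpa using this
  refine h2.congr fun m => ?_
  have hm : Measurable fun ω => f m (past ε 0 ω) - c := (hGm m).comp (hp 0)
  refine (eLpNorm_two_eq_ofReal_sqrt hm.aestronglyMeasurable ?_).symm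
  refine integrable_of_abs_le (hm.pow_const 2) (C := (2 * C) ^ 2) fun ω => ?_
  rw [abs_pow]
  exact pow_le_pow_left₀ (abs_nonneg _) (hGb m _) 2

/-- Telescope each summand down to lag $m$, exchange the sums over lags and times, and apply
Minkowski over the lags. The remainder is at most $n$ times the distance of the $m$-step forecast
from its mean. -/
theorem IsForecast.eLpNorm_sum_sub_le (hf : IsForecast P ε f C) (hε : IsIIDInnovation P ε)
    (n : ℕ) :
    eLpNorm (fun ω => ∑ t ∈ Finset.Icc 1 n,
        (f 0 (past ε (t : ℤ) ω) - ∫ ω', f 0 (past ε 0 ω') ∂P)) 2 P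
      ≤ ENNReal.ofReal √n * ∑' k, eLpNorm (fun ω => forecastDiff f k (past ε 0 ω)) 2 P := by
  set c := ∫ ω', f 0 (past ε 0 ω') ∂P with hc
  have hp := fun t => measurable_past hε.measurable t
  have hD : ∀ k (t : ℤ), AEStronglyMeasurable (fun ω => forecastDiff f k (past ε t ω)) P :=
    fun k t => ((hf.measurable_diff k).comp (hp t)).aestronglyMeasurable
  have hR : ∀ k (t : ℤ), AEStronglyMeasurable (fun ω => f k (past ε t ω) - c) P :=
    fun k t => (((hf.measurable k).comp (hp t)).sub_const c).aestronglyMeasurable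
  have hrem : ∀ m (t : ℤ), eLpNorm (fun ω => f m (past ε t ω) - c) 2 P
      = eLpNorm (fun ω => f m (past ε 0 ω) - c) 2 P := fun m t =>
    ((hε.identDistrib_past t).comp ((hf.measurable m).sub_const c)).eLpNorm_eq 2
  have hm : ∀ m : ℕ, eLpNorm (fun ω => ∑ t ∈ Finset.Icc 1 n, (f 0 (past ε (t : ℤ) ω) - c)) 2 P
      ≤ ENNReal.ofReal √n * ∑' k, eLpNorm (fun ω => forecastDiff f k (past ε 0 ω)) 2 P
        + n * eLpNorm (fun ω => f m (past ε 0 ω) - c) 2 P := by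
    intro m
    have e : (fun ω => ∑ t ∈ Finset.Icc 1 n, (f 0 (past ε (t : ℤ) ω) - c))
        = (∑ k ∈ Finset.range m, fun ω =>
            ∑ t ∈ Finset.Icc 1 n, forecastDiff f k (past ε ((t : ℤ) - k) ω))
          + ∑ t ∈ Finset.Icc 1 n, fun ω => f m (past ε ((t : ℤ) - m) ω) - c := by
      ext1 ω
      simp only [Pi.add_apply, Finset.sum_apply]
      rw [Finset.sum_comm, ← Finset.sum_add_distrib]
      refine Finset.sum_congr rfl fun t _ => ?_
      rw [sum_forecastDiff]
      ring
    rw [e]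
    refine (eLpNorm_add_le ?_ ?_ (by norm_num)).trans (add_le_add ?_ ?_)
    · exact Finset.aestronglyMeasurable_sum _ fun k _ =>
        Finset.aestronglyMeasurable_fun_sum _ fun t _ => hD _ _
    · exact Finset.aestronglyMeasurable_sum _ fun t _ => hR _ _
    · refine (eLpNorm_sum_le (fun k _ =>
        Finset.aestronglyMeasurable_fun_sum _ fun t _ => hD _ _) (by norm_num)).trans ?_
      simp_rw [hf.eLpNorm_sum_diff hε]
      rw [← Finset.mul_sum]
      gcongr
      exact ENNReal.sum_le_tsum _
    · refine (eLpNorm_sum_le (fun t _ => hR _ _) (by norm_num)).trans ?_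
      simp_rw [hrem]
      simp
  -- Here $n$ is fixed and $m\to\infty$, so the factor $n$ in the remainder is harmless.
  have hlim := (ENNReal.Tendsto.const_mul (hf.tendsto_eLpNorm hε) (a := (n : ℝ≥0∞))
    (Or.inr (ENNReal.natCast_ne_top n))).const_add
    (ENNReal.ofReal √n * ∑' k, eLpNorm (fun ω => forecastDiff f k (past ε 0 ω)) 2 P)
  rw [mul_zero, add_zero] at hlim
  exact ge_of_tendsto' hlim hm

end Forecast

/-! ### The coupling bound -/

section Coupling

variable {Ω E : Type*} [MeasurableSpace Ω] [MeasurableSpace E] {P : Measure Ω}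
  [IsProbabilityMeasure P] {ε : ℤ → Ω → E} {f : ℕ → (ℕ → E) → ℝ} {C : ℝ}

theorem measurable_coupled (hε : ∀ i, Measurable (ε i)) (i : ℤ) : Measurable (coupled ε i) := by
  by_cases hi : i = 0
  · have : coupled ε i = fun p : Ω × Ω => ε i p.2 := by ext1 p; simp [coupled, hi]
    rw [this]
    exact (hε i).comp measurable_snd
  · have : coupled ε i = fun p : Ω × Ω => ε i p.1 := by ext1 p; simp [coupled, hi]
    rw [this]
    exact (hε i).comp measurable_fst

/-- The two pasts differ only in their first entry, so the forecasts from one step earlier cancel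
and the difference is $U-V$, with $U$ and $V$ the forecast innovation at the original and at the
coupled past. These are orthogonal, hence $\mathbb E(U-V)^2=\mathbb EU^2+\mathbb EV^2\ge\mathbb
EU^2$. -/
theorem IsForecast.eLpNorm_diff_le_coupled (hf : IsForecast P ε f C) (hε : IsIIDInnovation P ε)
    (k : ℕ) :
    eLpNorm (fun ω => forecastDiff f k (past ε 0 ω)) 2 P
      ≤ eLpNorm (fun p : Ω × Ω => f k (past ε 0 p.1) - f k (past (coupled ε) 0 p)) 2
          (P.prod P) := by
  have hp := measurable_past hε.measurable 0
  have hp1 := measurable_past hε.measurable (-1)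
  have hpc : Measurable (past (coupled ε) 0) :=
    measurable_past (measurable_coupled hε.measurable) 0
  set U : Ω × Ω → ℝ := fun p => forecastDiff f k (past ε 0 p.1) with hU
  set V : Ω × Ω → ℝ := fun p => forecastDiff f k (past (coupled ε) 0 p) with hV
  have hUm : Measurable U := (hf.measurable_diff k).comp (hp.comp measurable_fst)
  have hVm : Measurable V := (hf.measurable_diff k).comp hpc
  have hC : 0 ≤ 2 * C := by
    obtain ⟨ω⟩ := nonempty_of_isProbabilityMeasure P
    exact (abs_nonneg _).trans (hf.abs_diff_le k (past ε 0 ω))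
  have hmul : ∀ u v : Ω × Ω → ℝ, Measurable u → Measurable v → (∀ p, |u p| ≤ 2 * C) →
      (∀ p, |v p| ≤ 2 * C) → Integrable (fun p => u p * v p) (P.prod P) := by
    intro u v hu hv hub hvb
    refine integrable_of_abs_le (hu.mul hv) (C := 2 * C * (2 * C)) fun p => ?_
    rw [abs_mul]
    exact mul_le_mul (hub p) (hvb p) (abs_nonneg _) hC
  have hUb : ∀ p, |U p| ≤ 2 * C := fun p => hf.abs_diff_le k _
  have hVb : ∀ p, |V p| ≤ 2 * C := fun p => hf.abs_diff_le k _
  have hdiff : ∀ p : Ω × Ω, f k (past ε 0 p.1) - f k (past (coupled ε) 0 p) = U p - V p := by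
    intro p
    simp only [hU, hV, forecastDiff, past_coupled]
    rw [← consSeq_past]
    simp [consSeq]
  have hUV : ∫ p, U p * V p ∂(P.prod P) = 0 := by
    rw [integral_prod_symm _ (hmul U V hUm hVm hUb hVb)]
    -- Once the copy $\varepsilon_0'$ is frozen, $V$ is a bounded function of the past at time $-1$,
    -- to which the martingale difference $U$ is orthogonal.
    have : ∀ ω' : Ω, ∫ ω, U (ω, ω') * V (ω, ω') ∂P = 0 := by
      intro ω'
      have hG : Measurable fun η : ℕ → E => forecastDiff f k (consSeq (ε 0 ω', η)) :=
        (hf.measurable_diff k).comp (measurable_consSeq.comp (measurable_const.prodMk measurable_id))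
      have := hf.integral_diff_mul_eq_zero hε k 0 hG (c := 2 * C) fun η => hf.abs_diff_le k _
      simpa only [hU, hV, past_coupled, zero_sub] using this
    simp [this]
  have hle : ∫ ω, forecastDiff f k (past ε 0 ω) ^ 2 ∂P
      ≤ ∫ p : Ω × Ω, (f k (past ε 0 p.1) - f k (past (coupled ε) 0 p)) ^ 2 ∂(P.prod P) := by
    have e1 : ∫ ω, forecastDiff f k (past ε 0 ω) ^ 2 ∂P = ∫ p, U p ^ 2 ∂(P.prod P) := by
      simp only [hU]
      rw [integral_fun_fst (μ := P) (ν := P) fun ω => forecastDiff f k (past ε 0 ω) ^ 2]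
      simp
    have hUU := hmul U U hUm hUm hUb hUb
    have hVV := hmul V V hVm hVm hVb hVb
    have hUVi := hmul U V hUm hVm hUb hVb
    have e2 : ∀ p, (f k (past ε 0 p.1) - f k (past (coupled ε) 0 p)) ^ 2
        = (U p * U p - 2 * (U p * V p)) + V p * V p := fun p => by
      rw [hdiff]; ring
    simp_rw [e2]
    have e3 : ∀ p, U p ^ 2 = U p * U p := fun p => sq _
    simp_rw [e1, e3]
    have i1 : Integrable (fun p => U p * U p - 2 * (U p * V p)) (P.prod P) :=
      hUU.sub (hUVi.const_mul 2)
    rw [integral_add i1 hVV, integral_sub hUU (hUVi.const_mul 2), integral_const_mul, hUV]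
    have : 0 ≤ ∫ p, V p * V p ∂(P.prod P) := integral_nonneg fun p => mul_self_nonneg _
    linarith
  rw [eLpNorm_two_eq_ofReal_sqrt, eLpNorm_two_eq_ofReal_sqrt]
  · exact ENNReal.ofReal_le_ofReal (Real.sqrt_le_sqrt hle)
  · simp_rw [hdiff]
    exact (hUm.sub hVm).aestronglyMeasurable
  · simp_rw [hdiff]
    have e2 : ∀ p, (U p - V p) ^ 2 = (U p * U p - 2 * (U p * V p)) + V p * V p := fun p => by ring
    simp_rw [e2]
    exact ((hmul U U hUm hUm hUb hUb).sub ((hmul U V hUm hVm hUb hVb).const_mul 2)).add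
      (hmul V V hVm hVm hVb hVb)
  · exact ((hf.measurable_diff k).comp hp).aestronglyMeasurable
  · refine integrable_of_abs_le (((hf.measurable_diff k).comp hp).pow_const 2) (C := (2 * C) ^ 2)
      fun ω => ?_
    rw [abs_pow]
    exact pow_le_pow_left₀ (abs_nonneg _) (hf.abs_diff_le k _) 2

/-- Pythagoras: the target is the sum of its lag-zero innovation and its one-step forecast, and
these are orthogonal. -/
theorem IsForecast.eLpNorm_diff_zero_le (hf : IsForecast P ε f C) (hε : IsIIDInnovation P ε) :
    eLpNorm (fun ω => forecastDiff f 0 (past ε 0 ω)) 2 P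
      ≤ eLpNorm (fun ω => f 0 (past ε 0 ω)) 2 P := by
  have hp := fun t => measurable_past hε.measurable t
  have hC : 0 ≤ C := by
    obtain ⟨ω⟩ := nonempty_of_isProbabilityMeasure P
    exact (abs_nonneg _).trans (hf.bound 0 (past ε 0 ω))
  set U : Ω → ℝ := fun ω => forecastDiff f 0 (past ε 0 ω) with hU
  set V : Ω → ℝ := fun ω => f 1 (past ε (0 - 1) ω) with hV
  have hUm : Measurable U := (hf.measurable_diff 0).comp (hp 0)
  have hVm : Measurable V := (hf.measurable 1).comp (hp _)
  have hUb : ∀ ω, |U ω| ≤ 2 * C := fun ω => hf.abs_diff_le 0 _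
  have hVb : ∀ ω, |V ω| ≤ 2 * C := fun ω => (hf.bound 1 _).trans (by linarith)
  have hmul : ∀ u v : Ω → ℝ, Measurable u → Measurable v → (∀ p, |u p| ≤ 2 * C) →
      (∀ p, |v p| ≤ 2 * C) → Integrable (fun p => u p * v p) P := by
    intro u v hu hv hub hvb
    refine integrable_of_abs_le (hu.mul hv) (C := 2 * C * (2 * C)) fun p => ?_
    rw [abs_mul]
    exact mul_le_mul (hub p) (hvb p) (abs_nonneg _) (by linarith)
  have hsum : ∀ ω, f 0 (past ε 0 ω) = U ω + V ω := fun ω => by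
    have := past_sub ε 0 1 ω
    rw [Nat.cast_one] at this
    simp only [hU, hV, forecastDiff, this, zero_add]
    ring
  have hUV : ∫ ω, U ω * V ω ∂P = 0 :=
    hf.integral_diff_mul_eq_zero hε 0 0 (hf.measurable 1) (hf.bound 1)
  have hUU := hmul U U hUm hUm hUb hUb
  have hVV := hmul V V hVm hVm hVb hVb
  have hUVi := hmul U V hUm hVm hUb hVb
  have e2 : ∀ ω, f 0 (past ε 0 ω) ^ 2 = (U ω * U ω + 2 * (U ω * V ω)) + V ω * V ω := fun ω => by
    rw [hsum]; ring
  have i1 : Integrable (fun ω => U ω * U ω + 2 * (U ω * V ω)) P := hUU.add (hUVi.const_mul 2)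
  have hf0 : Measurable fun ω => f 0 (past ε 0 ω) := (hf.measurable 0).comp (hp 0)
  rw [eLpNorm_two_eq_ofReal_sqrt hUm.aestronglyMeasurable (by simpa only [sq] using hUU),
    eLpNorm_two_eq_ofReal_sqrt hf0.aestronglyMeasurable (by simp_rw [e2]; exact i1.add hVV)]
  refine ENNReal.ofReal_le_ofReal (Real.sqrt_le_sqrt ?_)
  simp_rw [e2, sq]
  rw [integral_add i1 hVV, integral_add hUU (hUVi.const_mul 2), integral_const_mul, hUV]
  have : 0 ≤ ∫ p, V p * V p ∂P := integral_nonneg fun p => mul_self_nonneg _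
  linarith

end Coupling

/-! ### The second moment of sums of a function of the regressors -/

section RegressorSums

variable {Ω E : Type*} [MeasurableSpace Ω] [MeasurableSpace E] {P : Measure Ω}
  [IsProbabilityMeasure P] {ε : ℤ → Ω → E} {h : (ℕ → E) → ℝ} {γ : ℕ → ℝ → (ℕ → E) → ℝ}

theorem IsCondDensity.ae_integral_eq_one {X : ℤ → Ω → ℝ} (hγ : IsCondDensity P ε X γ)
    (hε : IsIIDInnovation P ε) {k : ℕ} (hk : 1 ≤ k) :
    ∀ᵐ ω ∂P, Integrable (fun v => γ k v (past ε 0 ω)) ∧ ∫ v, γ k v (past ε 0 ω) = 1 := by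
  have h1 := hγ.condProb k hk Set.univ MeasurableSet.univ
  have h2 : P⟦X (k : ℤ) ⁻¹' Set.univ | innovationField ε 0⟧ = fun _ => (1 : ℝ) := by
    rw [Set.preimage_univ, Set.indicator_univ]
    exact condExp_const (innovationField_le hε.measurable 0) 1
  rw [h2] at h1
  filter_upwards [h1] with ω hω
  rw [Measure.restrict_univ] at hω
  refine ⟨?_, hω.symm⟩
  -- The integral of a non-integrable function is $0$ by convention, so an integral equal to $1$
  -- already entails integrability.
  by_contra hn
  rw [integral_undef hn] at hω
  exact one_ne_zero hω

/-- It is enough to compare rectangles $A\times B$: integrating the conditional probability of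
$X_k\in A$ over the event $\xi_0\in B$ gives both sides. -/
theorem IsCondDensity.map_prod {X : ℤ → Ω → ℝ} (hγ : IsCondDensity P ε X γ)
    (hε : IsIIDInnovation P ε) (hX : ∀ t, Measurable (X t)) {k : ℕ} (hk : 1 ≤ k) :
    P.map (fun ω => (X k ω, past ε 0 ω))
      = (volume.prod (P.map (past ε 0))).withDensity
          fun p => ENNReal.ofReal (γ k p.1 p.2) := by
  have hp := measurable_past hε.measurable 0
  have hγm := hγ.measurable k hk
  have hmm : Measurable fun ω => (X k ω, past ε 0 ω) := (hX k).prodMk hp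
  have : IsProbabilityMeasure (P.map (past ε 0)) := Measure.isProbabilityMeasure_map hp.aemeasurable
  have : IsProbabilityMeasure (P.map fun ω => (X k ω, past ε 0 ω)) :=
    Measure.isProbabilityMeasure_map hmm.aemeasurable
  refine Measure.ext_prod fun {A B} hA hB => ?_
  have hof : Measurable fun p : ℝ × (ℕ → E) => ENNReal.ofReal (γ k p.1 p.2) := hγm.ennreal_ofReal
  have hBΩ : MeasurableSet[innovationField ε 0] (past ε 0 ⁻¹' B) := ⟨B, hB, rfl⟩
  have hXA : MeasurableSet (X k ⁻¹' A) := hX k hA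
  have hae := hγ.ae_integral_eq_one hε hk
  have hR : ∫⁻ ξ in B, (∫⁻ v in A, ENNReal.ofReal (γ k v ξ)) ∂(P.map (past ε 0))
      = ∫⁻ ω in past ε 0 ⁻¹' B, ENNReal.ofReal (∫ v in A, γ k v (past ε 0 ω)) ∂P := by
    rw [setLIntegral_map hB hof.lintegral_prod_left hp]
    refine lintegral_congr_ae (ae_restrict_of_ae ?_)
    filter_upwards [hae] with ω hω
    exact (ofReal_integral_eq_lintegral_ofReal hω.1.integrableOn
      (Eventually.of_forall fun v => hγ.nonneg k hk _ _)).symm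
  rw [Measure.map_apply hmm (hA.prod hB), withDensity_apply _ (hA.prod hB),
    ← Measure.prod_restrict, lintegral_prod_symm' _ hof, hR]
  have hc := hγ.condProb k hk A hA
  have hcint : Integrable (fun ω => ∫ v in A, γ k v (past ε 0 ω)) P :=
    integrable_condExp.congr hc
  rw [← ofReal_integral_eq_lintegral_ofReal hcint.integrableOn
    (Eventually.of_forall fun ω => integral_nonneg fun v => hγ.nonneg k hk _ _),
    ← setIntegral_congr_ae (innovationField_le hε.measurable 0 _ hBΩ) (hc.mono fun ω hω _ => hω),
    setIntegral_condExp (innovationField_le hε.measurable 0)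
      ((integrable_const _).indicator hXA) hBΩ,
    integral_indicator hXA, integral_const, measureReal_restrict_apply_univ,
    smul_eq_mul, mul_one, measureReal_restrict_apply hXA, ofReal_measureReal]
  rfl

/-- The forecast, `k` steps ahead, of a function `φ` of the regressor, truncated at height `C`. -/
def densityForecast (h : (ℕ → E) → ℝ) (γ : ℕ → ℝ → (ℕ → E) → ℝ) (φ : ℝ → ℝ) (C : ℝ) :
    ℕ → (ℕ → E) → ℝ
  | 0, ξ => φ (h ξ)
  | k + 1, ξ => max (-C) (min C (∫ v, φ v * γ (k + 1) v ξ))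

variable {φ : ℝ → ℝ} {C : ℝ}

theorem abs_integral_mul_le {w : ℝ → ℝ} (hφC : ∀ v, |φ v| ≤ C) (hw0 : ∀ v, 0 ≤ w v)
    (hw : Integrable w) (h1 : ∫ v, w v = 1) : |∫ v, φ v * w v| ≤ C := by
  have := norm_integral_le_of_norm_le (f := fun v => φ v * w v) (hw.const_mul C)
    (Eventually.of_forall fun v => by
      rw [norm_mul, Real.norm_eq_abs, Real.norm_eq_abs, abs_of_nonneg (hw0 v)]
      exact mul_le_mul_of_nonneg_right (hφC v) (hw0 v))
  rwa [integral_const_mul, h1, mul_one] at this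

/-- The truncation makes the bound hold for every past, including the null set on which `γ` may fail
to be a probability density; elsewhere it is inactive because $|\int\varphi\gamma|\le C$. The
forecast identity is then Fubini for the joint law of $X_k$ and the past. -/
theorem isForecast_densityForecast (hε : IsIIDInnovation P ε) (hh : Measurable h)
    (hγ : IsCondDensity P ε (regressor h ε) γ) (hφ : Measurable φ) (hφC : ∀ v, |φ v| ≤ C) :
    IsForecast P ε (densityForecast h γ φ C) C := by
  have hC : 0 ≤ C := (abs_nonneg _).trans (hφC 0)
  have hp := measurable_past hε.measurable
  have hmeas : ∀ k, Measurable (densityForecast h γ φ C k) := by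
    intro k
    cases k with
    | zero => exact hφ.comp hh
    | succ k =>
      have h1 : Measurable fun p : ℝ × (ℕ → E) => φ p.1 * γ (k + 1) p.1 p.2 :=
        (hφ.comp measurable_fst).mul (hγ.measurable (k + 1) (by omega))
      have h2 : Measurable fun ξ => ∫ v, φ v * γ (k + 1) v ξ :=
        (h1.stronglyMeasurable.integral_prod_left' (μ := volume)).measurable
      exact measurable_const.max (measurable_const.min h2)
  have hbound : ∀ k ξ, |densityForecast h γ φ C k ξ| ≤ C := by
    intro k ξ
    cases k with
    | zero => exact hφC _
    | succ k =>
      rw [abs_le]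
      exact ⟨le_max_left _ _, max_le (by linarith) (min_le_left _ _)⟩
  refine ⟨hmeas, hbound, fun k G c hG hc => ?_⟩
  cases k with
  | zero => rfl
  | succ k =>
    have hk : 1 ≤ k + 1 := by omega
    have hX := measurable_regressor hε.measurable hh
    have hmap := hγ.map_prod hε hX hk
    have hmm : Measurable fun ω => (regressor h ε (k + 1 : ℕ) ω, past ε 0 ω) := (hX _).prodMk (hp 0)
    have : IsProbabilityMeasure (P.map (past ε 0)) :=
      Measure.isProbabilityMeasure_map (hp 0).aemeasurable
    have hof : Measurable fun p : ℝ × (ℕ → E) => ENNReal.ofReal (γ (k + 1) p.1 p.2) :=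
      (hγ.measurable (k + 1) hk).ennreal_ofReal
    set Ψ : ℝ × (ℕ → E) → ℝ := fun p => φ p.1 * G p.2 with hΨ
    have hΨm : Measurable Ψ := (hφ.comp measurable_fst).mul (hG.comp measurable_snd)
    have hΨint : Integrable Ψ (P.map fun ω => (regressor h ε (k + 1 : ℕ) ω, past ε 0 ω)) := by
      have : IsProbabilityMeasure (P.map fun ω => (regressor h ε (k + 1 : ℕ) ω, past ε 0 ω)) :=
        Measure.isProbabilityMeasure_map hmm.aemeasurable
      refine integrable_of_abs_le hΨm (C := C * c) fun p => ?_
      rw [hΨ, abs_mul]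
      exact mul_le_mul (hφC _) (hc _) (abs_nonneg _) hC
    have e1 : ∫ ω, densityForecast h γ φ C 0 (past ε (k + 1 : ℕ) ω) * G (past ε 0 ω) ∂P
        = ∫ p, Ψ p ∂(P.map fun ω => (regressor h ε (k + 1 : ℕ) ω, past ε 0 ω)) := by
      rw [integral_map hmm.aemeasurable hΨm.aestronglyMeasurable]
      rfl
    rw [hmap] at hΨint e1
    rw [integrable_withDensity_iff_integrable_smul' hof (by simp)] at hΨint
    rw [e1, integral_withDensity_eq_integral_toReal_smul hof (by simp),
      integral_prod_symm _ hΨint]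
    have hsm : StronglyMeasurable fun ξ : ℕ → E =>
        ∫ v, (ENNReal.ofReal (γ (k + 1) v ξ)).toReal • Ψ (v, ξ) :=
      StronglyMeasurable.integral_prod_left'
        (f := fun p : ℝ × (ℕ → E) => (ENNReal.ofReal (γ (k + 1) p.1 p.2)).toReal • Ψ p)
        (hof.ennreal_toReal.smul hΨm).stronglyMeasurable
    rw [integral_map (hp 0).aemeasurable hsm.aestronglyMeasurable]
    refine integral_congr_ae ?_
    filter_upwards [hγ.ae_integral_eq_one hε hk] with ω hω
    have hb := abs_le.1 (abs_integral_mul_le hφC (fun v => hγ.nonneg (k + 1) hk v (past ε 0 ω))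
      hω.1 hω.2)
    simp only [densityForecast]
    rw [min_eq_right hb.2, max_eq_right hb.1, ← integral_mul_const]
    refine integral_congr_ae (Eventually.of_forall fun v => ?_)
    simp only [hΨ, smul_eq_mul]
    rw [ENNReal.toReal_ofReal (hγ.nonneg (k + 1) hk _ _)]
    ring

theorem eLpNorm_two_rpow_two {α : Type*} [MeasurableSpace α] (m : Measure α) (w : α → ℝ) :
    eLpNorm w 2 m ^ (2 : ℝ) = ∫⁻ x, ‖w x‖ₑ ^ (2 : ℝ) ∂m := by
  simpa using eLpNorm_nnreal_pow_eq_lintegral (f := w) (μ := m) (p := 2) (by norm_num)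

/-- Minkowski's integral inequality in `L²` against a weight. -/
theorem eLpNorm_two_le_of_enorm_le_lintegral {α : Type*} [MeasurableSpace α] {m : Measure α}
    [SFinite m] {u : α → ℝ} {Δ : ℝ × α → ℝ} (hΔ : Measurable Δ) (hφ : Measurable φ)
    {θ : ℝ≥0∞} (hθ : ∀ v, eLpNorm (fun p => Δ (v, p)) 2 m ≤ θ)
    (hu : ∀ᵐ p ∂m, ‖u p‖ₑ ≤ ∫⁻ v, ‖φ v‖ₑ * ‖Δ (v, p)‖ₑ) :
    eLpNorm u 2 m ≤ (∫⁻ v, ‖φ v‖ₑ) * θ := by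
  set ν : Measure ℝ := volume.withDensity fun v => ‖φ v‖ₑ with hν
  have hνuniv : ν Set.univ = ∫⁻ v, ‖φ v‖ₑ := by simp [hν]
  have hpt : ∀ᵐ p ∂m, ‖u p‖ₑ ^ (2 : ℝ)
      ≤ (∫⁻ v, ‖Δ (v, p)‖ₑ ^ (2 : ℝ) ∂ν) * ∫⁻ v, ‖φ v‖ₑ := by
    filter_upwards [hu] with p hp
    have hΔp : Measurable fun v => Δ (v, p) := hΔ.comp (measurable_id.prodMk measurable_const)
    have h1 : ∫⁻ v, ‖φ v‖ₑ * ‖Δ (v, p)‖ₑ = eLpNorm (fun v => Δ (v, p)) 1 ν := by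
      rw [eLpNorm_one_eq_lintegral_enorm, hν,
        lintegral_withDensity_eq_lintegral_mul _ hφ.enorm hΔp.enorm]
      rfl
    -- Cauchy–Schwarz for the measure with density $|\varphi|$:
    -- $(\int|\varphi||\Delta|)^2\le\int|\varphi|\cdot\int|\varphi||\Delta|^2$.
    have h2 := eLpNorm_le_eLpNorm_mul_rpow_measure_univ (p := 1) (q := 2) (μ := ν)
      (f := fun v => Δ (v, p)) (by norm_num) hΔp.aestronglyMeasurable
    rw [h1] at hp
    refine (ENNReal.rpow_le_rpow (hp.trans h2) (by norm_num)).trans ?_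
    rw [ENNReal.mul_rpow_of_nonneg _ _ (by norm_num), eLpNorm_two_rpow_two, ← ENNReal.rpow_mul, hνuniv]
    norm_num
  have hlin : eLpNorm u 2 m ^ (2 : ℝ) ≤ ((∫⁻ v, ‖φ v‖ₑ) * θ) ^ (2 : ℝ) := by
    have hΔ2 : Measurable fun p : α × ℝ => ‖Δ (p.2, p.1)‖ₑ ^ (2 : ℝ) :=
      (hΔ.comp measurable_swap).enorm.pow_const _
    rw [eLpNorm_two_rpow_two]
    calc ∫⁻ p, ‖u p‖ₑ ^ (2 : ℝ) ∂m
        ≤ ∫⁻ p, (∫⁻ v, ‖Δ (v, p)‖ₑ ^ (2 : ℝ) ∂ν) * (∫⁻ v, ‖φ v‖ₑ) ∂m := lintegral_mono_ae hpt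
      _ = (∫⁻ v, ∫⁻ p, ‖Δ (v, p)‖ₑ ^ (2 : ℝ) ∂m ∂ν) * ∫⁻ v, ‖φ v‖ₑ := by
        rw [lintegral_mul_const _ hΔ2.lintegral_prod_right', lintegral_lintegral_swap]
        exact hΔ2.aemeasurable
      _ ≤ (∫⁻ _, θ ^ (2 : ℝ) ∂ν) * ∫⁻ v, ‖φ v‖ₑ := by
        gcongr with v
        rw [← eLpNorm_two_rpow_two]
        exact ENNReal.rpow_le_rpow (hθ v) (by norm_num)
      _ = ((∫⁻ v, ‖φ v‖ₑ) * θ) ^ (2 : ℝ) := by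
        rw [lintegral_const, hνuniv, ENNReal.mul_rpow_of_nonneg _ _ (by norm_num)]
        simp only [ENNReal.rpow_two]
        ring
  exact (ENNReal.rpow_le_rpow_iff (by norm_num)).1 hlin

/-- Truncation is a contraction, so the two forecasts differ by at most
$|\int\varphi(v)\Delta(v)\,dv|$, with $\Delta(v)$ the difference of conditional densities. Minkowski
then uses $\|\Delta(v)\|\le\theta_{k+1}$ for every $v$. -/
theorem eLpNorm_densityForecast_sub_le (hε : IsIIDInnovation P ε)
    (hγ : IsCondDensity P ε (regressor h ε) γ) (hφ : Measurable φ) (hφC : ∀ v, |φ v| ≤ C)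
    (k : ℕ) :
    eLpNorm (fun p : Ω × Ω => densityForecast h γ φ C (k + 1) (past ε 0 p.1)
        - densityForecast h γ φ C (k + 1) (past (coupled ε) 0 p)) 2 (P.prod P)
      ≤ (∫⁻ v, ‖φ v‖ₑ) * dependenceMeasure P ε γ (k + 1) := by
  have hk : 1 ≤ k + 1 := by omega
  have hp := measurable_past hε.measurable 0
  have hpc : Measurable (past (coupled ε) 0) :=
    measurable_past (measurable_coupled hε.measurable) 0
  have hγm := hγ.measurable (k + 1) hk
  set Δ : ℝ × (Ω × Ω) → ℝ := fun q =>
    γ (k + 1) q.1 (past ε 0 q.2.1) - γ (k + 1) q.1 (past (coupled ε) 0 q.2) with hΔ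
  have hΔm : Measurable Δ :=
    (hγm.comp (measurable_fst.prodMk (hp.comp (measurable_fst.comp measurable_snd)))).sub
      (hγm.comp (measurable_fst.prodMk (hpc.comp measurable_snd)))
  refine eLpNorm_two_le_of_enorm_le_lintegral hΔm hφ
    (fun v => le_iSup (fun y => eLpNorm (fun p : Ω × Ω => γ (k + 1) y (past ε 0 p.1)
      - γ (k + 1) y (past (coupled ε) 0 p)) 2 (P.prod P)) v) ?_
  have hone := hγ.ae_integral_eq_one hε hk
  have hS : MeasurableSet {ξ : ℕ → E | Integrable fun v => γ (k + 1) v ξ} :=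
    measurableSet_integrable (f := fun ξ v => γ (k + 1) v ξ)
      (hγm.comp measurable_swap).stronglyMeasurable
  have h1 : ∀ᵐ p ∂(P.prod P), Integrable fun v => γ (k + 1) v (past ε 0 p.1) := by
    have := Measure.quasiMeasurePreserving_fst (μ := P) (ν := P) |>.ae (hone.mono fun ω hω => hω.1)
    exact this
  -- Integrability at the coupled past comes from equality of the two laws, which is why the set of
  -- integrable pasts must be measurable.
  have h2 : ∀ᵐ p ∂(P.prod P), Integrable fun v => γ (k + 1) v (past (coupled ε) 0 p) := by
    refine ae_of_ae_map (f := past (coupled ε) 0) (p := fun ξ => Integrable fun v => γ (k + 1) v ξ)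
      hpc.aemeasurable ?_
    rw [hε.map_past_coupled]
    exact (ae_map_iff hp.aemeasurable hS).2 (hone.mono fun ω hω => hω.1)
  filter_upwards [h1, h2] with p hp1 hp2
  have hi : ∀ w : ℝ → ℝ, Integrable w → Integrable fun v => φ v * w v := fun w hw =>
    hw.bdd_mul (c := C) hφ.aestronglyMeasurable (Eventually.of_forall hφC)
  have hclip : ∀ a c : ℝ, |max (-C) (min C a) - max (-C) (min C c)| ≤ |a - c| := by
    intro a c
    have h1 := abs_max_sub_max_le_max (-C) (min C a) (-C) (min C c)
    have h2 := abs_min_sub_min_le_max C a C c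
    rw [sub_self, abs_zero] at h1 h2
    exact (h1.trans_eq (max_eq_right (abs_nonneg _))).trans
      (h2.trans_eq (max_eq_right (abs_nonneg _)))
  have h3 : |densityForecast h γ φ C (k + 1) (past ε 0 p.1)
      - densityForecast h γ φ C (k + 1) (past (coupled ε) 0 p)| ≤ |∫ v, φ v * Δ (v, p)| := by
    refine (hclip _ _).trans (le_of_eq ?_)
    rw [← integral_sub (hi _ hp1) (hi _ hp2)]
    simp only [hΔ, mul_sub]
  calc _ ≤ ‖∫ v, φ v * Δ (v, p)‖ₑ := by
        rw [Real.enorm_eq_ofReal_abs, Real.enorm_eq_ofReal_abs]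
        exact ENNReal.ofReal_le_ofReal h3
    _ ≤ ∫⁻ v, ‖φ v * Δ (v, p)‖ₑ := enorm_integral_le_lintegral_enorm _
    _ = _ := by simp_rw [enorm_mul]

/-- The centred sums of a bounded integrable function of the regressors. -/
theorem eLpNorm_sum_regressor_le (hε : IsIIDInnovation P ε) (hh : Measurable h)
    (hγ : IsCondDensity P ε (regressor h ε) γ) (hφ : Measurable φ) (hφC : ∀ v, |φ v| ≤ C)
    (n : ℕ) :
    eLpNorm (fun ω => ∑ t ∈ Finset.Icc 1 n,
        (φ (regressor h ε (t : ℤ) ω) - ∫ ω', φ (regressor h ε 0 ω') ∂P)) 2 P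
      ≤ ENNReal.ofReal √n * (eLpNorm (fun ω => φ (regressor h ε 0 ω)) 2 P
        + (∫⁻ v, ‖φ v‖ₑ) * totalDependence P ε γ) := by
  have hf := isForecast_densityForecast hε hh hγ hφ hφC
  refine (hf.eLpNorm_sum_sub_le hε n).trans ?_
  gcongr
  -- Lag zero is split off: no dependence coefficient controls it, and the second moment of the
  -- summand takes its place.
  rw [tsum_eq_zero_add' ENNReal.summable, totalDependence, ← ENNReal.tsum_mul_left]
  gcongr with k
  · exact hf.eLpNorm_diff_zero_le hε
  · exact (hf.eLpNorm_diff_le_coupled hε (k + 1)).trans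
      (eLpNorm_densityForecast_sub_le hε hγ hφ hφC k)

theorem integral_sum_regressor_sq_le (hε : IsIIDInnovation P ε) (hh : Measurable h)
    (hγ : IsCondDensity P ε (regressor h ε) γ) (hΘ : totalDependence P ε γ < ∞)
    (hφ : Measurable φ) (hφC : ∀ v, |φ v| ≤ C) (hφint : Integrable φ) (n : ℕ) :
    ∫ ω, (∑ t ∈ Finset.Icc 1 n,
        (φ (regressor h ε (t : ℤ) ω) - ∫ ω', φ (regressor h ε 0 ω') ∂P)) ^ 2 ∂P
      ≤ n * (√(∫ ω, φ (regressor h ε 0 ω) ^ 2 ∂P)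
        + (∫ v, |φ v|) * (totalDependence P ε γ).toReal) ^ 2 := by
  have hX := fun t => measurable_regressor hε.measurable hh t
  set c := ∫ ω', φ (regressor h ε 0 ω') ∂P with hc
  have key := eLpNorm_sum_regressor_le hε hh hγ hφ hφC n
  have hm : Measurable fun ω => ∑ t ∈ Finset.Icc 1 n, (φ (regressor h ε (t : ℤ) ω) - c) :=
    Finset.measurable_fun_sum _ fun t _ => (hφ.comp (hX t)).sub_const c
  have hb : ∀ ω, |∑ t ∈ Finset.Icc 1 n, (φ (regressor h ε (t : ℤ) ω) - c)|
      ≤ ∑ t ∈ Finset.Icc 1 n, (C + |c|) := fun ω =>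
    (Finset.abs_sum_le_sum_abs _ _).trans (Finset.sum_le_sum fun t _ =>
      (abs_sub _ _).trans (add_le_add (hφC _) le_rfl))
  have hm0 : Measurable fun ω => φ (regressor h ε 0 ω) := hφ.comp (hX 0)
  rw [eLpNorm_two_eq_ofReal_sqrt hm.aestronglyMeasurable
      (integrable_of_abs_le (hm.pow_const 2) (C := (∑ t ∈ Finset.Icc 1 n, (C + |c|)) ^ 2)
        fun ω => by rw [abs_pow]; exact pow_le_pow_left₀ (abs_nonneg _) (hb ω) 2),
    eLpNorm_two_eq_ofReal_sqrt hm0.aestronglyMeasurable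
      (integrable_of_abs_le (hm0.pow_const 2) (C := C ^ 2)
        fun ω => by rw [abs_pow]; exact pow_le_pow_left₀ (abs_nonneg _) (hφC _) 2),
    ← ofReal_integral_norm_eq_lintegral_enorm hφint, ← ENNReal.ofReal_toReal hΘ.ne,
    ← ENNReal.ofReal_mul (integral_nonneg fun _ => norm_nonneg _),
    ← ENNReal.ofReal_add (Real.sqrt_nonneg _)
      (mul_nonneg (integral_nonneg fun _ => norm_nonneg _) ENNReal.toReal_nonneg),
    ← ENNReal.ofReal_mul (Real.sqrt_nonneg _), ENNReal.ofReal_le_ofReal_iff (mul_nonneg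
      (Real.sqrt_nonneg _) (add_nonneg (Real.sqrt_nonneg _)
      (mul_nonneg (integral_nonneg fun _ => norm_nonneg _) ENNReal.toReal_nonneg)))] at key
  have := (Real.sqrt_le_left (mul_nonneg
      (Real.sqrt_nonneg _) (add_nonneg (Real.sqrt_nonneg _)
      (mul_nonneg (integral_nonneg fun _ => norm_nonneg _) ENNReal.toReal_nonneg)))).1 key
  rw [mul_pow, Real.sq_sqrt (Nat.cast_nonneg n)] at this
  exact this

end RegressorSums

/-! ### Weighted sums of errors -/

section Errors

variable {Ω E : Type*} [MeasurableSpace Ω] [MeasurableSpace E] {P : Measure Ω}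
  [IsProbabilityMeasure P] {ε : ℤ → Ω → E} {e : ℕ → ℕ → Ω → ℝ} {n t : ℕ}

theorem IsErrorArray.indepFun (he : IsErrorArray P ε e) (ht : t ∈ Finset.Icc 1 n) {u : Ω → ℝ}
    {ζ : ℝ → ℝ}
    (hu : Measurable[innovationField ε (t : ℤ) ⊔
        ⨆ s ∈ Finset.Ico 1 t, MeasurableSpace.comap (e n s) inferInstance] u)
    (hζ : Measurable ζ) : u ⟂ᵢ[P] fun ω => ζ (e n t ω) := by
  rw [IndepFun_iff_Indep]
  refine (indep_of_indep_of_le_left (indep_of_indep_of_le_right (he.indep_past n t ht) ?_) ?_).symm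
  · exact measurable_iff_comap_le.1 hu
  · exact measurable_iff_comap_le.1 (hζ.comp (comap_measurable _))

theorem IsErrorArray.indepFun_of_innovationField (he : IsErrorArray P ε e)
    (ht : t ∈ Finset.Icc 1 n) {u : Ω → ℝ} {ζ : ℝ → ℝ} (hu : Measurable[innovationField ε (t : ℤ)] u)
    (hζ : Measurable ζ) : u ⟂ᵢ[P] fun ω => ζ (e n t ω) :=
  he.indepFun ht (hu.mono le_sup_left le_rfl) hζ

theorem IsErrorArray.identDistrib_comp (he : IsErrorArray P ε e) (ht : t ∈ Finset.Icc 1 n)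
    {ζ : ℝ → ℝ} (hζ : Measurable ζ) :
    IdentDistrib (fun ω => ζ (e n t ω)) (fun ω => ζ (e 1 1 ω)) P P :=
  (he.identDistrib n t ht).comp hζ

theorem IsErrorArray.integrable_mul_comp (he : IsErrorArray P ε e) (ht : t ∈ Finset.Icc 1 n)
    {u : Ω → ℝ} {ζ : ℝ → ℝ} (hu : Measurable[innovationField ε (t : ℤ)] u) (hui : Integrable u P)
    (hζ : Measurable ζ) (hζi : Integrable (fun ω => ζ (e 1 1 ω)) P) :
    Integrable (fun ω => u ω * ζ (e n t ω)) P :=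
  (he.indepFun_of_innovationField ht hu hζ).integrable_mul hui
    ((he.identDistrib_comp ht hζ).integrable_iff.2 hζi)

theorem IsErrorArray.integral_mul_comp (he : IsErrorArray P ε e) (ht : t ∈ Finset.Icc 1 n)
    {u : Ω → ℝ} {ζ : ℝ → ℝ} (hu : Measurable[innovationField ε (t : ℤ)] u) (hui : Integrable u P)
    (hζ : Measurable ζ) (hζi : Integrable (fun ω => ζ (e 1 1 ω)) P) :
    ∫ ω, u ω * ζ (e n t ω) ∂P = (∫ ω, u ω ∂P) * ∫ ω, ζ (e 1 1 ω) ∂P := by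
  have hid := he.identDistrib_comp ht hζ
  rw [(he.indepFun_of_innovationField ht hu hζ).integral_fun_mul_eq_mul_integral
    hui.aestronglyMeasurable (hid.integrable_iff.2 hζi).aestronglyMeasurable, hid.integral_eq]

theorem one_mem_Icc_one : (1 : ℕ) ∈ Finset.Icc 1 1 := by simp

theorem IsErrorArray.integrable_sq (he : IsErrorArray P ε e) :
    Integrable (fun ω => e 1 1 ω ^ 2) P :=
  (he.memLp 1 1 one_mem_Icc_one).integrable_sq

/-- Weighted sums of centred functions of the errors, with weights that depend on the past only,
are sums of martingale differences. -/
theorem IsErrorArray.integral_sum_sq (he : IsErrorArray P ε e) (hε : ∀ i, Measurable (ε i))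
    {a : ℕ → Ω → ℝ} {A : ℝ} (ha : ∀ t : ℕ, Measurable[innovationField ε (t : ℤ)] (a t))
    (haA : ∀ t ω, |a t ω| ≤ A) {ζ : ℝ → ℝ} (hζ : Measurable ζ)
    (hζ2 : MemLp (fun ω => ζ (e 1 1 ω)) 2 P) (hζ0 : ∫ ω, ζ (e 1 1 ω) ∂P = 0) (n : ℕ) :
    Integrable (fun ω => (∑ t ∈ Finset.Icc 1 n, a t ω * ζ (e n t ω)) ^ 2) P ∧
    ∫ ω, (∑ t ∈ Finset.Icc 1 n, a t ω * ζ (e n t ω)) ^ 2 ∂P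
      = (∑ t ∈ Finset.Icc 1 n, ∫ ω, a t ω ^ 2 ∂P) * ∫ ω, ζ (e 1 1 ω) ^ 2 ∂P := by
  have ha' : ∀ t, Measurable (a t) := fun t => (ha t).mono (innovationField_le hε _) le_rfl
  have hmem : ∀ t ∈ Finset.Icc 1 n, MemLp (fun ω => ζ (e n t ω)) 2 P := fun t ht =>
    (he.identDistrib_comp ht hζ).memLp_iff.2 hζ2
  have hmem' : ∀ t ∈ Finset.Icc 1 n, MemLp (fun ω => a t ω * ζ (e n t ω)) 2 P := fun t ht =>
    (hmem t ht).of_le_mul (c := A)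
      ((ha' t).aestronglyMeasurable.mul (hmem t ht).aestronglyMeasurable)
      (Eventually.of_forall fun ω => by
        rw [norm_mul]
        exact mul_le_mul_of_nonneg_right (haA t ω) (norm_nonneg _))
  have hint : ∀ i ∈ Finset.Icc 1 n, ∀ j ∈ Finset.Icc 1 n,
      Integrable (fun ω => a i ω * ζ (e n i ω) * (a j ω * ζ (e n j ω))) P := fun i hi j hj =>
    (hmem' i hi).integrable_mul (hmem' j hj)
  have hlt : ∀ i ∈ Finset.Icc 1 n, ∀ j ∈ Finset.Icc 1 n, i < j →
      ∫ ω, a i ω * ζ (e n i ω) * (a j ω * ζ (e n j ω)) ∂P = 0 := by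
    intro i hi j hj hij
    -- For $i<j$, everything except $\zeta(e_j)$ is measurable with respect to the innovations up to
    -- $j$ and the earlier errors, hence independent of $e_j$.
    set u : Ω → ℝ := fun ω => a i ω * ζ (e n i ω) * a j ω with hu
    have hum : Measurable[innovationField ε (j : ℤ) ⊔
        ⨆ s ∈ Finset.Ico 1 j, MeasurableSpace.comap (e n s) inferInstance] u := by
      have h1 : Measurable[innovationField ε (j : ℤ) ⊔
          ⨆ s ∈ Finset.Ico 1 j, MeasurableSpace.comap (e n s) inferInstance] (a j) :=
        (ha j).mono le_sup_left le_rfl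
      have h2 : innovationField ε (i : ℤ) ≤ innovationField ε (j : ℤ) :=
        measurable_iff_comap_le.1 (measurable_past_innovationField ε (by exact_mod_cast hij.le))
      have h3 : Measurable[innovationField ε (j : ℤ) ⊔
          ⨆ s ∈ Finset.Ico 1 j, MeasurableSpace.comap (e n s) inferInstance] (a i) :=
        (ha i).mono (h2.trans le_sup_left) le_rfl
      have hi' : i ∈ Finset.Ico 1 j := by
        rw [Finset.mem_Ico]; exact ⟨(Finset.mem_Icc.1 hi).1, hij⟩
      have h4 : Measurable[innovationField ε (j : ℤ) ⊔
          ⨆ s ∈ Finset.Ico 1 j, MeasurableSpace.comap (e n s) inferInstance]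
          fun ω => ζ (e n i ω) :=
        (hζ.comp (comap_measurable (e n i))).mono (le_trans (le_iSup₂_of_le i hi' le_rfl)
          le_sup_right) le_rfl
      exact @Measurable.mul _ _ _ _ _ (_) _ _ (@Measurable.mul _ _ _ _ _ (_) _ _ h3 h4) h1
    have hind := he.indepFun hj hum hζ
    have e1 : ∀ ω, a i ω * ζ (e n i ω) * (a j ω * ζ (e n j ω)) = u ω * ζ (e n j ω) :=
      fun ω => by simp only [hu]; ring
    simp_rw [e1]
    have hum' : AEStronglyMeasurable u P :=
      ((hmem' i hi).aestronglyMeasurable).mul (ha' j).aestronglyMeasurable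
    rw [hind.integral_fun_mul_eq_mul_integral hum' (hmem j hj).aestronglyMeasurable,
      (he.identDistrib_comp hj hζ).integral_eq, hζ0, mul_zero]
  refine ⟨?_, ?_⟩
  · simp_rw [sq, Finset.sum_mul_sum]
    exact integrable_finsetSum _ fun i hi => integrable_finsetSum _ fun j hj => hint i hi j hj
  · rw [integral_sum_sq_of_orthogonal _ hint, Finset.sum_mul]
    · refine Finset.sum_congr rfl fun t ht => ?_
      simp_rw [mul_pow]
      refine he.integral_mul_comp ht (u := fun ω => a t ω ^ 2) (ζ := fun y => ζ y ^ 2)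
        ((ha t).pow_const 2) ?_ (hζ.pow_const 2) hζ2.integrable_sq
      refine integrable_of_abs_le ((ha' t).pow_const 2) (C := A ^ 2) fun ω => ?_
      rw [abs_pow]
      exact pow_le_pow_left₀ (abs_nonneg _) (haA t ω) 2
    · intro i hi j hj hij
      rcases lt_or_gt_of_ne hij with h | h
      · exact hlt i hi j hj h
      · rw [← hlt j hj i hi h]
        exact integral_congr_ae (Eventually.of_forall fun ω => mul_comm _ _)

end Errors

/-! ### Kernels and bandwidths -/

/-- Bounded integrable Lipschitz kernels with an integrable second moment and cubic decay. -/
structure IsTameKernel (κ : ℝ → ℝ) : Prop where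
  lipschitz : ∃ L : ℝ, 0 ≤ L ∧ ∀ u v, |κ u - κ v| ≤ L * |u - v|
  bounded : ∃ C : ℝ, ∀ u, |κ u| ≤ C
  integrable : Integrable κ
  integrable_sq_mul : Integrable fun u => u ^ 2 * κ u
  decay : ∃ A : ℝ, ∀ u, |u| ^ 3 * |κ u| ≤ A

/-- Bandwidths `b n → 0` with `n (b n)³ → ∞`. -/
structure IsBandwidth (b : ℕ → ℝ) : Prop where
  pos : ∀ᶠ n in atTop, 0 < b n
  tendsto : Tendsto b atTop (𝓝 0)
  tendsto_cube : Tendsto (fun n : ℕ => n * b n ^ 3) atTop atTop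

section Kernels

variable {κ κ' : ℝ → ℝ} {b : ℕ → ℝ}

theorem IsTameKernel.continuous (hκ : IsTameKernel κ) : Continuous κ := by
  obtain ⟨L, hL0, hL⟩ := hκ.lipschitz
  exact (LipschitzWith.of_dist_le_mul (K := ⟨L, hL0⟩) fun u v => by
    rw [Real.dist_eq, Real.dist_eq]; exact hL u v).continuous

theorem IsTameKernel.abs (hκ : IsTameKernel κ) : IsTameKernel fun u => |κ u| where
  lipschitz := by
    obtain ⟨L, hL0, hL⟩ := hκ.lipschitz
    exact ⟨L, hL0, fun u v => (abs_abs_sub_abs_le_abs_sub _ _).trans (hL u v)⟩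
  bounded := by
    obtain ⟨C, hC⟩ := hκ.bounded
    exact ⟨C, fun u => by rw [abs_abs]; exact hC u⟩
  integrable := hκ.integrable.abs
  integrable_sq_mul := hκ.integrable_sq_mul.abs.congr (Eventually.of_forall fun u => by
    simp only [abs_mul, abs_pow, sq_abs])
  decay := by
    obtain ⟨A, hA⟩ := hκ.decay
    exact ⟨A, fun u => by rw [abs_abs]; exact hA u⟩

theorem IsTameKernel.const_mul (hκ : IsTameKernel κ) (c : ℝ) : IsTameKernel fun u => c * κ u where
  lipschitz := by
    obtain ⟨L, hL0, hL⟩ := hκ.lipschitz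
    refine ⟨|c| * L, by positivity, fun u v => ?_⟩
    rw [← mul_sub, abs_mul, mul_assoc]
    exact mul_le_mul_of_nonneg_left (hL u v) (abs_nonneg c)
  bounded := by
    obtain ⟨C, hC⟩ := hκ.bounded
    exact ⟨|c| * C, fun u => by
      rw [abs_mul]; exact mul_le_mul_of_nonneg_left (hC u) (abs_nonneg c)⟩
  integrable := hκ.integrable.const_mul c
  integrable_sq_mul := (hκ.integrable_sq_mul.const_mul c).congr (Eventually.of_forall fun u => by
    simp only; ring)
  decay := by
    obtain ⟨A, hA⟩ := hκ.decay
    refine ⟨|c| * A, fun u => ?_⟩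
    rw [abs_mul, mul_left_comm]
    exact mul_le_mul_of_nonneg_left (hA u) (abs_nonneg c)

theorem IsTameKernel.sub (hκ : IsTameKernel κ) (hκ' : IsTameKernel κ') :
    IsTameKernel fun u => κ u - κ' u where
  lipschitz := by
    obtain ⟨L, hL0, hL⟩ := hκ.lipschitz
    obtain ⟨L', hL0', hL'⟩ := hκ'.lipschitz
    refine ⟨L + L', by positivity, fun u v => ?_⟩
    have : κ u - κ' u - (κ v - κ' v) = (κ u - κ v) - (κ' u - κ' v) := by ring
    rw [this, add_mul]
    exact (abs_sub _ _).trans (add_le_add (hL u v) (hL' u v))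
  bounded := by
    obtain ⟨C, hC⟩ := hκ.bounded
    obtain ⟨C', hC'⟩ := hκ'.bounded
    exact ⟨C + C', fun u => (abs_sub _ _).trans (add_le_add (hC u) (hC' u))⟩
  integrable := hκ.integrable.sub hκ'.integrable
  integrable_sq_mul := (hκ.integrable_sq_mul.sub hκ'.integrable_sq_mul).congr
    (Eventually.of_forall fun u => by simp only [Pi.sub_apply]; ring)
  decay := by
    obtain ⟨A, hA⟩ := hκ.decay
    obtain ⟨A', hA'⟩ := hκ'.decay
    refine ⟨A + A', fun u => ?_⟩
    refine (mul_le_mul_of_nonneg_left (abs_sub (κ u) (κ' u)) (by positivity)).trans ?_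
    rw [mul_add]
    exact add_le_add (hA u) (hA' u)

theorem IsTameKernel.comp_div (hκ : IsTameKernel κ) {c : ℝ} (hc : 0 < c) :
    IsTameKernel fun u => κ (u / c) where
  lipschitz := by
    obtain ⟨L, hL0, hL⟩ := hκ.lipschitz
    refine ⟨L / c, by positivity, fun u v => (hL _ _).trans (le_of_eq ?_)⟩
    rw [← sub_div, abs_div, abs_of_pos hc]
    ring
  bounded := by
    obtain ⟨C, hC⟩ := hκ.bounded
    exact ⟨C, fun u => hC _⟩
  integrable := hκ.integrable.comp_div hc.ne'
  integrable_sq_mul := ((hκ.integrable_sq_mul.comp_div hc.ne').const_mul (c ^ 2)).congr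
    (Eventually.of_forall fun u => by field_simp)
  decay := by
    obtain ⟨A, hA⟩ := hκ.decay
    refine ⟨c ^ 3 * A, fun u => ?_⟩
    refine le_trans (le_of_eq ?_) (mul_le_mul_of_nonneg_left (hA (u / c)) (by positivity))
    rw [abs_div, abs_of_pos hc]
    field_simp

/-- Cubic decay is what distant points require: at distance at least $\delta$ the weight is
$O(c^3)$, which stays negligible after division by the bandwidth $c$. -/
theorem IsTameKernel.exists_decay (hκ : IsTameKernel κ) : ∃ A : ℝ, 0 ≤ A ∧
    ∀ δ : ℝ, 0 < δ → ∀ c : ℝ, 0 < c → ∀ z, δ ≤ |z| → |κ (z / c)| ≤ A / δ ^ 3 * c ^ 3 := by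
  obtain ⟨A, hA⟩ := hκ.decay
  refine ⟨A, (by simpa using hA 0), fun δ hδ c hc z hz => ?_⟩
  have h1 := hA (z / c)
  rw [abs_div, abs_of_pos hc, div_pow] at h1
  have h2 : δ ^ 3 ≤ |z| ^ 3 := pow_le_pow_left₀ hδ.le hz 3
  have h3 : δ ^ 3 / c ^ 3 * |κ (z / c)| ≤ A :=
    (mul_le_mul_of_nonneg_right (div_le_div_of_nonneg_right h2 (by positivity))
      (abs_nonneg _)).trans h1
  have h4 : 0 < δ ^ 3 := by positivity
  have h5 : 0 < c ^ 3 := by positivity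
  rw [div_mul_eq_mul_div, le_div_iff₀ h4]
  rw [div_mul_eq_mul_div, div_le_iff₀ h5] at h3
  linarith

theorem integral_kernel_comp (κ : ℝ → ℝ) {c : ℝ} (hc : 0 < c) (y : ℝ) :
    ∫ v, κ ((y - v) / c) = c * ∫ u, κ u := by
  rw [integral_sub_left_eq_self (fun w => κ (w / c)) volume y, Measure.integral_comp_div,
    abs_of_pos hc, smul_eq_mul]

theorem integrable_kernel_comp (hκ : Integrable κ) {c : ℝ} (hc : 0 < c) (y : ℝ) :
    Integrable fun v => κ ((y - v) / c) :=
  (hκ.comp_div hc.ne').comp_sub_left y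

theorem IsBandwidth.const_mul (hb : IsBandwidth b) {c : ℝ} (hc : 0 < c) :
    IsBandwidth fun n => c * b n where
  pos := hb.pos.mono fun n hn => mul_pos hc hn
  tendsto := by simpa using hb.tendsto.const_mul c
  tendsto_cube := (hb.tendsto_cube.const_mul_atTop (pow_pos hc 3)).congr fun n => by ring

theorem IsBandwidth.eventually_pos (hb : IsBandwidth b) :
    ∀ᶠ n in atTop, 0 < b n ∧ b n ≤ 1 ∧ (0 : ℝ) < n ∧ (0 : ℝ) < n * b n := by
  filter_upwards [hb.pos, hb.tendsto.eventually (gt_mem_nhds one_pos), eventually_ge_atTop 1]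
    with n h1 h2 h3
  have h4 : (0 : ℝ) < n := by exact_mod_cast h3
  exact ⟨h1, h2.le, h4, mul_pos h4 h1⟩

/-- `Ψ v` is close to `Ψ y` for `v` close to `y`, uniformly in `y ∈ S`. -/
def UniformlyContinuousNear (Ψ : ℝ → ℝ) (S : Set ℝ) : Prop :=
  ∀ η > 0, ∃ δ > 0, ∀ y ∈ S, ∀ v, |y - v| ≤ δ → |Ψ v - Ψ y| ≤ η

/-- Heine's theorem on the larger ball; the margin $R-R'$ keeps nearby points inside it, so the jump
of the indicator is never met. -/
theorem uniformlyContinuousNear_indicator {ψ : ℝ → ℝ} {x R R' : ℝ} (hR : R' < R)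
    (hψ : ContinuousOn ψ (Metric.closedBall x R)) :
    UniformlyContinuousNear ((Metric.closedBall x R).indicator ψ) (Metric.closedBall x R') := by
  intro η hη
  have hu := (isCompact_closedBall x R).uniformContinuousOn_of_continuous hψ
  rw [Metric.uniformContinuousOn_iff] at hu
  obtain ⟨δ, hδ, h⟩ := hu η hη
  refine ⟨min (δ / 2) (R - R'), lt_min (by positivity) (by linarith), fun y hy v hv => ?_⟩
  have hy' : y ∈ Metric.closedBall x R := Metric.closedBall_subset_closedBall hR.le hy
  have hv' : v ∈ Metric.closedBall x R := by
    rw [Metric.mem_closedBall] at hy ⊢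
    have h1 : dist v y ≤ R - R' := by
      rw [dist_comm, Real.dist_eq]; exact hv.trans (min_le_right _ _)
    linarith [dist_triangle v y x]
  rw [Set.indicator_of_mem hy', Set.indicator_of_mem hv', ← Real.dist_eq]
  refine (h v hv' y hy' ?_).le
  rw [dist_comm, Real.dist_eq]
  have := hv.trans (min_le_left _ _)
  linarith

theorem exists_bound_indicator {ψ : ℝ → ℝ} {x R : ℝ}
    (hψ : ContinuousOn ψ (Metric.closedBall x R)) :
    ∃ M : ℝ, 0 ≤ M ∧ ∀ v, |(Metric.closedBall x R).indicator ψ v| ≤ M := by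
  obtain ⟨M, hM⟩ := (isCompact_closedBall x R).exists_bound_of_continuousOn hψ
  refine ⟨max M 0, le_max_right _ _, fun v => ?_⟩
  by_cases hv : v ∈ Metric.closedBall x R
  · rw [Set.indicator_of_mem hv]
    exact (hM v hv).trans (le_max_left _ _)
  · rw [Set.indicator_of_notMem hv, abs_zero]
    exact le_max_right _ _

/-- Rescaled kernels form an approximate identity, uniformly on `S`. -/
theorem eventually_abs_integral_kernel_sub_le (hκ : IsTameKernel κ) (hb : IsBandwidth b)
    {Ψ : ℝ → ℝ} {S : Set ℝ} {M : ℝ} (hΨ : Measurable Ψ) (hM : ∀ v, |Ψ v| ≤ M)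
    (hS : UniformlyContinuousNear Ψ S) {η : ℝ} (hη : 0 < η) :
    ∀ᶠ n in atTop, ∀ y ∈ S,
      |1 / b n * (∫ v, κ ((y - v) / b n) * Ψ v) - Ψ y * ∫ u, κ u| ≤ η := by
  have hM0 : 0 ≤ M := (abs_nonneg _).trans (hM 0)
  set I := ∫ u, |κ u| with hI
  set J := ∫ u, u ^ 2 * |κ u| with hJ
  have hI0 : 0 ≤ I := integral_nonneg fun _ => abs_nonneg _
  -- The near part contributes at most $\eta I/(2(I+1))\le\eta/2$; the added $1$ avoids dividing by
  -- zero.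
  obtain ⟨δ, hδ, hnear⟩ := hS (η / (2 * (I + 1))) (by positivity)
  have hlim : Tendsto (fun n => 2 * M / δ ^ 2 * (b n ^ 2 * J)) atTop (𝓝 0) := by
    have := ((hb.tendsto.pow 2).mul_const J).const_mul (2 * M / δ ^ 2)
    simpa using this
  filter_upwards [hb.pos, hlim.eventually (gt_mem_nhds (show 0 < η / 2 by positivity))]
    with n hbn hn y hy
  have hi1 : Integrable fun v => κ ((y - v) / b n) := integrable_kernel_comp hκ.integrable hbn y
  have hi2 : Integrable fun v => κ ((y - v) / b n) * Ψ v :=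
    hi1.mul_bdd (c := M) hΨ.aestronglyMeasurable (Eventually.of_forall hM)
  have hi3 : Integrable fun v => |κ ((y - v) / b n)| := hi1.abs
  have hi4 : Integrable fun v => ((y - v) / b n) ^ 2 * |κ ((y - v) / b n)| :=
    integrable_kernel_comp hκ.abs.integrable_sq_mul hbn y
  have e1 : 1 / b n * (∫ v, κ ((y - v) / b n) * Ψ v) - Ψ y * ∫ u, κ u
      = 1 / b n * ∫ v, κ ((y - v) / b n) * (Ψ v - Ψ y) := by
    simp_rw [mul_sub]
    rw [integral_sub hi2 (hi1.mul_const _), integral_mul_const, integral_kernel_comp κ hbn]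
    field_simp
  have hpt : ∀ v, |κ ((y - v) / b n) * (Ψ v - Ψ y)|
      ≤ η / (2 * (I + 1)) * |κ ((y - v) / b n)|
        + 2 * M * (b n ^ 2 / δ ^ 2) * (((y - v) / b n) ^ 2 * |κ ((y - v) / b n)|) := by
    intro v
    rw [abs_mul, mul_comm]
    by_cases hv : |y - v| ≤ δ
    · refine (mul_le_mul_of_nonneg_right (hnear y hy v hv) (abs_nonneg _)).trans ?_
      refine le_add_of_nonneg_right ?_
      positivity
    · have h1 : |Ψ v - Ψ y| ≤ 2 * M := (abs_sub _ _).trans (by linarith [hM v, hM y])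
      -- Chebyshev's device: beyond distance $\delta$ the factor $(|y-v|/\delta)^2\ge1$ is inserted,
      -- and the second moment of the kernel pays for it with a factor $b^2$.
      have h2 : 1 ≤ b n ^ 2 / δ ^ 2 * ((y - v) / b n) ^ 2 := by
        have : b n ^ 2 / δ ^ 2 * ((y - v) / b n) ^ 2 = (|y - v| / δ) ^ 2 := by
          rw [div_pow, div_pow, sq_abs]; field_simp
        rw [this]
        exact one_le_pow₀ ((one_le_div hδ).2 (not_le.1 hv).le)
      calc |Ψ v - Ψ y| * |κ ((y - v) / b n)|
          ≤ 2 * M * (b n ^ 2 / δ ^ 2 * ((y - v) / b n) ^ 2) * |κ ((y - v) / b n)| := by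
            gcongr
            nlinarith
        _ ≤ _ := by
            have : 0 ≤ η / (2 * (I + 1)) * |κ ((y - v) / b n)| := by positivity
            linarith
  have h5 : |∫ v, κ ((y - v) / b n) * (Ψ v - Ψ y)|
      ≤ η / (2 * (I + 1)) * (b n * I) + 2 * M * (b n ^ 2 / δ ^ 2) * (b n * J) := by
    have hi5 : Integrable fun v => η / (2 * (I + 1)) * |κ ((y - v) / b n)|
        + 2 * M * (b n ^ 2 / δ ^ 2) * (((y - v) / b n) ^ 2 * |κ ((y - v) / b n)|) :=
      (hi3.const_mul _).add (hi4.const_mul _)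
    have := norm_integral_le_of_norm_le
      (f := fun v => κ ((y - v) / b n) * (Ψ v - Ψ y)) hi5 (Eventually.of_forall hpt)
    rw [integral_add (hi3.const_mul _) (hi4.const_mul _), integral_const_mul, integral_const_mul,
      integral_kernel_comp (fun u => |κ u|) hbn,
      integral_kernel_comp (fun u => u ^ 2 * |κ u|) hbn] at this
    exact this
  rw [e1, abs_mul, abs_of_pos (one_div_pos.2 hbn)]
  have h6 : η / (2 * (I + 1)) * I ≤ η / 2 := by
    rw [div_mul_eq_mul_div, div_le_div_iff₀ (by positivity) (by norm_num)]
    nlinarith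
  calc 1 / b n * |∫ v, κ ((y - v) / b n) * (Ψ v - Ψ y)|
      ≤ 1 / b n * (η / (2 * (I + 1)) * (b n * I) + 2 * M * (b n ^ 2 / δ ^ 2) * (b n * J)) := by
        gcongr
    _ = η / (2 * (I + 1)) * I + 2 * M / δ ^ 2 * (b n ^ 2 * J) := by field_simp
    _ ≤ η := by linarith

end Kernels

/-! ### Uniform consistency of kernel density estimators -/

/-- Identically distributed design points whose centred sums have second moments of the order of
independent ones, with a density that is continuous around `x`. -/
structure IsLocalDesign {Ω : Type*} [MeasurableSpace Ω] (P : Measure Ω) (X : ℕ → Ω → ℝ)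
    (g : ℝ → ℝ) (x ρ : ℝ) : Prop where
  measurable : ∀ t, Measurable (X t)
  identDistrib : ∀ t, IdentDistrib (X t) (X 0) P P
  density : IsDensityOf P (X 0) g
  pos : 0 < ρ
  continuousOn : ContinuousOn g (Metric.closedBall x (2 * ρ))
  moment : ∃ Θ : ℝ, ∀ φ : ℝ → ℝ, Measurable φ → (∃ C, ∀ v, |φ v| ≤ C) → Integrable φ → ∀ n : ℕ,
    ∫ ω, (∑ t ∈ Finset.Icc 1 n, (φ (X t ω) - ∫ ω', φ (X 0 ω') ∂P)) ^ 2 ∂P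
      ≤ n * (√(∫ ω, φ (X 0 ω) ^ 2 ∂P) + (∫ v, |φ v|) * Θ) ^ 2

section Design

variable {Ω : Type*} [MeasurableSpace Ω] {P : Measure Ω} [IsProbabilityMeasure P]
  {X : ℕ → Ω → ℝ} {g : ℝ → ℝ} {x ρ : ℝ} {κ : ℝ → ℝ} {b : ℕ → ℝ}

theorem IsLocalDesign.integral_comp (hX : IsLocalDesign P X g x ρ) {φ : ℝ → ℝ}
    (hφ : Measurable φ) (t : ℕ) : ∫ ω, φ (X t ω) ∂P = ∫ v, φ v * g v := by
  have h1 : ∫ ω, φ (X t ω) ∂P = ∫ ω, φ (X 0 ω) ∂P :=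
    ((hX.identDistrib t).comp hφ).integral_eq
  rw [h1, ← integral_map (hX.measurable 0).aemeasurable hφ.aestronglyMeasurable,
    hX.density.map_eq, integral_withDensity_eq_integral_toReal_smul
      hX.density.measurable.ennreal_ofReal (by simp)]
  refine integral_congr_ae (Eventually.of_forall fun v => ?_)
  simp only [smul_eq_mul]
  rw [ENNReal.toReal_ofReal (hX.density.nonneg v), mul_comm]

theorem IsLocalDesign.exists_density_bound (hX : IsLocalDesign P X g x ρ) :
    ∃ G : ℝ, 0 ≤ G ∧ ∀ v ∈ Metric.closedBall x (2 * ρ), g v ≤ G := by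
  obtain ⟨G, hG0, hG⟩ := exists_bound_indicator hX.continuousOn
  refine ⟨G, hG0, fun v hv => ?_⟩
  have := hG v
  rw [Set.indicator_of_mem hv] at this
  exact (le_abs_self _).trans this

/-- The expectation of a function of the design supported near `x`. -/
theorem IsLocalDesign.integral_comp_le (hX : IsLocalDesign P X g x ρ) {G : ℝ}
    (hG : ∀ v ∈ Metric.closedBall x (2 * ρ), g v ≤ G) {φ ψ : ℝ → ℝ} (hφ : Measurable φ)
    (h0 : ∀ v, 0 ≤ φ v) (hsupp : ∀ v ∉ Metric.closedBall x (2 * ρ), φ v = 0)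
    (hle : ∀ v, φ v ≤ ψ v) (hψ : Integrable ψ) (t : ℕ) :
    ∫ ω, φ (X t ω) ∂P ≤ G * ∫ v, ψ v := by
  rw [hX.integral_comp hφ, ← integral_const_mul]
  have hG0 : 0 ≤ G := (hX.density.nonneg x).trans (hG x (by simp [hX.pos.le]))
  refine integral_mono_of_nonneg (Eventually.of_forall fun v =>
    mul_nonneg (h0 v) (hX.density.nonneg v)) (hψ.const_mul G) (Eventually.of_forall fun v => ?_)
  simp only
  by_cases hv : v ∈ Metric.closedBall x (2 * ρ)
  · rw [mul_comm]
    exact mul_le_mul (hG v hv) (hle v) (h0 v) hG0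
  · rw [hsupp v hv, zero_mul]
    exact mul_nonneg hG0 ((h0 v).trans (hle v))

theorem far_of_mem {x ρ y v : ℝ} (hy : y ∈ Metric.closedBall x ρ)
    (hv : v ∉ Metric.closedBall x (2 * ρ)) : ρ ≤ |y - v| := by
  rw [Metric.mem_closedBall] at hy hv
  rw [← Real.dist_eq, dist_comm]
  linarith [dist_triangle v y x]

theorem abs_sum_div_le {s : Finset ℕ} {u : ℕ → ℝ} {c B d : ℝ} (hd : 0 < d)
    (hu : ∀ t ∈ s, |u t| ≤ c) (hB : s.card * c ≤ d * B) : |1 / d * ∑ t ∈ s, u t| ≤ B := by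
  rw [abs_mul, abs_of_pos (one_div_pos.2 hd), one_div, inv_mul_le_iff₀ hd]
  refine (Finset.abs_sum_le_sum_abs _ _).trans ((Finset.sum_le_sum hu).trans ?_)
  rw [Finset.sum_const, nsmul_eq_mul]
  exact hB

/-- The kernel is cut off outside the ball of radius $2\rho$, where $g$ is not controlled. The
cut-off part is $O(b^2)$ by decay, the mean of the rest is handled by the approximate identity, and
its fluctuation by the grid argument. -/
theorem IsLocalDesign.eventually_kernelDensity (hX : IsLocalDesign P X g x ρ)
    (hκ : IsTameKernel κ) (hb : IsBandwidth b) {η : ℝ} (hη : 0 < η) :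
    ∀ᶠ p in probFilter P, ∀ y ∈ Metric.closedBall x ρ,
      |kernelDensity κ p.1 (fun t => X t p.2) (b p.1) y - g y * ∫ u, κ u| ≤ η := by
  have hρ := hX.pos
  set B := Metric.closedBall x (2 * ρ) with hB
  have hBm : MeasurableSet B := Metric.isClosed_closedBall.measurableSet
  obtain ⟨G, hG0, hG⟩ := hX.exists_density_bound
  obtain ⟨L, hL0, hL⟩ := hκ.lipschitz
  obtain ⟨C, hC⟩ := hκ.bounded
  obtain ⟨A, hA0, hA⟩ := hκ.exists_decay
  obtain ⟨Θ, hΘ⟩ := hX.moment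
  have hC0 : 0 ≤ C := (abs_nonneg _).trans (hC 0)
  set I := ∫ u, |κ u| with hI
  have hI0 : 0 ≤ I := integral_nonneg fun _ => abs_nonneg _
  set φ : ℕ → ℝ → ℝ → ℝ := fun n y => B.indicator fun v => κ ((y - v) / b n) with hφ
  have hφm : ∀ n y, Measurable (φ n y) := fun n y =>
    (hκ.continuous.measurable.comp ((measurable_const.sub measurable_id).div_const _)).indicator hBm
  have hφle : ∀ n y v, |φ n y v| ≤ |κ ((y - v) / b n)| := fun n y v => by
    simp only [hφ, Set.indicator]
    split_ifs
    · exact le_rfl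
    · rw [abs_zero]; exact abs_nonneg _
  have hφC : ∀ n y v, |φ n y v| ≤ C := fun n y v => (hφle n y v).trans (hC _)
  have hφlip : ∀ n, 0 < b n → ∀ y z v, |φ n y v - φ n z v| ≤ L * (|y - z| / b n) := by
    intro n hn y z v
    simp only [hφ, Set.indicator]
    split_ifs
    · refine (hL _ _).trans (le_of_eq ?_)
      rw [← sub_div, sub_sub_sub_cancel_right, abs_div, abs_of_pos hn]
    · rw [sub_zero, abs_zero]; positivity
  have hφX : ∀ n y t, Integrable (fun ω => φ n y (X t ω)) P := fun n y t =>
    integrable_of_abs_le ((hφm n y).comp (hX.measurable t)) fun ω => hφC n y _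
  set m : ℕ → ℝ → ℝ := fun n y => ∫ ω', φ n y (X 0 ω') ∂P with hm
  set F : ℕ → ℝ → Ω → ℝ := fun n y ω =>
    1 / (n * b n) * ∑ t ∈ Finset.Icc 1 n, (φ n y (X t ω) - m n y) with hF
  have hmC : ∀ n y, |m n y| ≤ C := fun n y => by
    have := norm_integral_le_of_norm_le_const (μ := P) (f := fun ω => φ n y (X 0 ω)) (C := C)
      (Eventually.of_forall fun ω => hφC n y _)
    simpa using this
  have hFm : ∀ n y, Measurable (F n y) := fun n y =>
    (Finset.measurable_fun_sum _ fun t _ =>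
      ((hφm n y).comp (hX.measurable t)).sub_const _).const_mul _
  have hgrid : ∀ᶠ p in probFilter P, ∀ y ∈ Metric.closedBall x ρ, |F p.1 y p.2| ≤ η / 3 := by
    -- The summand and its mean each vary by at most $L|y-z|/b$, and normalisation supplies the
    -- second factor $1/b$. The second-moment constant comes from $(p+q)^2\le2p^2+2q^2$.
    refine eventually_forall_abs_le_of_lipschitz (Λ := fun _ _ => 2 * L)
      (C := 2 * (G * (C * I) + I ^ 2 * Θ ^ 2)) (C' := 2 * L) hρ hb.tendsto hb.pos hb.tendsto_cube
      ?_ ?_ ?_ ?_ ?_ (by positivity)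
    · filter_upwards [hb.eventually_pos] with n hn y
      obtain ⟨h1, h2, h3, h4⟩ := hn
      refine integrable_of_abs_le ((hFm n y).pow_const 2) (C := (2 * C / b n) ^ 2) fun ω => ?_
      rw [abs_pow]
      refine pow_le_pow_left₀ (abs_nonneg _) (abs_sum_div_le h4 (c := 2 * C) (fun t _ => ?_) ?_) 2
      · exact (abs_sub _ _).trans (by linarith [hφC n y (X t ω), hmC n y])
      · rw [Nat.card_Icc, Nat.add_sub_cancel]; field_simp; rfl
    · filter_upwards [hb.eventually_pos] with n hn y hy
      obtain ⟨h1, h2, h3, h4⟩ := hn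
      have hκi : Integrable fun v => κ ((y - v) / b n) := integrable_kernel_comp hκ.integrable h1 y
      have hφi : Integrable (φ n y) := hκi.indicator hBm
      have key := hΘ (φ n y) (hφm n y) ⟨C, hφC n y⟩ hφi n
      have hV : ∫ ω, φ n y (X 0 ω) ^ 2 ∂P ≤ G * (C * (b n * I)) := by
        have := hX.integral_comp_le hG (φ := fun v => φ n y v ^ 2)
          (ψ := fun v => C * |κ ((y - v) / b n)|) ((hφm n y).pow_const 2) (fun v => sq_nonneg _)
          (fun v hv => by simp only [hφ]; rw [Set.indicator_of_notMem hv]; ring)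
          (fun v => by
            rw [← sq_abs, sq]
            exact mul_le_mul (hφC n y v) (hφle n y v) (abs_nonneg _) hC0)
          (hκi.abs.const_mul C) 0
        rwa [integral_const_mul, integral_kernel_comp (fun u => |κ u|) h1] at this
      have hA1 : ∫ v, |φ n y v| ≤ b n * I := by
        rw [← integral_kernel_comp (fun u => |κ u|) h1 y]
        exact integral_mono hφi.abs hκi.abs fun v => hφle n y v
      have hA0 : 0 ≤ ∫ v, |φ n y v| := integral_nonneg fun _ => abs_nonneg _
      have hsq0 : 0 ≤ ∫ ω, φ n y (X 0 ω) ^ 2 ∂P := integral_nonneg fun _ => sq_nonneg _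
      have e1 : ∀ ω, F n y ω ^ 2
          = (1 / (n * b n)) ^ 2 * (∑ t ∈ Finset.Icc 1 n, (φ n y (X t ω) - m n y)) ^ 2 :=
        fun ω => mul_pow _ _ _
      simp_rw [e1]
      rw [integral_const_mul]
      have hs := Real.sq_sqrt hsq0
      have hw : (∫ v, |φ n y v|) ^ 2 ≤ (b n * I) ^ 2 := pow_le_pow_left₀ hA0 hA1 2
      -- The dependence term is of order $b^2$; for $b\le1$ it is absorbed by the order $b$ of the
      -- variance term.
      have hbb : b n ^ 2 ≤ b n := by nlinarith
      have h5 : (√(∫ ω, φ n y (X 0 ω) ^ 2 ∂P) + (∫ v, |φ n y v|) * Θ) ^ 2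
          ≤ 2 * (G * (C * I) + I ^ 2 * Θ ^ 2) * b n := by
        have h6 := add_sq_le (a := √(∫ ω, φ n y (X 0 ω) ^ 2 ∂P)) (b := (∫ v, |φ n y v|) * Θ)
        rw [hs, mul_pow] at h6
        have h7 : (∫ v, |φ n y v|) ^ 2 * Θ ^ 2 ≤ b n * I ^ 2 * Θ ^ 2 := by
          gcongr
          refine hw.trans ?_
          rw [mul_pow]
          gcongr
        nlinarith
      calc (1 / (n * b n)) ^ 2 * ∫ ω, (∑ t ∈ Finset.Icc 1 n, (φ n y (X t ω) - m n y)) ^ 2 ∂P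
          ≤ (1 / (n * b n)) ^ 2 * (n * (2 * (G * (C * I) + I ^ 2 * Θ ^ 2) * b n)) := by
            gcongr
            exact key.trans (by gcongr)
        _ = 2 * (G * (C * I) + I ^ 2 * Θ ^ 2) / (n * b n) := by field_simp
    · exact Eventually.of_forall fun n => integrable_const _
    · exact Eventually.of_forall fun n => by simp [abs_of_nonneg hL0]
    · filter_upwards [hb.eventually_pos] with n hn ω y hy z hz
      obtain ⟨h1, h2, h3, h4⟩ := hn
      have hmd : |m n y - m n z| ≤ L * (|y - z| / b n) := by
        simp only [hm]
        rw [← integral_sub (hφX n y 0) (hφX n z 0)]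
        have := norm_integral_le_of_norm_le_const (μ := P)
          (f := fun ω => φ n y (X 0 ω) - φ n z (X 0 ω)) (C := L * (|y - z| / b n))
          (Eventually.of_forall fun ω => hφlip n h1 y z _)
        simpa using this
      have e1 : F n y ω - F n z ω = 1 / (n * b n) * ∑ t ∈ Finset.Icc 1 n,
          ((φ n y (X t ω) - φ n z (X t ω)) - (m n y - m n z)) := by
        simp only [hF]
        rw [← mul_sub, ← Finset.sum_sub_distrib]
        congr 1
        exact Finset.sum_congr rfl fun t _ => by ring
      rw [e1]
      refine abs_sum_div_le h4 (c := 2 * (L * (|y - z| / b n))) (fun t _ => ?_) ?_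
      · exact (abs_sub _ _).trans (by linarith [hφlip n h1 y z (X t ω)])
      · rw [Nat.card_Icc, Nat.add_sub_cancel]
        apply le_of_eq
        field_simp
  have hmean := eventually_abs_integral_kernel_sub_le hκ hb (Ψ := B.indicator g)
    (hX.density.measurable.indicator hBm) (exists_bound_indicator hX.continuousOn).choose_spec.2
    (uniformlyContinuousNear_indicator (R' := ρ) (by linarith) hX.continuousOn)
    (show 0 < η / 3 by positivity)
  have hfar : ∀ᶠ n in atTop, A / ρ ^ 3 * b n ^ 2 < η / 3 := by
    have : Tendsto (fun n => A / ρ ^ 3 * b n ^ 2) atTop (𝓝 0) := by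
      simpa using (hb.tendsto.pow 2).const_mul (A / ρ ^ 3)
    exact this.eventually (gt_mem_nhds (by positivity))
  filter_upwards [hgrid, tendsto_fst_probFilter.eventually hmean,
    tendsto_fst_probFilter.eventually hfar, tendsto_fst_probFilter.eventually hb.eventually_pos]
    with ⟨n, ω⟩ h1 h2 h3 h4 y hy
  obtain ⟨hb0, hb1, hn0, hnb⟩ := h4
  have hyB : y ∈ B := Metric.closedBall_subset_closedBall (by linarith) hy
  have h1' := h1 y hy
  have h2' := h2 y hy
  rw [Set.indicator_of_mem hyB] at h2'
  have e2 : ∫ v, κ ((y - v) / b n) * B.indicator g v = m n y := by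
    simp only [hm]
    rw [hX.integral_comp (hφm n y)]
    refine integral_congr_ae (Eventually.of_forall fun v => ?_)
    simp only [hφ, Set.indicator]
    split_ifs <;> simp
  simp only at h2' h3 hb0 hn0 hnb
  rw [e2] at h2'
  have h5 : |1 / (n * b n) * ∑ t ∈ Finset.Icc 1 n,
      (κ ((y - X t ω) / b n) - φ n y (X t ω))| ≤ A / ρ ^ 3 * b n ^ 2 := by
    refine abs_sum_div_le hnb (c := A / ρ ^ 3 * b n ^ 3) (fun t _ => ?_) ?_
    · simp only [hφ]
      by_cases hv : X t ω ∈ B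
      · rw [Set.indicator_of_mem hv, sub_self, abs_zero]; positivity
      · rw [Set.indicator_of_notMem hv, sub_zero]
        exact hA ρ hρ _ hb0 _ (far_of_mem hy hv)
    · rw [Nat.card_Icc, Nat.add_sub_cancel]
      apply le_of_eq
      ring
  have e3 : kernelDensity κ n (fun t => X t ω) (b n) y - g y * ∫ u, κ u
      = F n y ω + (1 / b n * m n y - g y * ∫ u, κ u)
        + 1 / (n * b n) * ∑ t ∈ Finset.Icc 1 n, (κ ((y - X t ω) / b n) - φ n y (X t ω)) := by
    simp only [kernelDensity, hF]
    rw [Finset.sum_sub_distrib, Finset.sum_sub_distrib, Finset.sum_const, Nat.card_Icc,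
      Nat.add_sub_cancel, nsmul_eq_mul]
    field_simp
    ring
  simp only
  rw [e3]
  have t1 := abs_add_three (F n y ω) (1 / b n * m n y - g y * ∫ u, κ u)
    (1 / (n * b n) * ∑ t ∈ Finset.Icc 1 n, (κ ((y - X t ω) / b n) - φ n y (X t ω)))
  simp only at h1'
  linarith

theorem IsLocalDesign.exists_kernelDensity_abs_le (hX : IsLocalDesign P X g x ρ)
    (hκ : IsTameKernel κ) (hb : IsBandwidth b) :
    ∃ D : ℝ, 0 < D ∧ ∀ᶠ p in probFilter P, ∀ y ∈ Metric.closedBall x ρ,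
      1 / (p.1 * b p.1) * ∑ t ∈ Finset.Icc 1 p.1, |κ ((y - X t p.2) / b p.1)| ≤ D := by
  obtain ⟨G, hG0, hG⟩ := hX.exists_density_bound
  have hI0 : 0 ≤ ∫ u, |κ u| := integral_nonneg fun _ => abs_nonneg _
  refine ⟨G * (∫ u, |κ u|) + 1, by positivity, ?_⟩
  filter_upwards [hX.eventually_kernelDensity hκ.abs hb one_pos] with p hp y hy
  have h1 := (abs_le.1 (hp y hy)).2
  have h2 : g y * ∫ u, |κ u| ≤ G * ∫ u, |κ u| := mul_le_mul_of_nonneg_right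
    (hG y (Metric.closedBall_subset_closedBall (by linarith [hX.pos]) hy)) hI0
  simp only [kernelDensity] at h1
  linarith

/-- Local averages of the oscillation of a function. -/
theorem IsLocalDesign.eventually_oscillation_le (hX : IsLocalDesign P X g x ρ)
    (hκ : IsTameKernel κ) (hb : IsBandwidth b) {Ψ : ℝ → ℝ} {S : Set ℝ} {M : ℝ}
    (hM : ∀ v, |Ψ v| ≤ M) (hS : UniformlyContinuousNear Ψ S) (hSB : S ⊆ Metric.closedBall x ρ)
    {η : ℝ} (hη : 0 < η) :
    ∀ᶠ p in probFilter P, ∀ y ∈ S, 1 / (p.1 * b p.1) * ∑ t ∈ Finset.Icc 1 p.1,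
      |κ ((y - X t p.2) / b p.1)| * |Ψ (X t p.2) - Ψ y| ≤ η := by
  have hM0 : 0 ≤ M := (abs_nonneg _).trans (hM 0)
  obtain ⟨D, hD0, hD⟩ := hX.exists_kernelDensity_abs_le hκ hb
  obtain ⟨A, hA0, hA⟩ := hκ.exists_decay
  obtain ⟨δ, hδ, hnear⟩ := hS (η / (2 * D)) (by positivity)
  have hfar : ∀ᶠ n in atTop, 2 * M * (A / δ ^ 3) * b n ^ 2 < η / 2 := by
    have : Tendsto (fun n => 2 * M * (A / δ ^ 3) * b n ^ 2) atTop (𝓝 0) := by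
      simpa using (hb.tendsto.pow 2).const_mul (2 * M * (A / δ ^ 3))
    exact this.eventually (gt_mem_nhds (by positivity))
  filter_upwards [hD, tendsto_fst_probFilter.eventually hfar,
    tendsto_fst_probFilter.eventually hb.eventually_pos] with ⟨n, ω⟩ h1 h2 h3 y hy
  obtain ⟨hb0, hb1, hn0, hnb⟩ := h3
  simp only at hb0 hb1 hn0 hnb h2 ⊢
  have h4 : ∀ t, |κ ((y - X t ω) / b n)| * |Ψ (X t ω) - Ψ y|
      ≤ η / (2 * D) * |κ ((y - X t ω) / b n)| + 2 * M * (A / δ ^ 3 * b n ^ 3) := by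
    intro t
    by_cases hv : |y - X t ω| ≤ δ
    · have := mul_le_mul_of_nonneg_right (hnear y hy _ hv) (abs_nonneg (κ ((y - X t ω) / b n)))
      have h6 : 0 ≤ 2 * M * (A / δ ^ 3 * b n ^ 3) := by positivity
      linarith
    · have h5 := hA δ hδ _ hb0 _ (not_le.1 hv).le
      have h6 : |Ψ (X t ω) - Ψ y| ≤ 2 * M :=
        (abs_sub _ _).trans (by linarith [hM (X t ω), hM y])
      have h7 : 0 ≤ η / (2 * D) * |κ ((y - X t ω) / b n)| := by positivity
      have h8 := mul_le_mul h5 h6 (abs_nonneg _) ((abs_nonneg _).trans h5)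
      linarith
  have h9 := h1 y (hSB hy)
  simp only at h9
  calc 1 / (n * b n) * ∑ t ∈ Finset.Icc 1 n, |κ ((y - X t ω) / b n)| * |Ψ (X t ω) - Ψ y|
      ≤ 1 / (n * b n) * ∑ t ∈ Finset.Icc 1 n, (η / (2 * D) * |κ ((y - X t ω) / b n)|
          + 2 * M * (A / δ ^ 3 * b n ^ 3)) := by
        gcongr with t
        exact h4 t
    _ = η / (2 * D) * (1 / (n * b n) * ∑ t ∈ Finset.Icc 1 n, |κ ((y - X t ω) / b n)|)
          + 2 * M * (A / δ ^ 3) * b n ^ 2 := by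
        rw [Finset.sum_add_distrib, ← Finset.mul_sum, Finset.sum_const, Nat.card_Icc,
          Nat.add_sub_cancel, nsmul_eq_mul]
        field_simp
    _ ≤ η / (2 * D) * D + η / 2 := by gcongr
    _ = η := by field_simp; ring

end Design

/-! ### Local averages of the errors -/

section LocalNoise

variable {Ω E : Type*} [MeasurableSpace Ω] [MeasurableSpace E] {P : Measure Ω}
  [IsProbabilityMeasure P] {ε : ℤ → Ω → E} {h : (ℕ → E) → ℝ} {e : ℕ → ℕ → Ω → ℝ}
  {g : ℝ → ℝ} {x ρ : ℝ} {κ Ψ : ℝ → ℝ} {b : ℕ → ℝ} {M : ℝ}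

theorem measurable_comp_regressor (hh : Measurable h) {φ : ℝ → ℝ} (hφ : Measurable φ) (t : ℤ) :
    Measurable[innovationField ε t] fun ω => φ (regressor h ε t ω) :=
  (hφ.comp hh).comp (comap_measurable (past ε t))

/-- The local average of `Ψ (X_t) ζ (e_t)` around `y`. -/
def localAverage (κ Ψ ζ : ℝ → ℝ) (n : ℕ) (c y : ℝ) (X e : ℕ → ℝ) : ℝ :=
  1 / (n * c) * ∑ t ∈ Finset.Icc 1 n, κ ((y - X t) / c) * Ψ (X t) * ζ (e t)

/-- Orthogonality removes the cross terms, and each squared weight has mean $O(c)$ since $\Psi$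
lives where $g$ is bounded. The constant is uniform in $\zeta$, so that $\zeta$ may be truncated at
a level depending on $n$. -/
theorem IsLocalDesign.integral_localAverage_sq_le
    (hX : IsLocalDesign P (fun t : ℕ => regressor h ε (t : ℤ)) g x ρ)
    (he : IsErrorArray P ε e) (hε : ∀ i, Measurable (ε i)) (hh : Measurable h)
    (hκ : IsTameKernel κ) (hΨ : Measurable Ψ) (hM : ∀ v, |Ψ v| ≤ M)
    (hsupp : ∀ v ∉ Metric.closedBall x (2 * ρ), Ψ v = 0) :
    ∃ D : ℝ, 0 ≤ D ∧ ∀ ζ : ℝ → ℝ, Measurable ζ → MemLp (fun ω => ζ (e 1 1 ω)) 2 P →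
      ∫ ω, ζ (e 1 1 ω) ∂P = 0 → ∀ (n : ℕ) (c y : ℝ), 0 < (n : ℝ) → 0 < c →
      Integrable (fun ω => localAverage κ Ψ ζ n c y (fun t => regressor h ε t ω)
        (fun t => e n t ω) ^ 2) P ∧
      ∫ ω, localAverage κ Ψ ζ n c y (fun t => regressor h ε t ω) (fun t => e n t ω) ^ 2 ∂P
        ≤ D * (∫ ω, ζ (e 1 1 ω) ^ 2 ∂P) / (n * c) := by
  obtain ⟨G, hG0, hG⟩ := hX.exists_density_bound
  obtain ⟨C, hC⟩ := hκ.bounded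
  have hC0 : 0 ≤ C := (abs_nonneg _).trans (hC 0)
  have hM0 : 0 ≤ M := (abs_nonneg _).trans (hM 0)
  have hI0 : 0 ≤ ∫ u, |κ u| := integral_nonneg fun _ => abs_nonneg _
  refine ⟨G * (M ^ 2 * C * ∫ u, |κ u|), by positivity, fun ζ hζ hζ2 hζ0 n c y hn hc => ?_⟩
  have hφ : Measurable fun v => κ ((y - v) / c) * Ψ v :=
    (hκ.continuous.measurable.comp ((measurable_const.sub measurable_id).div_const _)).mul hΨ
  have hφb : ∀ v, |κ ((y - v) / c) * Ψ v| ≤ C * M := fun v => by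
    rw [abs_mul]
    exact mul_le_mul (hC _) (hM _) (abs_nonneg _) hC0
  obtain ⟨i1, i2⟩ := he.integral_sum_sq hε
    (a := fun t ω => κ ((y - regressor h ε t ω) / c) * Ψ (regressor h ε t ω))
    (fun t => measurable_comp_regressor hh hφ t) (fun t ω => hφb _) hζ hζ2 hζ0 n
  have e1 : ∀ ω, localAverage κ Ψ ζ n c y (fun t => regressor h ε t ω) (fun t => e n t ω) ^ 2
      = (1 / (n * c)) ^ 2 * (∑ t ∈ Finset.Icc 1 n, κ ((y - regressor h ε t ω) / c)
        * Ψ (regressor h ε t ω) * ζ (e n t ω)) ^ 2 := fun ω => mul_pow _ _ _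
  simp_rw [e1]
  refine ⟨i1.const_mul _, ?_⟩
  rw [integral_const_mul, i2]
  have h1 : ∀ t : ℕ, ∫ ω, (κ ((y - regressor h ε t ω) / c) * Ψ (regressor h ε t ω)) ^ 2 ∂P
      ≤ G * (M ^ 2 * C * ∫ u, |κ u|) * c := by
    intro t
    have := hX.integral_comp_le hG (φ := fun v => (κ ((y - v) / c) * Ψ v) ^ 2)
      (ψ := fun v => M ^ 2 * C * |κ ((y - v) / c)|) (hφ.pow_const 2) (fun v => sq_nonneg _)
      (fun v hv => by rw [hsupp v hv]; ring)
      (fun v => by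
        have h2 : κ ((y - v) / c) ^ 2 ≤ C * |κ ((y - v) / c)| := by
          rw [← sq_abs, sq]
          exact mul_le_mul_of_nonneg_right (hC _) (abs_nonneg _)
        have h3 : Ψ v ^ 2 ≤ M ^ 2 := sq_le_sq' (abs_le.1 (hM v)).1 (abs_le.1 (hM v)).2
        rw [mul_pow]
        have := mul_le_mul h2 h3 (sq_nonneg _) (by positivity)
        linarith)
      ((integrable_kernel_comp hκ.integrable hc y).abs.const_mul _) t
    rw [integral_const_mul, integral_kernel_comp (fun u => |κ u|) hc] at this
    linarith
  have h2 : ∑ t ∈ Finset.Icc 1 n,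
      ∫ ω, (κ ((y - regressor h ε t ω) / c) * Ψ (regressor h ε t ω)) ^ 2 ∂P
      ≤ n * (G * (M ^ 2 * C * ∫ u, |κ u|) * c) := by
    refine (Finset.sum_le_sum fun t _ => h1 t).trans ?_
    rw [Finset.sum_const, Nat.card_Icc, Nat.add_sub_cancel, nsmul_eq_mul]
  have h3 : 0 ≤ ∫ ω, ζ (e 1 1 ω) ^ 2 ∂P := integral_nonneg fun _ => sq_nonneg _
  calc (1 / (n * c)) ^ 2 * ((∑ t ∈ Finset.Icc 1 n,
        ∫ ω, (κ ((y - regressor h ε t ω) / c) * Ψ (regressor h ε t ω)) ^ 2 ∂P)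
        * ∫ ω, ζ (e 1 1 ω) ^ 2 ∂P)
      ≤ (1 / (n * c)) ^ 2 * (n * (G * (M ^ 2 * C * ∫ u, |κ u|) * c)
        * ∫ ω, ζ (e 1 1 ω) ^ 2 ∂P) := by gcongr
    _ = _ := by field_simp

/-- The $L^1$ counterpart, by the triangle inequality: it gives no decay in $n$, but needs only a
first moment of $\zeta(e)$ and no centring, as suits the tail left by truncation. -/
theorem IsLocalDesign.integral_abs_localAverage_le
    (hX : IsLocalDesign P (fun t : ℕ => regressor h ε (t : ℤ)) g x ρ)
    (he : IsErrorArray P ε e) (hh : Measurable h)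
    (hκ : IsTameKernel κ) (hΨ : Measurable Ψ) (hM : ∀ v, |Ψ v| ≤ M)
    (hsupp : ∀ v ∉ Metric.closedBall x (2 * ρ), Ψ v = 0) :
    ∃ D : ℝ, 0 ≤ D ∧ ∀ ζ : ℝ → ℝ, Measurable ζ → Integrable (fun ω => ζ (e 1 1 ω)) P →
      ∀ (n : ℕ) (c y : ℝ), 0 < (n : ℝ) → 0 < c →
      Integrable (fun ω => localAverage κ Ψ ζ n c y (fun t => regressor h ε t ω)
        (fun t => e n t ω)) P ∧
      ∫ ω, |localAverage κ Ψ ζ n c y (fun t => regressor h ε t ω) (fun t => e n t ω)| ∂P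
        ≤ D * ∫ ω, |ζ (e 1 1 ω)| ∂P := by
  obtain ⟨G, hG0, hG⟩ := hX.exists_density_bound
  obtain ⟨C, hC⟩ := hκ.bounded
  have hC0 : 0 ≤ C := (abs_nonneg _).trans (hC 0)
  have hM0 : 0 ≤ M := (abs_nonneg _).trans (hM 0)
  have hI0 : 0 ≤ ∫ u, |κ u| := integral_nonneg fun _ => abs_nonneg _
  refine ⟨G * (M * ∫ u, |κ u|), by positivity, fun ζ hζ hζi n c y hn hc => ?_⟩
  have hφ : Measurable fun v => κ ((y - v) / c) * Ψ v :=
    (hκ.continuous.measurable.comp ((measurable_const.sub measurable_id).div_const _)).mul hΨ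
  have hφb : ∀ v, |κ ((y - v) / c) * Ψ v| ≤ C * M := fun v => by
    rw [abs_mul]
    exact mul_le_mul (hC _) (hM _) (abs_nonneg _) hC0
  have hXi : ∀ t : ℕ, Integrable (fun ω => κ ((y - regressor h ε t ω) / c)
      * Ψ (regressor h ε t ω)) P := fun t =>
    integrable_of_abs_le (hφ.comp (hX.measurable t)) fun ω => hφb _
  have hterm : ∀ t ∈ Finset.Icc 1 n, Integrable (fun ω => κ ((y - regressor h ε t ω) / c)
      * Ψ (regressor h ε t ω) * ζ (e n t ω)) P := fun t ht =>
    he.integrable_mul_comp ht (measurable_comp_regressor hh hφ t) (hXi t) hζ hζi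
  refine ⟨(integrable_finsetSum _ hterm).const_mul _, ?_⟩
  have hle : ∀ t ∈ Finset.Icc 1 n, ∫ ω, |κ ((y - regressor h ε t ω) / c)
      * Ψ (regressor h ε t ω) * ζ (e n t ω)| ∂P
      ≤ G * (M * ∫ u, |κ u|) * c * ∫ ω, |ζ (e 1 1 ω)| ∂P := by
    intro t ht
    simp_rw [abs_mul _ (ζ _)]
    rw [he.integral_mul_comp ht (ζ := fun y => |ζ y|)
      (u := fun ω => |κ ((y - regressor h ε t ω) / c) * Ψ (regressor h ε t ω)|)
      (measurable_comp_regressor hh hφ.abs t) (hXi t).abs hζ.abs hζi.abs]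
    refine mul_le_mul_of_nonneg_right ?_ (integral_nonneg fun _ => abs_nonneg _)
    have := hX.integral_comp_le hG (φ := fun v => |κ ((y - v) / c) * Ψ v|)
      (ψ := fun v => M * |κ ((y - v) / c)|) hφ.abs (fun v => abs_nonneg _)
      (fun v hv => by rw [hsupp v hv, mul_zero, abs_zero])
      (fun v => by
        rw [abs_mul, mul_comm]
        exact mul_le_mul_of_nonneg_right (hM v) (abs_nonneg _))
      ((integrable_kernel_comp hκ.integrable hc y).abs.const_mul _) t
    rw [integral_const_mul, integral_kernel_comp (fun u => |κ u|) hc] at this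
    linarith
  have hnc : 0 < (n : ℝ) * c := mul_pos hn hc
  calc ∫ ω, |localAverage κ Ψ ζ n c y (fun t => regressor h ε t ω) (fun t => e n t ω)| ∂P
      ≤ ∫ ω, 1 / (n * c) * ∑ t ∈ Finset.Icc 1 n, |κ ((y - regressor h ε t ω) / c)
        * Ψ (regressor h ε t ω) * ζ (e n t ω)| ∂P := by
        refine integral_mono ((integrable_finsetSum _ hterm).const_mul _).abs
          ((integrable_finsetSum _ fun t ht => (hterm t ht).abs).const_mul _) fun ω => ?_
        simp only [localAverage]
        rw [abs_mul, abs_of_pos (one_div_pos.2 hnc)]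
        gcongr
        exact Finset.abs_sum_le_sum_abs _ _
    _ ≤ 1 / (n * c) * (n * (G * (M * ∫ u, |κ u|) * c * ∫ ω, |ζ (e 1 1 ω)| ∂P)) := by
        rw [integral_const_mul, integral_finsetSum _ fun t ht => (hterm t ht).abs]
        gcongr
        refine (Finset.sum_le_sum hle).trans ?_
        rw [Finset.sum_const, Nat.card_Icc, Nat.add_sub_cancel, nsmul_eq_mul]
    _ = _ := by field_simp

theorem IsErrorArray.integrable_one (he : IsErrorArray P ε e) : Integrable (e 1 1) P :=
  (he.memLp 1 1 one_mem_Icc_one).integrable (by norm_num)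

/-- Local averages of the errors vanish uniformly. -/
theorem IsLocalDesign.eventually_localAverage_error_le
    (hX : IsLocalDesign P (fun t : ℕ => regressor h ε (t : ℤ)) g x ρ)
    (he : IsErrorArray P ε e) (hε : ∀ i, Measurable (ε i)) (hh : Measurable h)
    (hκ : IsTameKernel κ) (hb : IsBandwidth b) (hΨ : Measurable Ψ) (hM : ∀ v, |Ψ v| ≤ M)
    (hsupp : ∀ v ∉ Metric.closedBall x (2 * ρ), Ψ v = 0) {η : ℝ} (hη : 0 < η) :
    ∀ᶠ p in probFilter P, ∀ y ∈ Metric.closedBall x ρ,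
      |localAverage κ Ψ id p.1 (b p.1) y (fun t => regressor h ε t p.2) (fun t => e p.1 t p.2)|
        ≤ η := by
  obtain ⟨D, hD0, hD⟩ := hX.integral_localAverage_sq_le he hε hh hκ hΨ hM hsupp
  obtain ⟨L, hL0, hL⟩ := hκ.lipschitz
  have hM0 : 0 ≤ M := (abs_nonneg _).trans (hM 0)
  have h11 := he.memLp 1 1 one_mem_Icc_one
  have habs : ∀ n, ∀ t ∈ Finset.Icc 1 n, Integrable (fun ω => |e n t ω|) P := fun n t ht =>
    ((he.identDistrib_comp ht measurable_id).integrable_iff.2 he.integrable_one).abs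
  -- The Lipschitz constant is random, since the errors are unbounded, but its mean is bounded by a
  -- multiple of $\mathbb E|e|$.
  refine eventually_forall_abs_le_of_lipschitz (F := fun n y ω => localAverage κ Ψ id n (b n) y
      (fun t => regressor h ε t ω) (fun t => e n t ω))
    (Λ := fun n ω => L * M * (1 / n * ∑ t ∈ Finset.Icc 1 n, |e n t ω|))
    (C := D * ∫ ω, e 1 1 ω ^ 2 ∂P) (C' := L * M * ∫ ω, |e 1 1 ω| ∂P)
    hX.pos hb.tendsto hb.pos hb.tendsto_cube ?_ ?_ ?_ ?_ ?_ hη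
  · filter_upwards [hb.eventually_pos] with n hn y
    exact (hD id measurable_id h11 (he.mean_zero 1 1 one_mem_Icc_one) n (b n) y hn.2.2.1 hn.1).1
  · filter_upwards [hb.eventually_pos] with n hn y _
    exact (hD id measurable_id h11 (he.mean_zero 1 1 one_mem_Icc_one) n (b n) y hn.2.2.1 hn.1).2
  · exact Eventually.of_forall fun n =>
      ((integrable_finsetSum _ fun t ht => habs n t ht).const_mul _).const_mul _
  · filter_upwards [hb.eventually_pos] with n hn
    have h0 : ∀ ω, |L * M * (1 / n * ∑ t ∈ Finset.Icc 1 n, |e n t ω|)|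
        = L * M * (1 / n * ∑ t ∈ Finset.Icc 1 n, |e n t ω|) := fun ω => abs_of_nonneg (by positivity)
    simp_rw [h0]
    rw [integral_const_mul, integral_const_mul, integral_finsetSum _ fun t ht => habs n t ht]
    refine le_of_eq ?_
    have h1 : ∀ t ∈ Finset.Icc 1 n, ∫ ω, |e n t ω| ∂P = ∫ ω, |e 1 1 ω| ∂P := fun t ht =>
      (he.identDistrib_comp ht (ζ := fun y => |y|) measurable_id.abs).integral_eq
    rw [Finset.sum_congr rfl h1, Finset.sum_const, Nat.card_Icc, Nat.add_sub_cancel, nsmul_eq_mul]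
    have := hn.2.2.1.ne'
    field_simp
  · filter_upwards [hb.eventually_pos] with n hn ω y _ z _
    obtain ⟨h1, h2, h3, h4⟩ := hn
    simp only [localAverage]
    rw [← mul_sub, ← Finset.sum_sub_distrib, abs_mul, abs_of_pos (one_div_pos.2 h4)]
    have h5 : ∀ t : ℕ, |κ ((y - regressor h ε t ω) / b n) * Ψ (regressor h ε t ω) * id (e n t ω)
        - κ ((z - regressor h ε t ω) / b n) * Ψ (regressor h ε t ω) * id (e n t ω)|
        ≤ L * (|y - z| / b n) * M * |e n t ω| := by
      intro t
      rw [← sub_mul, ← sub_mul, abs_mul, abs_mul]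
      have h6 := hL ((y - regressor h ε t ω) / b n) ((z - regressor h ε t ω) / b n)
      rw [← sub_div, sub_sub_sub_cancel_right, abs_div, abs_of_pos h1] at h6
      exact mul_le_mul_of_nonneg_right (mul_le_mul h6 (hM _) (abs_nonneg _) (by positivity))
        (abs_nonneg _)
    calc 1 / (n * b n) * |∑ t ∈ Finset.Icc 1 n,
          (κ ((y - regressor h ε t ω) / b n) * Ψ (regressor h ε t ω) * id (e n t ω)
          - κ ((z - regressor h ε t ω) / b n) * Ψ (regressor h ε t ω) * id (e n t ω))|
        ≤ 1 / (n * b n) * ∑ t ∈ Finset.Icc 1 n, L * (|y - z| / b n) * M * |e n t ω| := by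
          gcongr
          exact (Finset.abs_sum_le_sum_abs _ _).trans (Finset.sum_le_sum fun t _ => h5 t)
      _ = _ := by
          rw [← Finset.mul_sum]
          field_simp

/-- Weak law of large numbers for local averages of the squared errors. -/
theorem IsLocalDesign.tendsto_localAverage_sq_sub_one
    (hX : IsLocalDesign P (fun t : ℕ => regressor h ε (t : ℤ)) g x ρ)
    (he : IsErrorArray P ε e) (hε : ∀ i, Measurable (ε i)) (hh : Measurable h)
    (hκ : IsTameKernel κ) (hb : IsBandwidth b) (hΨ : Measurable Ψ) (hM : ∀ v, |Ψ v| ≤ M)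
    (hsupp : ∀ v ∉ Metric.closedBall x (2 * ρ), Ψ v = 0) :
    Tendsto (fun p : ℕ × Ω => localAverage κ Ψ (fun u => u ^ 2 - 1) p.1 (b p.1) x
      (fun t => regressor h ε t p.2) (fun t => e p.1 t p.2)) (probFilter P) (𝓝 0) := by
  obtain ⟨D, hD0, hD⟩ := hX.integral_localAverage_sq_le he hε hh hκ hΨ hM hsupp
  obtain ⟨D', hD0', hD'⟩ := hX.integral_abs_localAverage_le he hh hκ hΨ hM hsupp
  have hm11 := he.measurable 1 1 one_mem_Icc_one
  have hsq := he.integrable_sq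
  have hnb : Tendsto (fun n : ℕ => n * b n) atTop atTop := by
    refine tendsto_atTop_mono' _ ?_ hb.tendsto_cube
    filter_upwards [hb.eventually_pos] with n hn
    obtain ⟨h1, h2, h3, h4⟩ := hn
    have : b n ^ 3 ≤ b n := by
      calc b n ^ 3 = b n * b n ^ 2 := by ring
        _ ≤ b n * 1 := by
          gcongr
          exact pow_le_one₀ h1.le h2
        _ = b n := mul_one _
    exact mul_le_mul_of_nonneg_left this h3.le
  -- Truncating $e^2$ at $(nb)^{1/4}$ makes its variance at most $(nb)^{1/2}$, so the truncated
  -- average has second moment $O((nb)^{-1/2})$, while the level still tends to infinity.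
  set T : ℕ → Set ℝ := fun n => {u | u ^ 2 ≤ √√(n * b n)} with hT
  have hTm : ∀ n, MeasurableSet (T n) := fun n =>
    measurableSet_le (measurable_id.pow_const 2) measurable_const
  set ζ : ℕ → ℝ → ℝ := fun n => (T n).indicator fun u => u ^ 2 with hζ
  have hζm : ∀ n, Measurable (ζ n) := fun n => (measurable_id.pow_const 2).indicator (hTm n)
  have hζ0 : ∀ n u, 0 ≤ ζ n u := fun n u => Set.indicator_nonneg (fun _ _ => sq_nonneg _) _
  have hζle : ∀ n u, ζ n u ≤ √√(n * b n) := by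
    intro n u
    simp only [hζ, Set.indicator]
    split_ifs with hu
    · exact hu
    · exact Real.sqrt_nonneg _
  have hζsq : ∀ n u, ζ n u ≤ u ^ 2 := fun n u =>
    Set.indicator_le_self' (fun _ _ => sq_nonneg _) _
  have hζi : ∀ n, Integrable (fun ω => ζ n (e 1 1 ω)) P := fun n =>
    integrable_of_abs_le ((hζm n).comp hm11) (C := √√(n * b n)) fun ω => by
      rw [abs_of_nonneg (hζ0 _ _)]; exact hζle _ _
  set c : ℕ → ℝ := fun n => ∫ ω, ζ n (e 1 1 ω) ∂P with hc
  have hc0 : ∀ n, 0 ≤ c n := fun n => integral_nonneg fun _ => hζ0 _ _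
  have hcle : ∀ n, c n ≤ √√(n * b n) := fun n => by
    have := integral_mono (hζi n) (integrable_const (√√(n * b n))) fun ω => hζle n (e 1 1 ω)
    simpa using this
  have hAtop : Tendsto (fun n : ℕ => √√(n * b n)) atTop atTop :=
    Real.tendsto_sqrt_atTop.comp (Real.tendsto_sqrt_atTop.comp hnb)
  have hclim : Tendsto c atTop (𝓝 1) := by
    rw [← he.variance_one 1 1 one_mem_Icc_one]
    refine tendsto_integral_of_dominated_convergence (fun ω => e 1 1 ω ^ 2)
      (fun n => ((hζm n).comp hm11).aestronglyMeasurable) hsq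
      (fun n => Eventually.of_forall fun ω => ?_) (Eventually.of_forall fun ω => ?_)
    · rw [Real.norm_eq_abs, abs_of_nonneg (hζ0 _ _)]
      exact hζsq _ _
    · refine tendsto_const_nhds.congr' ?_
      filter_upwards [hAtop.eventually_ge_atTop (e 1 1 ω ^ 2)] with n hn
      simp only [hζ]
      rw [Set.indicator_of_mem]
      exact hn
  -- the bounded part
  have hpart1 : Tendsto (fun p : ℕ × Ω => localAverage κ Ψ (fun u => ζ p.1 u - c p.1) p.1 (b p.1) x
      (fun t => regressor h ε t p.2) (fun t => e p.1 t p.2)) (probFilter P) (𝓝 0) := by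
    have key : ∀ᶠ n in atTop, Integrable (fun ω => localAverage κ Ψ (fun u => ζ n u - c n) n (b n) x
          (fun t => regressor h ε t ω) (fun t => e n t ω) ^ 2) P ∧
        ∫ ω, localAverage κ Ψ (fun u => ζ n u - c n) n (b n) x
          (fun t => regressor h ε t ω) (fun t => e n t ω) ^ 2 ∂P ≤ D * (1 / √(n * b n)) := by
      filter_upwards [hb.eventually_pos] with n hn
      obtain ⟨h1, h2, h3, h4⟩ := hn
      have hm : Measurable fun u => ζ n u - c n := (hζm n).sub_const _
      have hbd : ∀ ω, |ζ n (e 1 1 ω) - c n| ≤ √√(n * b n) := fun ω => by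
        rw [abs_le]
        constructor <;> linarith [hζ0 n (e 1 1 ω), hζle n (e 1 1 ω), hc0 n, hcle n]
      have hmem : MemLp (fun ω => ζ n (e 1 1 ω) - c n) 2 P :=
        MemLp.of_bound (hm.comp hm11).aestronglyMeasurable _ (Eventually.of_forall hbd)
      have h0 : ∫ ω, (ζ n (e 1 1 ω) - c n) ∂P = 0 := by
        rw [integral_sub (hζi n) (integrable_const _)]
        simp [hc]
      obtain ⟨i1, i2⟩ := hD _ hm hmem h0 n (b n) x h3 h1
      refine ⟨i1, i2.trans ?_⟩
      have hV : ∫ ω, (ζ n (e 1 1 ω) - c n) ^ 2 ∂P ≤ √(n * b n) := by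
        have := integral_mono hmem.integrable_sq (integrable_const (√(n * b n))) fun ω => by
          have := pow_le_pow_left₀ (abs_nonneg _) (hbd ω) 2
          rwa [sq_abs, Real.sq_sqrt (Real.sqrt_nonneg _)] at this
        simpa using this
      have hs : √(n * b n) ^ 2 = n * b n := Real.sq_sqrt h4.le
      have hs0 : 0 < √(n * b n) := Real.sqrt_pos.2 h4
      calc D * (∫ ω, (ζ n (e 1 1 ω) - c n) ^ 2 ∂P) / (n * b n)
          ≤ D * √(n * b n) / (n * b n) := by gcongr
        _ = D * √(n * b n) / √(n * b n) ^ 2 := by rw [hs]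
        _ = D * (1 / √(n * b n)) := by field_simp
    have hlim : Tendsto (fun n : ℕ => D * (1 / √(n * b n))) atTop (𝓝 0) := by
      have : Tendsto (fun n : ℕ => 1 / √(n * b n)) atTop (𝓝 0) :=
        (Real.tendsto_sqrt_atTop.comp hnb).inv_tendsto_atTop.congr fun n => (one_div _).symm
      simpa using this.const_mul D
    have h2 := tendsto_probFilter_of_integral_le (P := P)
      (f := fun n ω => localAverage κ Ψ (fun u => ζ n u - c n) n (b n) x
          (fun t => regressor h ε t ω) (fun t => e n t ω) ^ 2) (key.mono fun n hn => hn.1)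
      (key.mono fun n hn => by simpa only [abs_sq] using hn.2) hlim
    rw [tendsto_zero_iff_abs_tendsto_zero]
    have h3 := (Real.continuous_sqrt.tendsto 0).comp h2
    rw [Real.sqrt_zero] at h3
    exact h3.congr fun p => Real.sqrt_sq_eq_abs _
  -- the tail
  have hpart2 : Tendsto (fun p : ℕ × Ω => localAverage κ Ψ
      (fun u => (u ^ 2 - ζ p.1 u) - (1 - c p.1)) p.1 (b p.1) x
      (fun t => regressor h ε t p.2) (fun t => e p.1 t p.2)) (probFilter P) (𝓝 0) := by
    have key : ∀ᶠ n in atTop, Integrable (fun ω => localAverage κ Ψ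
          (fun u => (u ^ 2 - ζ n u) - (1 - c n)) n (b n) x
          (fun t => regressor h ε t ω) (fun t => e n t ω)) P ∧
        ∫ ω, |localAverage κ Ψ (fun u => (u ^ 2 - ζ n u) - (1 - c n)) n (b n) x
          (fun t => regressor h ε t ω) (fun t => e n t ω)| ∂P ≤ D' * (2 * (1 - c n)) := by
      filter_upwards [hb.eventually_pos] with n hn
      obtain ⟨h1, h2, h3, h4⟩ := hn
      have hm : Measurable fun u => (u ^ 2 - ζ n u) - (1 - c n) :=
        ((measurable_id.pow_const 2).sub (hζm n)).sub_const _
      have hd : Integrable (fun ω => e 1 1 ω ^ 2 - ζ n (e 1 1 ω)) P := hsq.sub (hζi n)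
      have hdi : ∫ ω, (e 1 1 ω ^ 2 - ζ n (e 1 1 ω)) ∂P = 1 - c n := by
        rw [integral_sub hsq (hζi n), he.variance_one 1 1 one_mem_Icc_one]
      have hc1 : 0 ≤ 1 - c n := by
        rw [← hdi]
        exact integral_nonneg fun ω => sub_nonneg.2 (hζsq _ _)
      obtain ⟨i1, i2⟩ := hD' _ hm (hd.sub (integrable_const _)) n (b n) x h3 h1
      refine ⟨i1, i2.trans ?_⟩
      gcongr
      calc ∫ ω, |e 1 1 ω ^ 2 - ζ n (e 1 1 ω) - (1 - c n)| ∂P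
          ≤ ∫ ω, ((e 1 1 ω ^ 2 - ζ n (e 1 1 ω)) + (1 - c n)) ∂P := by
            refine integral_mono (hd.sub (integrable_const _)).abs
              (hd.add (integrable_const _)) fun ω => ?_
            refine (abs_sub _ _).trans (le_of_eq ?_)
            rw [abs_of_nonneg (sub_nonneg.2 (hζsq _ _)), abs_of_nonneg hc1]
        _ = 2 * (1 - c n) := by
            rw [integral_add hd (integrable_const _), hdi]
            simp
            ring
    have hlim : Tendsto (fun n : ℕ => D' * (2 * (1 - c n))) atTop (𝓝 0) := by
      simpa using ((hclim.const_sub 1).const_mul 2).const_mul D'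
    exact tendsto_probFilter_of_integral_le (P := P)
      (f := fun n ω => localAverage κ Ψ (fun u => (u ^ 2 - ζ n u) - (1 - c n)) n (b n) x
          (fun t => regressor h ε t ω) (fun t => e n t ω)) (key.mono fun n hn => hn.1)
      (key.mono fun n hn => hn.2) hlim
  have := hpart1.add hpart2
  rw [add_zero] at this
  refine this.congr fun p => ?_
  simp only [localAverage]
  rw [← mul_add, ← Finset.sum_add_distrib]
  congr 1
  exact Finset.sum_congr rfl fun t _ => by ring

theorem IsLocalDesign.tendsto_kernelDensity {X : ℕ → Ω → ℝ} (hX : IsLocalDesign P X g x ρ)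
    (hκ : IsTameKernel κ) (hb : IsBandwidth b) :
    Tendsto (fun p : ℕ × Ω => kernelDensity κ p.1 (fun t => X t p.2) (b p.1) x)
      (probFilter P) (𝓝 (g x * ∫ u, κ u)) := by
  rw [Metric.tendsto_nhds]
  intro η hη
  filter_upwards [hX.eventually_kernelDensity hκ hb (half_pos hη)] with p hp
  rw [Real.dist_eq]
  exact (hp x (Metric.mem_closedBall_self hX.pos.le)).trans_lt (half_lt_self hη)

/-- Local averages of the weighted squared errors at `x`. -/
theorem IsLocalDesign.tendsto_localAverage_sq
    (hX : IsLocalDesign P (fun t : ℕ => regressor h ε (t : ℤ)) g x ρ)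
    (he : IsErrorArray P ε e) (hε : ∀ i, Measurable (ε i)) (hh : Measurable h)
    (hκ : IsTameKernel κ) (hb : IsBandwidth b) (hΨ : Measurable Ψ) (hM : ∀ v, |Ψ v| ≤ M)
    (hsupp : ∀ v ∉ Metric.closedBall x (2 * ρ), Ψ v = 0) (hnear : UniformlyContinuousNear Ψ {x}) :
    Tendsto (fun p : ℕ × Ω => localAverage κ Ψ (fun u => u ^ 2) p.1 (b p.1) x
      (fun t => regressor h ε t p.2) (fun t => e p.1 t p.2)) (probFilter P)
      (𝓝 (Ψ x * (g x * ∫ u, κ u))) := by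
  have h1 := hX.tendsto_localAverage_sq_sub_one he hε hh hκ hb hΨ hM hsupp
  have h2 := (hX.tendsto_kernelDensity hκ hb).const_mul (Ψ x)
  have h3 : Tendsto (fun p : ℕ × Ω => 1 / (p.1 * b p.1) * ∑ t ∈ Finset.Icc 1 p.1,
      κ ((x - regressor h ε t p.2) / b p.1) * (Ψ (regressor h ε t p.2) - Ψ x))
      (probFilter P) (𝓝 0) := by
    rw [Metric.tendsto_nhds]
    intro η hη
    filter_upwards [hX.eventually_oscillation_le hκ hb hM hnear
      (Set.singleton_subset_iff.2 (Metric.mem_closedBall_self hX.pos.le)) (half_pos hη),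
      tendsto_fst_probFilter.eventually hb.eventually_pos] with p hp hn
    rw [Real.dist_eq, sub_zero, abs_mul, abs_of_pos (one_div_pos.2 hn.2.2.2)]
    refine lt_of_le_of_lt ?_ (half_lt_self hη)
    refine le_trans ?_ (hp x rfl)
    have := one_div_pos.2 hn.2.2.2
    gcongr
    refine (Finset.abs_sum_le_sum_abs _ _).trans (le_of_eq ?_)
    simp_rw [abs_mul]
  have := (h1.add h3).add h2
  rw [zero_add, zero_add] at this
  refine this.congr fun p => ?_
  simp only [localAverage, kernelDensity]
  rw [mul_left_comm (Ψ x), ← mul_add, ← mul_add, Finset.mul_sum, ← Finset.sum_add_distrib,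
    ← Finset.sum_add_distrib]
  congr 1
  exact Finset.sum_congr rfl fun t _ => by ring

end LocalNoise

/-! ### Uniform consistency of the mean estimator -/

section MeanEstimator

variable {Ω E : Type*} [MeasurableSpace Ω] [MeasurableSpace E] {P : Measure Ω}
  [IsProbabilityMeasure P] {ε : ℤ → Ω → E} {h : (ℕ → E) → ℝ} {e Q : ℕ → ℕ → Ω → ℝ}
  {g μ σ : ℝ → ℝ} {x ρ : ℝ} {K : ℝ → ℝ} {b a : ℕ → ℝ}

theorem meanEstimator_sub (K : ℝ → ℝ) {n : ℕ} (X Z : ℕ → ℝ) {c y : ℝ} (m : ℝ)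
    (hnc : (n : ℝ) * c ≠ 0) (hd : kernelDensity K n X c y ≠ 0) :
    meanEstimator K n X Z c y - m
      = (1 / (n * c) * ∑ t ∈ Finset.Icc 1 n, K ((y - X t) / c) * (Z t - m))
        / kernelDensity K n X c y := by
  have h1 : ∑ t ∈ Finset.Icc 1 n, K ((y - X t) / c) = n * c * kernelDensity K n X c y := by
    rw [kernelDensity, ← mul_assoc, mul_one_div_cancel hnc, one_mul]
  simp_rw [mul_sub]
  rw [Finset.sum_sub_distrib, ← Finset.sum_mul, h1, meanEstimator, eq_div_iff hd, sub_mul,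
    mul_sub]
  congr 1
  · rw [one_div, mul_inv, one_div]
    field_simp
  · rw [one_div, ← mul_assoc, ← mul_assoc, inv_mul_cancel₀ hnc, one_mul, mul_comm]

/-- The error times $\hat g(y)\ge c/2$ splits into the oscillation of $\mu$, a local average of
errors, and distant points. The sequence `a` abstracts the kernel's decay, so that both types of
kernel are treated together. -/
theorem IsLocalDesign.eventually_meanEstimator
    (hX : IsLocalDesign P (fun t : ℕ => regressor h ε (t : ℤ)) g x ρ)
    (he : IsErrorArray P ε e) (hε : ∀ i, Measurable (ε i)) (hh : Measurable h)
    (hK : IsTameKernel K) (hK1 : ∫ u, K u = 1) (hb : IsBandwidth b)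
    {c : ℝ} (hc : 0 < c) (hgc : ∀ v ∈ Metric.closedBall x ρ, c ≤ g v)
    (hσm : Measurable σ)
    (hμ : ContinuousOn μ (Metric.closedBall x (2 * ρ)))
    (hσ : ContinuousOn σ (Metric.closedBall x (2 * ρ)))
    (hmodel : ∀ n, ∀ t ∈ Finset.Icc 1 n, ∀ᵐ ω ∂P,
      Q n t ω = μ (regressor h ε t ω) + σ (regressor h ε t ω) * e n t ω)
    (ha : ∀ᶠ n in atTop, ∀ z, ρ ≤ |z| → |K (z / b n)| ≤ a n * b n)
    (haQ : Tendsto (fun p : ℕ × Ω => a p.1 * (1 / p.1 * ∑ t ∈ Finset.Icc 1 p.1,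
      (1 + Q p.1 t p.2 ^ 2))) (probFilter P) (𝓝 0)) {η : ℝ} (hη : 0 < η) :
    ∀ᶠ p in probFilter P, ∀ y ∈ Metric.closedBall x ρ,
      |meanEstimator K p.1 (fun t => regressor h ε t p.2) (fun t => Q p.1 t p.2) (b p.1) y - μ y|
        ≤ η := by
  have hρ := hX.pos
  set B := Metric.closedBall x (2 * ρ) with hB
  have hBm : MeasurableSet B := Metric.isClosed_closedBall.measurableSet
  obtain ⟨M, hM0, hM⟩ := exists_bound_indicator hμ
  obtain ⟨M', hM0', hM'⟩ := exists_bound_indicator hσ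
  have hosc := hX.eventually_oscillation_le hK hb hM
    (uniformlyContinuousNear_indicator (R' := ρ) (by linarith) hμ) subset_rfl
    (show 0 < η * (c / 2) / 3 by positivity)
  have hnoise := hX.eventually_localAverage_error_le he hε hh hK hb (hσm.indicator hBm) hM'
    (fun v hv => Set.indicator_of_notMem hv _) (show 0 < η * (c / 2) / 3 by positivity)
  have hfar := haQ.eventually (gt_mem_nhds (show 0 < η * (c / 2) / 3 by positivity))
  have hdens := hX.eventually_kernelDensity hK hb (show 0 < c / 2 by positivity)
  have hmod : ∀ᶠ p in probFilter P, ∀ t ∈ Finset.Icc 1 p.1,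
      Q p.1 t p.2 = μ (regressor h ε t p.2) + σ (regressor h ε t p.2) * e p.1 t p.2 :=
    eventually_probFilter_of_ae fun n => (ae_ball_iff (Finset.countable_toSet _)).2 (hmodel n)
  filter_upwards [hosc, hnoise, hfar, hdens, hmod, tendsto_fst_probFilter.eventually ha,
    tendsto_fst_probFilter.eventually hb.eventually_pos]
    with ⟨n, ω⟩ h1 h2 h3 h4 h5 h6 h7 y hy
  obtain ⟨hb0, hb1, hn0, hnb⟩ := h7
  simp only at hb0 hb1 hn0 hnb h3 h5 h6 ⊢
  have hyB : y ∈ B := Metric.closedBall_subset_closedBall (by linarith) hy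
  have h1' := h1 y hy
  have h2' := h2 y hy
  have h4' := h4 y hy
  simp only at h1' h2' h4'
  rw [Set.indicator_of_mem hyB] at h1'
  rw [hK1, mul_one] at h4'
  have hd : c / 2 ≤ kernelDensity K n (fun t => regressor h ε t ω) (b n) y := by
    linarith [(abs_le.1 h4').1, hgc y hy]
  have hd0 : 0 < kernelDensity K n (fun t => regressor h ε t ω) (b n) y := by linarith
  rw [meanEstimator_sub K _ _ _ hnb.ne' hd0.ne', abs_div, abs_of_pos hd0, div_le_iff₀ hd0]
  refine le_trans ?_ (mul_le_mul_of_nonneg_left hd hη.le)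
  have hnb' := one_div_pos.2 hnb
  -- Outside the ball the model is not expanded: $\mu$ and $\sigma$ may be unbounded there, so $Q_t$
  -- itself is kept and controlled through its square.
  have e1 : 1 / (n * b n) * ∑ t ∈ Finset.Icc 1 n,
        K ((y - regressor h ε t ω) / b n) * (Q n t ω - μ y)
      = 1 / (n * b n) * ∑ t ∈ Finset.Icc 1 n, K ((y - regressor h ε t ω) / b n)
          * (B.indicator μ (regressor h ε t ω) - μ y)
        + localAverage K (B.indicator σ) id n (b n) y (fun t => regressor h ε t ω)
          (fun t => e n t ω)
        + 1 / (n * b n) * ∑ t ∈ Finset.Icc 1 n,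
          Bᶜ.indicator (fun v => K ((y - v) / b n)) (regressor h ε t ω) * Q n t ω := by
    simp only [localAverage, id]
    rw [← mul_add, ← mul_add, ← Finset.sum_add_distrib, ← Finset.sum_add_distrib]
    congr 1
    refine Finset.sum_congr rfl fun t ht => ?_
    rw [h5 t ht]
    by_cases hv : regressor h ε t ω ∈ B
    · rw [Set.indicator_of_mem hv, Set.indicator_of_mem hv,
        Set.indicator_of_notMem (Set.notMem_compl_iff.2 hv)]
      ring
    · rw [Set.indicator_of_notMem hv, Set.indicator_of_notMem hv, Set.indicator_of_mem hv]
      ring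
  have t1 : |1 / (n * b n) * ∑ t ∈ Finset.Icc 1 n, K ((y - regressor h ε t ω) / b n)
      * (B.indicator μ (regressor h ε t ω) - μ y)| ≤ η * (c / 2) / 3 := by
    refine le_trans ?_ h1'
    rw [abs_mul, abs_of_pos hnb']
    gcongr
    refine (Finset.abs_sum_le_sum_abs _ _).trans (le_of_eq ?_)
    simp_rw [abs_mul]
    rfl
  have t3 : |1 / (n * b n) * ∑ t ∈ Finset.Icc 1 n,
      Bᶜ.indicator (fun v => K ((y - v) / b n)) (regressor h ε t ω) * Q n t ω|
      ≤ η * (c / 2) / 3 := by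
    refine le_trans ?_ h3.le
    rw [abs_mul, abs_of_pos hnb']
    have hab : 0 ≤ a n * b n := (abs_nonneg _).trans (h6 ρ (le_abs_self ρ))
    have h8 : ∀ t : ℕ, |Bᶜ.indicator (fun v => K ((y - v) / b n)) (regressor h ε t ω) * Q n t ω|
        ≤ a n * b n * (1 + Q n t ω ^ 2) := by
      intro t
      rw [abs_mul]
      have h9 : |Q n t ω| ≤ 1 + Q n t ω ^ 2 := by
        rw [← sq_abs]
        nlinarith [sq_nonneg (|Q n t ω| - 1), abs_nonneg (Q n t ω)]
      refine mul_le_mul ?_ h9 (abs_nonneg _) hab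
      by_cases hv : regressor h ε t ω ∈ B
      · rw [Set.indicator_of_notMem (Set.notMem_compl_iff.2 hv), abs_zero]
        exact hab
      · rw [Set.indicator_of_mem hv]
        exact h6 _ (far_of_mem hy hv)
    calc 1 / (n * b n) * |∑ t ∈ Finset.Icc 1 n,
          Bᶜ.indicator (fun v => K ((y - v) / b n)) (regressor h ε t ω) * Q n t ω|
        ≤ 1 / (n * b n) * ∑ t ∈ Finset.Icc 1 n, a n * b n * (1 + Q n t ω ^ 2) := by
          gcongr
          exact (Finset.abs_sum_le_sum_abs _ _).trans (Finset.sum_le_sum fun t _ => h8 t)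
      _ = a n * (1 / n * ∑ t ∈ Finset.Icc 1 n, (1 + Q n t ω ^ 2)) := by
          rw [← Finset.mul_sum]
          field_simp
  rw [e1]
  refine (abs_add_three _ _ _).trans ?_
  linarith

end MeanEstimator

/-! ### Smoothing kernels -/

section SmoothingKernels

variable {K : ℝ → ℝ}

theorem IsSmoothingKernel.apply_abs (hK : IsSmoothingKernel K) (u : ℝ) : K |u| = K u := by
  rcases abs_cases u with h | h
  · rw [h.1]
  · rw [h.1, hK.symmetric]

/-- Were $K$ negative at $|u|$, monotonicity would keep it below a negative constant on a half-line,
against integrability. -/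
theorem IsSmoothingKernel.nonneg (hK : IsSmoothingKernel K) (hanti : AntitoneOn K (Set.Ici 0))
    (u : ℝ) : 0 ≤ K u := by
  rw [← hK.apply_abs]
  by_contra hneg
  rw [not_le] at hneg
  have h1 : IntegrableOn (fun _ : ℝ => K |u|) (Set.Ici |u|) := by
    refine Integrable.mono hK.integrable.integrableOn aestronglyMeasurable_const ?_
    refine (ae_restrict_iff' measurableSet_Ici).2 (Eventually.of_forall fun v hv => ?_)
    have h2 : K v ≤ K |u| := hanti (abs_nonneg u) ((abs_nonneg u).trans hv) hv
    rw [Real.norm_eq_abs, Real.norm_eq_abs, abs_of_neg hneg, abs_of_neg (h2.trans_lt hneg)]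
    linarith
  rw [integrableOn_const_iff (by simp)] at h1
  rcases h1 with h1 | h1
  · exact hneg.ne (enorm_eq_zero.1 h1)
  · simp at h1

theorem IsSmoothingKernel.apply_zero_pos (hK : IsSmoothingKernel K)
    (hanti : AntitoneOn K (Set.Ici 0)) : 0 < K 0 := by
  refine lt_of_le_of_ne (hK.nonneg hanti 0) fun h0 => ?_
  have : K = fun _ => 0 := by
    ext1 u
    refine le_antisymm ?_ (hK.nonneg hanti u)
    rw [← hK.apply_abs, h0]
    exact hanti (Set.mem_Ici.2 le_rfl) (abs_nonneg u) (abs_nonneg u)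
  have h1 := hK.integral_eq_one
  rw [this] at h1
  simp at h1

/-- By monotonicity $\int_0^{|u|}v^2K(v)\,dv\ge K(u)|u|^3/3$, so a finite second moment already
forces cubic decay. -/
theorem IsSmoothingKernel.decay_of_antitoneOn (hK : IsSmoothingKernel K)
    (hanti : AntitoneOn K (Set.Ici 0)) (u : ℝ) : |u| ^ 3 * |K u| ≤ 3 * ∫ v, v ^ 2 * K v := by
  rw [abs_of_nonneg (hK.nonneg hanti u), ← hK.apply_abs]
  have h1 : ∫ v in Set.Ioc 0 |u|, v ^ 2 * K |u| ≤ ∫ v in Set.Ioc 0 |u|, v ^ 2 * K v := by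
    refine setIntegral_mono_on ?_ hK.integrable_sq_mul.integrableOn measurableSet_Ioc
      fun v hv => ?_
    · refine (Continuous.integrableOn_Icc (by fun_prop)).mono_set Set.Ioc_subset_Icc_self
    · exact mul_le_mul_of_nonneg_left (hanti (Set.mem_Ici.2 hv.1.le) (abs_nonneg u) hv.2)
        (sq_nonneg v)
  have h2 : ∫ v in Set.Ioc 0 |u|, v ^ 2 * K v ≤ ∫ v, v ^ 2 * K v :=
    setIntegral_le_integral hK.integrable_sq_mul
      (Eventually.of_forall fun v => mul_nonneg (sq_nonneg v) (hK.nonneg hanti v))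
  rw [integral_mul_const, ← intervalIntegral.integral_of_le (abs_nonneg u), integral_pow] at h1
  norm_num at h1
  linarith

theorem IsSmoothingKernel.isTameKernel (hK : IsSmoothingKernel K)
    (hfar : HasCompactSupport K ∨ AntitoneOn K (Set.Ici 0)) : IsTameKernel K where
  lipschitz := by
    obtain ⟨L, hL⟩ := hK.lipschitz
    exact ⟨L, L.2, fun u v => by simpa only [Real.dist_eq] using hL.dist_le_mul u v⟩
  bounded := hK.bounded
  integrable := hK.integrable
  integrable_sq_mul := hK.integrable_sq_mul
  decay := by
    rcases hfar with h | h
    · obtain ⟨C, hC⟩ := hK.bounded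
      obtain ⟨R, hR⟩ := h.isCompact.isBounded.subset_closedBall 0
      refine ⟨|R| ^ 3 * C, fun u => ?_⟩
      have hC0 : 0 ≤ C := (abs_nonneg _).trans (hC 0)
      by_cases hu : u ∈ tsupport K
      · have h1 := hR hu
        rw [mem_closedBall_zero_iff, Real.norm_eq_abs] at h1
        exact mul_le_mul (pow_le_pow_left₀ (abs_nonneg u) (h1.trans (le_abs_self R)) 3) (hC u)
          (abs_nonneg _) (by positivity)
      · rw [image_eq_zero_of_notMem_tsupport hu, abs_zero, mul_zero]
        positivity
    · exact ⟨_, hK.decay_of_antitoneOn h⟩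

theorem isTameKernel_jackknifeKernel (hK : IsTameKernel K) : IsTameKernel (jackknifeKernel 2 K) := by
  have := (hK.const_mul 2).sub ((hK.comp_div (show (0 : ℝ) < √2 by positivity)).const_mul (√2)⁻¹)
  convert this using 2 with u
  simp only [jackknifeKernel]
  norm_num

theorem integral_jackknifeKernel (hK : Integrable K) (h1 : ∫ u, K u = 1) :
    ∫ u, jackknifeKernel 2 K u = 1 := by
  have hs : (0 : ℝ) < √2 := by positivity
  have e : ∀ u, jackknifeKernel 2 K u = 2 * K u - (√2)⁻¹ * K (u / √2) := fun u => by
    simp only [jackknifeKernel]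
    norm_num
  simp_rw [e]
  rw [integral_sub (hK.const_mul 2) ((hK.comp_div hs.ne').const_mul _), integral_const_mul,
    integral_const_mul, Measure.integral_comp_div, h1, abs_of_pos hs, smul_eq_mul, ← mul_assoc,
    inv_mul_cancel₀ hs.ne']
  norm_num

end SmoothingKernels

/-! ### Stability of the mean estimator at the design points -/

section Covering

variable {K : ℝ → ℝ}

theorem summable_one_div_one_add_sq : Summable fun j : ℤ => 1 / (1 + (j : ℝ) ^ 2) := by
  have h := Real.summable_one_div_int_pow.2 (show 1 < 2 by norm_num)
  refine Summable.of_norm_bounded_eventually h ?_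
  refine (Set.finite_singleton (0 : ℤ)).subset fun j hj => ?_
  by_contra hj0
  refine hj ?_
  have hj0' : (0 : ℝ) < (j : ℝ) ^ 2 := by
    have : (j : ℝ) ≠ 0 := by exact_mod_cast hj0
    positivity
  show ‖1 / (1 + (j : ℝ) ^ 2)‖ ≤ 1 / (j : ℝ) ^ 2
  rw [Real.norm_eq_abs, abs_of_nonneg (by positivity)]
  exact one_div_le_one_div_of_le hj0' (by linarith)

theorem sum_one_div_one_add_sq_sub_le (s : Finset ℤ) (m : ℤ) :
    ∑ j ∈ s, 1 / (1 + ((j - m : ℤ) : ℝ) ^ 2) ≤ ∑' j : ℤ, 1 / (1 + (j : ℝ) ^ 2) := by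
  rw [← (Equiv.subRight m).tsum_eq fun j : ℤ => 1 / (1 + (j : ℝ) ^ 2)]
  exact ((Equiv.subRight m).summable_iff.2 summable_one_div_one_add_sq).sum_le_tsum _
    fun j _ => by positivity

/-- Cut the line into cells of length $\delta c$, short enough that two points in one cell interact
with strength at least $K(0)/2$. The denominator at $X_t$ is then at least $K(0)/2$ times the number
of design points in its cell, and the numerator is $O(1/(1+j^2))$ for a cell $j$ steps from that of
$z$. Summing over a cell cancels the count, and a convergent series remains, whatever the design. -/
theorem exists_sum_kernel_ratio_le (hK : IsTameKernel K) (hK0 : 0 < K 0) (hnn : ∀ u, 0 ≤ K u) :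
    ∃ D : ℝ, 0 ≤ D ∧ ∀ (s : Finset ℕ) (X : ℕ → ℝ) (c z : ℝ), 0 < c →
      ∑ t ∈ s, K ((X t - z) / c) / ∑ r ∈ s, K ((X t - X r) / c) ≤ D := by
  obtain ⟨C, hC⟩ := hK.bounded
  obtain ⟨A, hA⟩ := hK.decay
  have hC0 : 0 ≤ C := (abs_nonneg _).trans (hC 0)
  have hA0 : 0 ≤ A := by simpa using hA 0
  obtain ⟨δ, hδ, hnear⟩ := Metric.continuous_iff.1 hK.continuous 0 (K 0 / 2) (half_pos hK0)
  have hnear' : ∀ u, |u| < δ → K 0 / 2 ≤ K u := fun u hu => by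
    have := hnear u (by simpa [Real.dist_eq] using hu)
    rw [Real.dist_eq, abs_lt] at this
    linarith [this.1]
  -- Obtained from $1+j^2\le3+2w^2/\delta^2$ together with $K\le C$ and $w^2K(w)\le C+A$, where $w$
  -- is the rescaled distance.
  set H : ℝ := 3 * C + 2 * (C + A) / δ ^ 2 with hH
  have hH0 : 0 ≤ H := by positivity
  set T : ℝ := ∑' j : ℤ, 1 / (1 + (j : ℝ) ^ 2) with hT
  have hT0 : 0 ≤ T := tsum_nonneg fun j => by positivity
  refine ⟨H / (K 0 / 2) * T, by positivity, fun s X c z hc => ?_⟩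
  set cell : ℝ → ℤ := fun v => ⌊v / (δ * c)⌋ with hcell
  have hδc : 0 < δ * c := mul_pos hδ hc
  have hcells : ∀ u v : ℝ, |(u - v) / (δ * c) - (cell u - cell v : ℤ)| < 1 := by
    intro u v
    have a1 := Int.floor_le (u / (δ * c))
    have a2 := Int.lt_floor_add_one (u / (δ * c))
    have a3 := Int.floor_le (v / (δ * c))
    have a4 := Int.lt_floor_add_one (v / (δ * c))
    rw [abs_lt, sub_div]
    push_cast
    constructor <;> simp only [hcell] <;> linarith
  have hdiv : ∀ u : ℝ, u / (δ * c) = u / c / δ := fun u => by rw [mul_comm, div_div]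
  have hnum : ∀ u v : ℝ, K ((u - v) / c) ≤ H * (1 / (1 + ((cell u - cell v : ℤ) : ℝ) ^ 2)) := by
    intro u v
    have h1 := hcells u v
    set w := (u - v) / c with hw
    set j : ℝ := ((cell u - cell v : ℤ) : ℝ) with hj
    rw [hdiv] at h1
    have h2 : j ^ 2 ≤ 2 * (w ^ 2 / δ ^ 2) + 2 := by
      have h3 : (w / δ - j) ^ 2 ≤ 1 := (sq_le_one_iff_abs_le_one _).2 h1.le
      have h4 : w ^ 2 / δ ^ 2 = (w / δ) ^ 2 := (div_pow _ _ _).symm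
      rw [h4]
      nlinarith [sq_nonneg (w / δ + (w / δ - j))]
    have h5 : w ^ 2 * K w ≤ C + A := by
      have h6 := hC w
      have h7 := hA w
      rw [abs_of_nonneg (hnn w)] at h6 h7
      by_cases hw1 : |w| ≤ 1
      · have : w ^ 2 ≤ 1 := (sq_le_one_iff_abs_le_one _).2 hw1
        nlinarith [hnn w]
      · have : w ^ 2 ≤ |w| ^ 3 := by
          rw [← sq_abs]
          exact pow_le_pow_right₀ (not_le.1 hw1).le (by norm_num)
        nlinarith [hnn w]
    rw [mul_one_div, le_div_iff₀ (by positivity)]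
    have h8 : K w ≤ C := (le_abs_self _).trans (hC w)
    calc K w * (1 + j ^ 2) ≤ K w * (3 + 2 * (w ^ 2 / δ ^ 2)) :=
          mul_le_mul_of_nonneg_left (by linarith) (hnn w)
      _ = 3 * K w + 2 * (w ^ 2 * K w) / δ ^ 2 := by ring
      _ ≤ H := by
          simp only [hH]
          gcongr
  have hden : ∀ t ∈ s, K 0 / 2 * (s.filter fun r => cell (X r) = cell (X t)).card
      ≤ ∑ r ∈ s, K ((X t - X r) / c) := by
    intro t _
    refine le_trans ?_ (Finset.sum_le_sum_of_subset_of_nonneg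
      (Finset.filter_subset (fun r => cell (X r) = cell (X t)) s) fun r _ _ => hnn _)
    rw [mul_comm, ← nsmul_eq_mul]
    refine Finset.card_nsmul_le_sum _ _ _ fun r hr => hnear' _ ?_
    have h1 := hcells (X t) (X r)
    rw [(Finset.mem_filter.1 hr).2, sub_self, Int.cast_zero, sub_zero, hdiv, abs_div,
      abs_of_pos hδ, div_lt_one hδ] at h1
    exact h1
  set N : ℤ → ℕ := fun j => (s.filter fun r => cell (X r) = j).card with hN
  have hNpos : ∀ t ∈ s, 0 < N (cell (X t)) := fun t ht =>
    Finset.card_pos.2 ⟨t, Finset.mem_filter.2 ⟨ht, rfl⟩⟩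
  calc ∑ t ∈ s, K ((X t - z) / c) / ∑ r ∈ s, K ((X t - X r) / c)
      ≤ ∑ t ∈ s, H * (1 / (1 + ((cell (X t) - cell z : ℤ) : ℝ) ^ 2))
          / (K 0 / 2 * N (cell (X t))) := by
        refine Finset.sum_le_sum fun t ht => ?_
        have := hNpos t ht
        have h1 : (0 : ℝ) < K 0 / 2 * N (cell (X t)) := by positivity
        exact div_le_div₀ (by positivity) (hnum _ _) h1 (hden t ht)
    -- Points are grouped by cell, since the summand depends on $t$ only through its cell.
    _ = ∑ j ∈ s.image fun t => cell (X t), N j •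
          (H * (1 / (1 + ((j - cell z : ℤ) : ℝ) ^ 2)) / (K 0 / 2 * N j)) :=
        Finset.sum_comp (fun j : ℤ => H * (1 / (1 + ((j - cell z : ℤ) : ℝ) ^ 2))
          / (K 0 / 2 * N j)) fun t => cell (X t)
    _ = H / (K 0 / 2) * ∑ j ∈ s.image fun t => cell (X t),
          1 / (1 + ((j - cell z : ℤ) : ℝ) ^ 2) := by
        rw [Finset.mul_sum]
        refine Finset.sum_congr rfl fun j hj => ?_
        obtain ⟨t, ht, rfl⟩ := Finset.mem_image.1 hj
        have h1 : (N (cell (X t)) : ℝ) ≠ 0 := by exact_mod_cast (hNpos t ht).ne'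
        rw [nsmul_eq_mul]
        field_simp
    _ ≤ H / (K 0 / 2) * T := by
        gcongr
        exact sum_one_div_one_add_sq_sub_le _ _

/-- The sum of squares of the mean estimator over the design points is controlled by that of the
data, uniformly in the design and the bandwidth. -/
theorem exists_sum_meanEstimator_sq_le (hK : IsTameKernel K) (hK0 : 0 < K 0)
    (hnn : ∀ u, 0 ≤ K u) :
    ∃ D : ℝ, 0 ≤ D ∧ ∀ (n : ℕ) (X Z : ℕ → ℝ) (c : ℝ), 0 < c →
      ∑ t ∈ Finset.Icc 1 n, meanEstimator K n X Z c (X t) ^ 2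
        ≤ D * ∑ t ∈ Finset.Icc 1 n, Z t ^ 2 := by
  obtain ⟨D, hD0, hD⟩ := exists_sum_kernel_ratio_le hK hK0 hnn
  refine ⟨D, hD0, fun n X Z c hc => ?_⟩
  set s := Finset.Icc 1 n with hs
  have hSpos : ∀ t ∈ s, 0 < ∑ r ∈ s, K ((X t - X r) / c) := fun t ht =>
    lt_of_lt_of_le (by simpa using hK0)
      (Finset.single_le_sum (f := fun r => K ((X t - X r) / c)) (fun r _ => hnn _) ht)
  have h1 : ∀ t ∈ s, meanEstimator K n X Z c (X t) ^ 2
      ≤ ∑ r ∈ s, Z r ^ 2 * (K ((X t - X r) / c) / ∑ r ∈ s, K ((X t - X r) / c)) := by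
    intro t ht
    have hS := hSpos t ht
    have hn : (0 : ℝ) < n := by
      have := Finset.mem_Icc.1 ht
      exact_mod_cast lt_of_lt_of_le this.1 this.2
    have e1 : meanEstimator K n X Z c (X t)
        = (∑ r ∈ s, K ((X t - X r) / c) * Z r) / ∑ r ∈ s, K ((X t - X r) / c) := by
      have : n * c * kernelDensity K n X c (X t) = ∑ r ∈ s, K ((X t - X r) / c) := by
        rw [kernelDensity, ← mul_assoc, mul_one_div_cancel (by positivity), one_mul]
      rw [meanEstimator, this, one_div_mul_eq_div]
    -- $\hat\mu(X_t)$ is a weighted average of the data with nonnegative weights, so its square is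
    -- at most the average of the squares.
    have hcs : (∑ r ∈ s, K ((X t - X r) / c) * Z r) ^ 2
        ≤ (∑ r ∈ s, K ((X t - X r) / c)) * ∑ r ∈ s, K ((X t - X r) / c) * Z r ^ 2 :=
      Finset.sum_sq_le_sum_mul_sum_of_sq_le_mul s (fun r _ => hnn _)
        (fun r _ => mul_nonneg (hnn _) (sq_nonneg _)) fun r _ => le_of_eq (by ring)
    rw [e1, div_pow, div_le_iff₀ (by positivity)]
    refine hcs.trans (le_of_eq ?_)
    have : ∀ r, Z r ^ 2 * (K ((X t - X r) / c) / ∑ r ∈ s, K ((X t - X r) / c))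
        = (K ((X t - X r) / c) * Z r ^ 2) / ∑ r ∈ s, K ((X t - X r) / c) := fun r => by ring
    simp_rw [this]
    rw [← Finset.sum_div]
    field_simp
  refine (Finset.sum_le_sum h1).trans ?_
  -- After exchanging the sums, the coefficient of $Z_r^2$ is the total influence of observation $r$
  -- on all fitted values: the ratio sum with $z=X_r$.
  rw [Finset.sum_comm, Finset.mul_sum]
  refine Finset.sum_le_sum fun r _ => ?_
  rw [← Finset.mul_sum, mul_comm]
  exact mul_le_mul_of_nonneg_right (hD s X c (X r) hc) (sq_nonneg _)

end Covering

/-! ### Contributions of distant design points -/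

section Far

variable {Ω E : Type*} [MeasurableSpace Ω] [MeasurableSpace E] {P : Measure Ω}
  [IsProbabilityMeasure P] {ε : ℤ → Ω → E} {h : (ℕ → E) → ℝ} {e Q : ℕ → ℕ → Ω → ℝ}
  {μ σ : ℝ → ℝ} {ρ : ℝ} {K : ℝ → ℝ} {b : ℕ → ℝ}

theorem eventually_model
    (hmodel : ∀ n, ∀ t ∈ Finset.Icc 1 n, ∀ᵐ ω ∂P,
      Q n t ω = μ (regressor h ε t ω) + σ (regressor h ε t ω) * e n t ω) :
    ∀ᶠ p in probFilter P, ∀ t ∈ Finset.Icc 1 p.1,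
      Q p.1 t p.2 = μ (regressor h ε t p.2) + σ (regressor h ε t p.2) * e p.1 t p.2 :=
  eventually_probFilter_of_ae fun n => (ae_ball_iff (Finset.countable_toSet _)).2 (hmodel n)

/-- With second moments, averages of the squared data stay bounded in probability. -/
theorem tendsto_mul_average_sq (hε : IsIIDInnovation P ε) (hh : Measurable h)
    (he : IsErrorArray P ε e) (hμm : Measurable μ) (hσm : Measurable σ)
    (hμi : Integrable (fun ω => μ (regressor h ε 0 ω) ^ 2) P)
    (hσi : Integrable (fun ω => σ (regressor h ε 0 ω) ^ 2) P)
    (hmodel : ∀ n, ∀ t ∈ Finset.Icc 1 n, ∀ᵐ ω ∂P,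
      Q n t ω = μ (regressor h ε t ω) + σ (regressor h ε t ω) * e n t ω)
    {a : ℕ → ℝ} (ha0 : ∀ n, 0 ≤ a n) (ha : Tendsto a atTop (𝓝 0)) :
    Tendsto (fun p : ℕ × Ω => a p.1 * (1 / p.1 * ∑ t ∈ Finset.Icc 1 p.1, (1 + Q p.1 t p.2 ^ 2)))
      (probFilter P) (𝓝 0) := by
  set V : ℕ → Ω → ℝ := fun n ω => a n * (1 / n * ∑ t ∈ Finset.Icc 1 n,
    (1 + (2 * μ (regressor h ε t ω) ^ 2 + 2 * (σ (regressor h ε t ω) ^ 2 * e n t ω ^ 2)))) with hV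
  have hid := fun t : ℤ => hε.identDistrib_regressor hh t
  have hμt : ∀ t : ℤ, Integrable (fun ω => μ (regressor h ε t ω) ^ 2) P := fun t =>
    ((hid t).comp (hμm.pow_const 2)).integrable_iff.2 hμi
  have hσt : ∀ t : ℤ, Integrable (fun ω => σ (regressor h ε t ω) ^ 2) P := fun t =>
    ((hid t).comp (hσm.pow_const 2)).integrable_iff.2 hσi
  have hsq := he.integrable_sq
  have hprod : ∀ n : ℕ, ∀ t ∈ Finset.Icc 1 n,
      Integrable (fun ω => σ (regressor h ε t ω) ^ 2 * e n t ω ^ 2) P := fun n t ht =>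
    he.integrable_mul_comp ht (u := fun ω => σ (regressor h ε t ω) ^ 2) (ζ := fun y => y ^ 2)
      (measurable_comp_regressor hh (hσm.pow_const 2) t) (hσt t) (measurable_id.pow_const 2) hsq
  have hterm : ∀ n : ℕ, ∀ t ∈ Finset.Icc 1 n, Integrable (fun ω => 1 + (2 * μ (regressor h ε t ω) ^ 2
      + 2 * (σ (regressor h ε t ω) ^ 2 * e n t ω ^ 2))) P := fun n t ht =>
    (integrable_const _).add (((hμt t).const_mul 2).add ((hprod n t ht).const_mul 2))
  have hmean : ∀ n : ℕ, ∀ t ∈ Finset.Icc 1 n, ∫ ω, (1 + (2 * μ (regressor h ε t ω) ^ 2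
      + 2 * (σ (regressor h ε t ω) ^ 2 * e n t ω ^ 2))) ∂P
      = 1 + ((2 * ∫ ω, μ (regressor h ε 0 ω) ^ 2 ∂P)
        + 2 * ∫ ω, σ (regressor h ε 0 ω) ^ 2 ∂P) := by
    intro n t ht
    have h1 : ∫ ω, μ (regressor h ε t ω) ^ 2 ∂P = ∫ ω, μ (regressor h ε 0 ω) ^ 2 ∂P :=
      ((hid t).comp (hμm.pow_const 2)).integral_eq
    have h2 : ∫ ω, σ (regressor h ε t ω) ^ 2 ∂P = ∫ ω, σ (regressor h ε 0 ω) ^ 2 ∂P :=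
      ((hid t).comp (hσm.pow_const 2)).integral_eq
    have h3 : ∫ ω, σ (regressor h ε t ω) ^ 2 * e n t ω ^ 2 ∂P
        = ∫ ω, σ (regressor h ε 0 ω) ^ 2 ∂P := by
      have := he.integral_mul_comp ht (u := fun ω => σ (regressor h ε t ω) ^ 2)
        (ζ := fun y => y ^ 2) (measurable_comp_regressor hh (hσm.pow_const 2) t) (hσt t)
        (measurable_id.pow_const 2) hsq
      rw [this, he.variance_one 1 1 one_mem_Icc_one, mul_one, h2]
    have i1 : Integrable (fun ω => 2 * μ (regressor h ε t ω) ^ 2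
        + 2 * (σ (regressor h ε t ω) ^ 2 * e n t ω ^ 2)) P :=
      ((hμt t).const_mul 2).add ((hprod n t ht).const_mul 2)
    rw [integral_add (integrable_const _) i1,
      integral_add ((hμt t).const_mul 2) ((hprod n t ht).const_mul 2), integral_const_mul,
      integral_const_mul, h1, h3]
    simp
  set m : ℝ := 1 + ((2 * ∫ ω, μ (regressor h ε 0 ω) ^ 2 ∂P)
    + 2 * ∫ ω, σ (regressor h ε 0 ω) ^ 2 ∂P)
  have hVlim : Tendsto (fun p : ℕ × Ω => V p.1 p.2) (probFilter P) (𝓝 0) := by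
    refine tendsto_probFilter_of_integral_le (c := fun n => a n * m)
      (Eventually.of_forall fun n =>
        ((integrable_finsetSum _ (hterm n)).const_mul _).const_mul _) ?_
      (by simpa using ha.mul_const m)
    filter_upwards [eventually_gt_atTop 0] with n hn
    have hn' : (n : ℝ) ≠ 0 := by exact_mod_cast hn.ne'
    have habs : ∀ ω, |V n ω| = V n ω := fun ω => abs_of_nonneg
      (mul_nonneg (ha0 n) (mul_nonneg (by positivity) (Finset.sum_nonneg fun t _ => by positivity)))
    simp_rw [habs]
    simp only [hV]
    rw [integral_const_mul, integral_const_mul, integral_finsetSum _ (hterm n),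
      Finset.sum_congr rfl (hmean n), Finset.sum_const, Nat.card_Icc, Nat.add_sub_cancel,
      nsmul_eq_mul, one_div, inv_mul_cancel_left₀ hn']
  refine squeeze_zero' (Eventually.of_forall fun p => mul_nonneg (ha0 _)
    (mul_nonneg (by positivity) (Finset.sum_nonneg fun t _ => by positivity))) ?_ hVlim
  filter_upwards [eventually_model hmodel] with p hp
  refine mul_le_mul_of_nonneg_left (mul_le_mul_of_nonneg_left
    (Finset.sum_le_sum fun t ht => ?_) (by positivity)) (ha0 _)
  rw [hp t ht]
  nlinarith [sq_nonneg (μ (regressor h ε t p.2) - σ (regressor h ε t p.2) * e p.1 t p.2)]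

/-- One sequence covers both kernel assumptions. For compact support it can be zero, since distant
weights eventually vanish and no moments are needed; for a monotone kernel it is of order $b^2$, and
second moments together with stability of the fitted values keep the averaged squares bounded in
probability. -/
theorem exists_far_sequence (hε : IsIIDInnovation P ε) (hh : Measurable h)
    (he : IsErrorArray P ε e) (hμm : Measurable μ) (hσm : Measurable σ)
    (hmodel : ∀ n, ∀ t ∈ Finset.Icc 1 n, ∀ᵐ ω ∂P,
      Q n t ω = μ (regressor h ε t ω) + σ (regressor h ε t ω) * e n t ω)
    (hK : IsSmoothingKernel K)
    (hfar : HasCompactSupport K ∨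
      (AntitoneOn K (Set.Ici 0) ∧
        Integrable (fun ω => μ (regressor h ε 0 ω) ^ 2) P ∧
        Integrable (fun ω => σ (regressor h ε 0 ω) ^ 2) P))
    (hb : IsBandwidth b) (hρ : 0 < ρ) :
    ∃ a : ℕ → ℝ,
      (∀ᶠ n in atTop, ∀ z, ρ ≤ |z| →
        |K (z / b n)| ≤ a n * b n ∧ |K (z / (√2 * b n))| ≤ a n * b n) ∧
      Tendsto (fun p : ℕ × Ω => a p.1 * (1 / p.1 * ∑ t ∈ Finset.Icc 1 p.1,
        (1 + Q p.1 t p.2 ^ 2))) (probFilter P) (𝓝 0) ∧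
      Tendsto (fun p : ℕ × Ω => a p.1 * (1 / p.1 * ∑ t ∈ Finset.Icc 1 p.1,
        (Q p.1 t p.2 - jackknifeEstimator 2 K p.1 (fun t => regressor h ε t p.2)
          (fun t => Q p.1 t p.2) (b p.1) (regressor h ε t p.2)) ^ 2)) (probFilter P) (𝓝 0) := by
  have hs2 : (0 : ℝ) < √2 := by positivity
  rcases hfar with hcomp | ⟨hanti, hμi, hσi⟩
  · refine ⟨fun _ => 0, ?_, by simpa using tendsto_const_nhds,
      by simpa using tendsto_const_nhds⟩
    obtain ⟨R, hR⟩ := hcomp.isCompact.isBounded.subset_closedBall 0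
    have hlim1 : Tendsto (fun n => b n * (|R| + 1)) atTop (𝓝 0) := by
      simpa using hb.tendsto.mul_const (|R| + 1)
    have hlim2 : Tendsto (fun n => √2 * b n * (|R| + 1)) atTop (𝓝 0) := by
      simpa using (hb.tendsto.const_mul √2).mul_const (|R| + 1)
    have hzero : ∀ c z : ℝ, 0 < c → c * (|R| + 1) < ρ → ρ ≤ |z| → K (z / c) = 0 := by
      intro c z hc hcR hz
      refine image_eq_zero_of_notMem_tsupport fun hmem => ?_
      have h1 := hR hmem
      rw [mem_closedBall_zero_iff, Real.norm_eq_abs, abs_div, abs_of_pos hc, div_le_iff₀ hc] at h1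
      nlinarith [le_abs_self R]
    filter_upwards [hb.pos, hlim1.eventually (gt_mem_nhds hρ), hlim2.eventually (gt_mem_nhds hρ)]
      with n h1 h2 h3 z hz
    rw [hzero _ z h1 h2 hz, hzero _ z (mul_pos hs2 h1) h3 hz]
    simp
  · have hKt := hK.isTameKernel (Or.inr hanti)
    obtain ⟨A, hA0, hA⟩ := hKt.exists_decay
    have hnn := hK.nonneg hanti
    obtain ⟨D, hD0, hD⟩ := exists_sum_meanEstimator_sq_le hKt (hK.apply_zero_pos hanti) hnn
    -- The factor $\sqrt2^3$ comes from the larger bandwidth $\sqrt2\,b$, at which the decay bound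
    -- is weaker.
    set a : ℕ → ℝ := fun n => A / ρ ^ 3 * (√2 ^ 3 * b n ^ 2) with ha
    have ha0 : ∀ n, 0 ≤ a n := fun n => by positivity
    have halim : Tendsto a atTop (𝓝 0) := by
      simpa using ((hb.tendsto.pow 2).const_mul (√2 ^ 3)).const_mul (A / ρ ^ 3)
    have hQ := tendsto_mul_average_sq hε hh he hμm hσm hμi hσi hmodel ha0 halim
    refine ⟨a, ?_, hQ, ?_⟩
    · filter_upwards [hb.pos] with n hn z hz
      have h1 := hA ρ hρ _ hn z hz
      have h2 := hA ρ hρ _ (mul_pos hs2 hn) z hz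
      have h3 : a n * b n = A / ρ ^ 3 * (√2 * b n) ^ 3 := by simp only [ha]; ring
      rw [h3]
      refine ⟨h1.trans ?_, h2⟩
      have h4 : b n ≤ √2 * b n := by
        have : (1 : ℝ) ≤ √2 := Real.one_le_sqrt.2 (by norm_num)
        nlinarith
      gcongr
    · have hQ' : Tendsto (fun p : ℕ × Ω => (3 + 15 * D) * (a p.1 * (1 / p.1 *
          ∑ t ∈ Finset.Icc 1 p.1, (1 + Q p.1 t p.2 ^ 2)))) (probFilter P) (𝓝 0) := by
        simpa using hQ.const_mul (3 + 15 * D)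
      refine squeeze_zero' (Eventually.of_forall fun p => mul_nonneg (ha0 _)
        (mul_nonneg (by positivity) (Finset.sum_nonneg fun t _ => sq_nonneg _))) ?_ hQ'
      filter_upwards [tendsto_fst_probFilter.eventually hb.pos] with ⟨n, ω⟩ hn
      simp only at hn ⊢
      have h1 := hD n (fun t => regressor h ε t ω) (fun t => Q n t ω) (b n) hn
      have h2 := hD n (fun t => regressor h ε t ω) (fun t => Q n t ω) (√2 * b n) (mul_pos hs2 hn)
      -- This is $(p+q+r)^2\le3(p^2+q^2+r^2)$ with the jackknife weights $2$ and $1$; stability at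
      -- the two bandwidths then produces $3+12D+3D$.
      have hpt : ∀ q u v : ℝ, (q - (2 * u - v) / (2 - 1)) ^ 2 ≤ 3 * q ^ 2 + 12 * u ^ 2 + 3 * v ^ 2 := by
        intro q u v
        norm_num
        nlinarith [sq_nonneg (q + 2 * u), sq_nonneg (q - v), sq_nonneg (2 * u + v)]
      have h3 : ∑ t ∈ Finset.Icc 1 n, (Q n t ω - jackknifeEstimator 2 K n
          (fun t => regressor h ε t ω) (fun t => Q n t ω) (b n) (regressor h ε t ω)) ^ 2
          ≤ (3 + 15 * D) * ∑ t ∈ Finset.Icc 1 n, (1 + Q n t ω ^ 2) := by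
        refine (Finset.sum_le_sum fun t _ => hpt _ _ _).trans ?_
        rw [Finset.sum_add_distrib, Finset.sum_add_distrib, ← Finset.mul_sum, ← Finset.mul_sum,
          ← Finset.mul_sum]
        have h4 : ∑ t ∈ Finset.Icc 1 n, Q n t ω ^ 2 ≤ ∑ t ∈ Finset.Icc 1 n, (1 + Q n t ω ^ 2) :=
          Finset.sum_le_sum fun t _ => by linarith
        have h5 := mul_le_mul_of_nonneg_left h4 (show 0 ≤ 3 + 15 * D by positivity)
        linarith
      calc a n * (1 / n * ∑ t ∈ Finset.Icc 1 n, (Q n t ω - jackknifeEstimator 2 K n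
            (fun t => regressor h ε t ω) (fun t => Q n t ω) (b n) (regressor h ε t ω)) ^ 2)
          ≤ a n * (1 / n * ((3 + 15 * D) * ∑ t ∈ Finset.Icc 1 n, (1 + Q n t ω ^ 2))) := by
            have := ha0 n
            gcongr
        _ = _ := by ring

end Far

/-! ### Consistency of the variance estimator -/

section Variance

variable {Ω E : Type*} [MeasurableSpace Ω] [MeasurableSpace E] {P : Measure Ω}
  [IsProbabilityMeasure P] {ε : ℤ → Ω → E} {h : (ℕ → E) → ℝ}

theorem HasBoundedFourthDeriv.continuousOn {f : ℝ → ℝ} {s : Set ℝ}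
    (hf : HasBoundedFourthDeriv f s) : ContinuousOn f s := fun y hy => by
  have := hf.1 0 (by norm_num) y hy
  rw [iteratedDeriv_zero] at this
  exact this.continuousAt.continuousWithinAt

/-- Since $\log n\ge1$ eventually, the rate condition forces $nb^3\to\infty$. Eventual positivity of
$b$ comes from $nb\to\infty$. -/
theorem isBandwidth_of_tendsto {b : ℕ → ℝ} (hb : Tendsto b atTop (𝓝 0))
    (hnb : Tendsto (fun n : ℕ => n * b n) atTop atTop)
    (hnb3 : Tendsto (fun n : ℕ => Real.log n / (n * b n ^ 3)) atTop (𝓝 0)) : IsBandwidth b := by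
  have hpos : ∀ᶠ n in atTop, 0 < b n := by
    filter_upwards [hnb.eventually_gt_atTop 0] with n hn
    exact pos_of_mul_pos_right hn (Nat.cast_nonneg n)
  refine ⟨hpos, hb, tendsto_atTop.2 fun C => ?_⟩
  have hlog : Tendsto (fun n : ℕ => Real.log n) atTop atTop :=
    Real.tendsto_log_atTop.comp tendsto_natCast_atTop_atTop
  filter_upwards [hpos, hlog.eventually_ge_atTop 1, eventually_gt_atTop 0,
    hnb3.eventually (gt_mem_nhds (show (0 : ℝ) < 1 / (|C| + 1) by positivity))]
    with n h1 h2 h3 h4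
  have h5 : (0 : ℝ) < n * b n ^ 3 := by
    have : (0 : ℝ) < n := by exact_mod_cast h3
    positivity
  rw [div_lt_div_iff₀ h5 (by positivity), one_mul] at h4
  nlinarith [le_abs_self C, abs_nonneg C]

theorem isLocalDesign_regressor (hε : IsIIDInnovation P ε) (hh : Measurable h) {g : ℝ → ℝ}
    (hg : IsDensityOf P (regressor h ε 0) g) {γ : ℕ → ℝ → (ℕ → E) → ℝ}
    (hγ : IsCondDensity P ε (regressor h ε) γ) (hΘ : totalDependence P ε γ < ∞) {x ρ : ℝ}
    (hρ : 0 < ρ) (hgc : ContinuousOn g (Metric.closedBall x (2 * ρ))) :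
    IsLocalDesign P (fun t : ℕ => regressor h ε (t : ℤ)) g x ρ where
  measurable t := measurable_regressor hε.measurable hh t
  identDistrib t := hε.identDistrib_regressor hh t
  density := hg
  pos := hρ
  continuousOn := hgc
  moment := ⟨_, fun _ hφ ⟨_, hC⟩ hφi n => integral_sum_regressor_sq_le hε hh hγ hΘ hφ hC hφi n⟩

/-- Replacing the residuals by estimated ones, in a weighted sum of squares. -/
theorem abs_weighted_sq_sub_le {w s u d η : ℝ} (hη1 : η ≤ 1) (hd : |d| ≤ η) :
    |w * ((s * u + d) ^ 2 - s ^ 2 * u ^ 2)| ≤ η * (|w| * (s ^ 2 * u ^ 2) + 2 * |w|) := by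
  have hη0 : 0 ≤ η := (abs_nonneg d).trans hd
  have h1 : |(s * u + d) ^ 2 - s ^ 2 * u ^ 2| ≤ η * (s ^ 2 * u ^ 2 + 2) := by
    have e : (s * u + d) ^ 2 - s ^ 2 * u ^ 2 = d * (2 * (s * u) + d) := by ring
    rw [e, abs_mul]
    refine mul_le_mul hd ?_ (abs_nonneg _) hη0
    refine (abs_add_le _ _).trans ?_
    rw [abs_mul, abs_two, ← mul_pow, ← sq_abs (s * u)]
    nlinarith [sq_nonneg (|s * u| - 1)]
  rw [abs_mul]
  calc |w| * |(s * u + d) ^ 2 - s ^ 2 * u ^ 2| ≤ |w| * (η * (s ^ 2 * u ^ 2 + 2)) := by gcongr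
    _ = _ := by ring

/-- The numerator is compared with the local average of $\sigma^2(X_t)e_t^2$ over the design points
near $x$. The difference is a small multiple of a bounded local average, plus the contribution of
distant points. -/
theorem tendsto_varianceEstimator {g : ℝ → ℝ} {x ρ : ℝ}
    (hX : IsLocalDesign P (fun t : ℕ => regressor h ε (t : ℤ)) g x ρ)
    (hε : IsIIDInnovation P ε) (hh : Measurable h) {e : ℕ → ℕ → Ω → ℝ} (he : IsErrorArray P ε e)
    {μ σ : ℝ → ℝ} (hμm : Measurable μ) (hσm : Measurable σ)
    (hμ : ContinuousOn μ (Metric.closedBall x (2 * ρ)))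
    (hσ : ContinuousOn σ (Metric.closedBall x (2 * ρ)))
    {Q : ℕ → ℕ → Ω → ℝ}
    (hmodel : ∀ n, ∀ t ∈ Finset.Icc 1 n, ∀ᵐ ω ∂P,
      Q n t ω = μ (regressor h ε t ω) + σ (regressor h ε t ω) * e n t ω)
    {K : ℝ → ℝ} (hK : IsSmoothingKernel K)
    (hfar : HasCompactSupport K ∨
      (AntitoneOn K (Set.Ici 0) ∧
        Integrable (fun ω => μ (regressor h ε 0 ω) ^ 2) P ∧
        Integrable (fun ω => σ (regressor h ε 0 ω) ^ 2) P))
    {b : ℕ → ℝ} (hb : IsBandwidth b) {c : ℝ} (hc : 0 < c)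
    (hgc : ∀ v ∈ Metric.closedBall x ρ, c ≤ g v) :
    Tendsto (fun p : ℕ × Ω => varianceEstimator K p.1 (fun t => regressor h ε t p.2)
      (fun t => Q p.1 t p.2) (b p.1) x) (probFilter P) (𝓝 (σ x ^ 2)) := by
  have hρ := hX.pos
  have hs2 : (0 : ℝ) < √2 := by positivity
  have hKt : IsTameKernel K := hK.isTameKernel (hfar.imp_right fun h => h.1)
  set K2 := jackknifeKernel 2 K with hK2
  have hK2t : IsTameKernel K2 := isTameKernel_jackknifeKernel hKt
  have hK2one : ∫ u, K2 u = 1 := integral_jackknifeKernel hK.integrable hK.integral_eq_one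
  set I := Metric.closedBall x ρ with hI
  have hIm : MeasurableSet I := Metric.isClosed_closedBall.measurableSet
  have hxI : x ∈ I := Metric.mem_closedBall_self hρ.le
  have hIB : I ⊆ Metric.closedBall x (2 * ρ) :=
    Metric.closedBall_subset_closedBall (by linarith)
  -- The cut-off is at radius $\rho$, not $2\rho$: the mean estimator is uniformly close to $\mu$
  -- only on the smaller ball.
  set Ψ : ℝ → ℝ := I.indicator fun v => σ v ^ 2 with hΨ
  have hσ2 : ContinuousOn (fun v => σ v ^ 2) I := (hσ.mono hIB).pow 2
  have hΨm : Measurable Ψ := (hσm.pow_const 2).indicator hIm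
  obtain ⟨M, hM0, hM⟩ := exists_bound_indicator hσ2
  have hΨsupp : ∀ v ∉ Metric.closedBall x (2 * ρ), Ψ v = 0 := fun v hv =>
    Set.indicator_of_notMem (fun hvI => hv (hIB hvI)) _
  have hΨnear : UniformlyContinuousNear Ψ {x} := by
    have := uniformlyContinuousNear_indicator (R' := 0) hρ hσ2
    rwa [Metric.closedBall_zero] at this
  have hΨx : Ψ x = σ x ^ 2 := Set.indicator_of_mem hxI _
  have hgx : 0 < g x := hc.trans_le (hgc x hxI)
  obtain ⟨a, haK, haQ, haJ⟩ := exists_far_sequence hε hh he hμm hσm hmodel hK hfar hb hρ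
  have hb' := hb.const_mul hs2
  -- the leading term
  have hmain := hX.tendsto_localAverage_sq he hε.measurable hh hK2t hb hΨm hM hΨsupp hΨnear
  rw [hK2one, mul_one, hΨx] at hmain
  have habs := hX.tendsto_localAverage_sq he hε.measurable hh hK2t.abs hb hΨm hM hΨsupp hΨnear
  set W : ℝ := Ψ x * (g x * ∫ u, |K2 u|) with hW
  obtain ⟨D, hD0, hD⟩ := hX.exists_kernelDensity_abs_le hK2t hb
  -- the numerator
  set num : ℕ × Ω → ℝ := fun p => 1 / (p.1 * b p.1) * ∑ t ∈ Finset.Icc 1 p.1,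
    K2 ((x - regressor h ε t p.2) / b p.1) * (Q p.1 t p.2 - jackknifeEstimator 2 K p.1
      (fun t => regressor h ε t p.2) (fun t => Q p.1 t p.2) (b p.1) (regressor h ε t p.2)) ^ 2
    with hnum
  have hrem : Tendsto (fun p : ℕ × Ω => num p - localAverage K2 Ψ (fun u => u ^ 2) p.1 (b p.1) x
      (fun t => regressor h ε t p.2) (fun t => e p.1 t p.2)) (probFilter P) (𝓝 0) := by
    rw [Metric.tendsto_nhds]
    intro η hη
    have hW0 : 0 ≤ W := by
      rw [hW, hΨx]
      have : 0 ≤ ∫ u, |K2 u| := integral_nonneg fun _ => abs_nonneg _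
      positivity
    -- Accuracy $\eta'$ at both bandwidths gives the jackknife accuracy $2\eta'+\eta'=3\eta'$. It
    -- multiplies a quantity below $W+1+2D$, so near points cost at most $\eta/3$.
    obtain ⟨η', hη'0, hη'1, hη'⟩ : ∃ η' : ℝ, 0 < η' ∧ 3 * η' ≤ 1 ∧
        3 * η' * (W + 1 + 2 * D) ≤ η / 3 := by
      refine ⟨min (1 / 3) (η / (9 * (W + 1 + 2 * D))), by positivity, ?_, ?_⟩
      · linarith [min_le_left (1 / 3) (η / (9 * (W + 1 + 2 * D)))]
      · have h1 := min_le_right (1 / 3) (η / (9 * (W + 1 + 2 * D)))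
        rw [le_div_iff₀ (by positivity)] at h1
        linarith
    have hm1 := hX.eventually_meanEstimator he hε.measurable hh hKt hK.integral_eq_one hb hc hgc
      hσm hμ hσ hmodel (haK.mono fun n hn z hz => (hn z hz).1) haQ hη'0
    have hm2 := hX.eventually_meanEstimator he hε.measurable hh hKt hK.integral_eq_one hb' hc hgc
      hσm hμ hσ hmodel (a := a) (by
        filter_upwards [haK, hb.pos] with n hn hbn z hz
        refine ((hn z hz).2).trans ?_
        have h1 : 0 ≤ a n * b n := (abs_nonneg _).trans (hn z hz).2
        have h2 : (1 : ℝ) ≤ √2 := Real.one_le_sqrt.2 (by norm_num)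
        nlinarith) haQ hη'0
    filter_upwards [hm1, hm2, eventually_model hmodel, hD,
      habs.eventually (gt_mem_nhds (lt_add_one W)),
      haJ.eventually (gt_mem_nhds (show (0 : ℝ) < η / 9 by positivity)),
      tendsto_fst_probFilter.eventually haK,
      tendsto_fst_probFilter.eventually hb.eventually_pos] with ⟨n, ω⟩ h1 h2 h3 h4 h5 h6 h7 h8
    obtain ⟨hb0, hb1, hn0, hnb⟩ := h8
    simp only at h3 h5 h6 h7 hb0 hn0 hnb
    have h4' := h4 x hxI
    simp only at h4'
    have hnb' := one_div_pos.2 hnb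
    set X : ℕ → ℝ := fun t => regressor h ε t ω with hXdef
    set J : ℕ → ℝ := fun t => jackknifeEstimator 2 K n X (fun t => Q n t ω) (b n) (X t) with hJ
    set w : ℕ → ℝ := fun t => K2 ((x - X t) / b n) with hw
    have hab : 0 ≤ a n * b n := (abs_nonneg _).trans (h7 ρ (le_abs_self ρ)).1
    -- Near points use the closeness of the fitted value to $\mu$, distant points the smallness of
    -- the weight; adding both nonnegative bounds gives one inequality valid for every $t$.
    have hpt : ∀ t ∈ Finset.Icc 1 n,
        |w t * (Q n t ω - J t) ^ 2 - w t * Ψ (X t) * e n t ω ^ 2|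
        ≤ 3 * η' * (|w t| * Ψ (X t) * e n t ω ^ 2 + 2 * |w t|)
          + 3 * (a n * b n) * (Q n t ω - J t) ^ 2 := by
      intro t ht
      by_cases hv : X t ∈ I
      · have h9 : |μ (X t) - J t| ≤ 3 * η' := by
          have h10 := h1 (X t) hv
          have h11 := h2 (X t) hv
          have e1 : μ (X t) - J t = (meanEstimator K n X (fun t => Q n t ω) (√2 * b n) (X t)
              - μ (X t)) - 2 * (meanEstimator K n X (fun t => Q n t ω) (b n) (X t)
              - μ (X t)) := by
            simp only [hJ, jackknifeEstimator]
            norm_num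
            ring
          rw [e1]
          refine (abs_sub _ _).trans ?_
          rw [abs_mul, abs_two]
          simp only at h10 h11
          linarith
        have e2 : Q n t ω - J t = σ (X t) * e n t ω + (μ (X t) - J t) := by
          rw [h3 t ht]; ring
        have h12 := abs_weighted_sq_sub_le (w := w t) (s := σ (X t)) (u := e n t ω) hη'1 h9
        rw [← e2] at h12
        have e3 : Ψ (X t) = σ (X t) ^ 2 := Set.indicator_of_mem hv _
        rw [e3]
        have h13 : 0 ≤ 3 * (a n * b n) * (Q n t ω - J t) ^ 2 := by positivity
        rw [mul_sub] at h12
        refine le_trans (le_of_eq ?_) (h12.trans (le_trans (le_of_eq ?_)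
          (le_add_of_nonneg_right h13)))
        · congr 1; ring
        · ring
      · have e3 : Ψ (X t) = 0 := Set.indicator_of_notMem hv _
        have hz : ρ ≤ |x - X t| := by
          rw [hI, Metric.mem_closedBall, dist_comm, Real.dist_eq, not_le] at hv
          exact hv.le
        obtain ⟨k1, k2⟩ := h7 _ hz
        -- $3=2+1$, from the coefficients $2$ and $1/\sqrt2\le1$ in $K_2$.
        have hw3 : |w t| ≤ 3 * (a n * b n) := by
          have e4 : w t = 2 * K ((x - X t) / b n) - (√2)⁻¹ * K ((x - X t) / (√2 * b n)) := by
            simp only [hw, hK2, jackknifeKernel]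
            rw [div_div, mul_comm (b n)]
            norm_num
          have h14 : (√2)⁻¹ ≤ 1 := inv_le_one_of_one_le₀ (Real.one_le_sqrt.2 (by norm_num))
          rw [e4]
          refine (abs_sub _ _).trans ?_
          rw [abs_mul, abs_mul, abs_two, abs_of_pos (inv_pos.2 hs2)]
          have := mul_le_mul h14 k2 (abs_nonneg _) zero_le_one
          linarith
        rw [e3, mul_zero, zero_mul, sub_zero, abs_mul, abs_of_nonneg (sq_nonneg (Q n t ω - J t))]
        have h13 : 0 ≤ 3 * η' * (|w t| * 0 * e n t ω ^ 2 + 2 * |w t|) := by positivity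
        have := mul_le_mul_of_nonneg_right hw3 (sq_nonneg (Q n t ω - J t))
        linarith
    have e5 : num (n, ω) - localAverage K2 Ψ (fun u => u ^ 2) n (b n) x X (fun t => e n t ω)
        = 1 / (n * b n) * ∑ t ∈ Finset.Icc 1 n,
          (w t * (Q n t ω - J t) ^ 2 - w t * Ψ (X t) * e n t ω ^ 2) := by
      rw [Finset.sum_sub_distrib, mul_sub]
      rfl
    have h15 : localAverage (fun u => |K2 u|) Ψ (fun u => u ^ 2) n (b n) x X (fun t => e n t ω)
        = 1 / (n * b n) * ∑ t ∈ Finset.Icc 1 n, |w t| * Ψ (X t) * e n t ω ^ 2 := rfl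
    rw [Real.dist_eq, sub_zero]
    simp only
    rw [e5, abs_mul, abs_of_pos hnb']
    rw [h15] at h5
    calc 1 / (n * b n) * |∑ t ∈ Finset.Icc 1 n,
          (w t * (Q n t ω - J t) ^ 2 - w t * Ψ (X t) * e n t ω ^ 2)|
        ≤ 1 / (n * b n) * ∑ t ∈ Finset.Icc 1 n,
          (3 * η' * (|w t| * Ψ (X t) * e n t ω ^ 2 + 2 * |w t|)
          + 3 * (a n * b n) * (Q n t ω - J t) ^ 2) := by
          gcongr
          exact (Finset.abs_sum_le_sum_abs _ _).trans (Finset.sum_le_sum hpt)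
      _ = 3 * η' * (1 / (n * b n) * ∑ t ∈ Finset.Icc 1 n, |w t| * Ψ (X t) * e n t ω ^ 2
            + 2 * (1 / (n * b n) * ∑ t ∈ Finset.Icc 1 n, |w t|))
          + 3 * (a n * (1 / n * ∑ t ∈ Finset.Icc 1 n, (Q n t ω - J t) ^ 2)) := by
          rw [Finset.sum_add_distrib, ← Finset.mul_sum, ← Finset.mul_sum, Finset.sum_add_distrib,
            ← Finset.mul_sum]
          field_simp
      _ ≤ 3 * η' * (W + 1 + 2 * D) + 3 * (η / 9) := by
          gcongr
      _ < η := by linarith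
  have hnumlim : Tendsto num (probFilter P) (𝓝 (σ x ^ 2 * g x)) := by
    have := hrem.add hmain
    rw [zero_add] at this
    exact this.congr fun p => sub_add_cancel _ _
  have hden := hX.tendsto_kernelDensity hKt hb
  rw [hK.integral_eq_one, mul_one] at hden
  have := hnumlim.div hden hgx.ne'
  rw [mul_div_cancel_right₀ _ hgx.ne'] at this
  refine this.congr fun p => ?_
  simp only [Pi.div_apply, hnum, varianceEstimator, hK2]
  rw [one_div, one_div, mul_inv, div_eq_mul_inv]
  ring

end Variance

end

theorem mainTheorem4
    {Ω E ι : Type*} [MeasurableSpace Ω] [MeasurableSpace E]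
    (P : Measure Ω) [IsProbabilityMeasure P]
    -- the regressor process
    (ε : ℤ → Ω → E) (hε : IsIIDInnovation P ε)
    (h : (ℕ → E) → ℝ) (hh : Measurable h)
    -- density, conditional densities given the past, short-range dependence
    (g : ℝ → ℝ) (hg : IsDensityOf P (regressor h ε 0) g)
    (γ : ℕ → ℝ → (ℕ → E) → ℝ) (hγ : IsCondDensity P ε (regressor h ε) γ)
    (hΘ : totalDependence P ε γ < ∞)
    -- replicated observations and their sample quantiles
    (τ : ℝ) (hτ : τ ∈ Set.Ioo (0 : ℝ) 1)
    (Γ : ℕ → ℕ → Finset ι)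
    (hΓ : ∀ t, 1 ≤ t → Tendsto (fun n => (Γ n t).card) atTop atTop)
    (Y : ℕ → ℕ → ι → Ω → ℝ) (Q : ℕ → ℕ → Ω → ℝ)
    (hQ : ∀ n, ∀ t ∈ Finset.Icc 1 n, ∀ᵐ ω ∂P,
      IsSampleQuantile τ (Γ n t) (fun j => Y n t j ω) (Q n t ω))
    -- the regression model
    (μ σ : ℝ → ℝ) (hμ : Measurable μ) (hσ : Measurable σ) (hσ_pos : ∀ y, 0 < σ y)
    (e : ℕ → ℕ → Ω → ℝ) (he : IsErrorArray P ε e)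
    (hmodel : ∀ n, ∀ t ∈ Finset.Icc 1 n, ∀ᵐ ω ∂P,
      Q n t ω = μ (regressor h ε t ω) + σ (regressor h ε t ω) * e n t ω)
    -- kernel and bandwidth
    (K : ℝ → ℝ) (hK : IsSmoothingKernel K)
    (hfar : HasCompactSupport K ∨
      (AntitoneOn K (Set.Ici 0) ∧
        Integrable (fun ω => μ (regressor h ε 0 ω) ^ 2) P ∧
        Integrable (fun ω => σ (regressor h ε 0 ω) ^ 2) P))
    (b : ℕ → ℝ) (hb : Tendsto b atTop (𝓝 0))
    (hnb : Tendsto (fun n : ℕ => n * b n) atTop atTop)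
    (hnb3 : Tendsto (fun n : ℕ => Real.log n / (n * b n ^ 3)) atTop (𝓝 0))
    -- the point of estimation
    (x : ℝ) (hx : IsFavourable P ε γ μ σ g x) :
    TendstoInMeasure P
      (fun (n : ℕ) (ω : Ω) => varianceEstimator K n (fun t => regressor h ε t ω)
        (fun t => Q n t ω) (b n) x)
      atTop (fun _ => σ x ^ 2) := by
  -- Taking $\rho=r/4$ places the closed ball of radius $2\rho$ inside the open favourable ball, so
  -- continuity holds on a compact set.
  obtain ⟨r, hr, hμr, hσr, hgr, -, ⟨c, hc, hgc⟩, -⟩ := hx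
  have hsub : Metric.closedBall x (2 * (r / 4)) ⊆ Metric.ball x r :=
    Metric.closedBall_subset_ball (by linarith)
  have hsub' : Metric.closedBall x (r / 4) ⊆ Metric.ball x r :=
    Metric.closedBall_subset_ball (by linarith)
  have hX := isLocalDesign_regressor hε hh hg hγ hΘ (show 0 < r / 4 by positivity)
    (hgr.continuousOn.mono hsub)
  exact tendstoInMeasure_of_tendsto_probFilter
    (tendsto_varianceEstimator hX hε hh he hμ hσ (hμr.continuousOn.mono hsub)
      (hσr.continuousOn.mono hsub) hmodel hK hfar (isBandwidth_of_tendsto hb hnb hnb3) hc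
      fun v hv => hgc v (hsub' hv))
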